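/- Let $\alpha>0$ and let $\mathfrak k_\alpha$ be the seven-dimensional real Lie algebra with basis $(e_1,\dots,e_7)$ and dual basis $(e^1,\dots,e^7)$ whose structure equations are ($e^{ij\cdots}=e^i\wedge e^j\wedge\cdots$, $d$ the Chevalley–Eilenberg differential) $$(de^1,\dots,de^7)=\Big(-\alpha e^{17},\,-2e^{35},\,-e^{25}-e^{57},\,\tfrac{\alpha}{2}e^{47}-e^{67},\,e^{23}+e^{37},\,e^{47}+\tfrac{\alpha}{2}e^{67},\,0\Big).$$ (a) $\mathfrak k_\alpha$ is unimodular, non-solvable and isomorphic to $\mathfrak{sl}(2,\mathbb R)\oplus\mathfrak r'_{4,\alpha,-\alpha/2}$, where $\mathfrak r'_{4,\gamma,\delta}$ has the brackets $[f_4,f_1]=\gamma f_1$, $[f_4,f_2]=\delta f_2-f_3$, $[f_4,f_3]=f_2+\delta f_3$; and for $\alpha,\beta>0$, $\mathfrak k_\alpha\cong\mathfrak k_\beta$ only if $\alpha=\beta$. (b) The 3-form $\varphi_\alpha=\frac{\alpha}{2}(e^{127}+e^{347}+e^{567})+e^{135}-e^{146}-e^{236}-e^{245}$ is a closed $\mathrm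 G_2$-structure on $\mathfrak k_\alpha$. That is, $d\varphi_\alpha=0$ and, with $b_\varphi(u,v)=\frac16\,\iota_u\varphi\wedge\iota_v\varphi\wedge\varphi$, the volume form $dV_\varphi=\det(b_\varphi)^{1/9}$ is nonzero and $g_\varphi=\det(b_\varphi)^{-1/9}b_\varphi$ is positive definite. It induces $g_{\varphi_\alpha}=\sum_{i=1}^6(e^i)^2+\frac{\alpha^2}{4}(e^7)^2$ and $dV_{\varphi_\alpha}=\frac{\alpha}{2}e^{1234567}$. Its intrinsic torsion form, i.e. the unique 2-form $\tau$ with $d{*_\varphi}\varphi=\tau\wedge\varphi=-{*_\varphi}\tau$, is $\tau_\alpha=4e^{12}-2e^{34}-2e^{56}$. (c) Let $\lambda=6$ and $D=\mathrm{diag}(2,0,0,-4,0,-4,0)$ with respect to $(e_1,\dots,e_7)$. Then $D$ is a derivation of $\mathfrak k_\alpha$ and $$\mathrm{Ric}(g_\varphi)-\tfrac1{12}\mathrm{tr}(\tau_\varphi^2)\,\mathrm{Id}+\tfrac12\tau_\varphi^2=-\tfrac{\lambda}{3}\mathrm{Id}-D \qquad(\mathrm{AS})$$ for $\varphi=\varphi_\alpha$,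 where $\mathrm{Ric}(g_\varphi)$ is the Ricci endomorphism and $\tau_\varphi$ is the skew endomorphism with $\tau(\cdot,\cdot)=g_\varphi(\tau_\varphi\cdot,\cdot)$; the $g_\varphi$-adjoint of $D$ is also a derivation. So $\varphi_\alpha$ is an algebraic soliton on $\mathfrak k_\alpha$, and it is expanding ($\lambda>0$). (d) The left-invariant form $\varphi$ induced by $\varphi_\alpha$ on the simply connected non-solvable Lie group $G$ with Lie algebra $\mathfrak k_\alpha$ is an expanding Laplacian soliton: $\varphi$ is a closed $\mathrm G_2$-structure on $G$ and $$\Delta_\varphi\varphi=6\,\varphi+\mathcal L_{X_D}\varphi,$$ where $X_D$ is the vector field whose flow is the one-parameter group of automorphisms $F_t$ of $G$ with $dF_t|_1=\exp(tD)$. More precisely: such a group $G$, not solvable as a group, with such a field $X_D$ exists; and the equation holds for every simply connected Lie group $G$ with every identification of its Lie algebra with $\mathfrak k_\alpha$ and every such field $X_D$ on it. -/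

import Mathlib

open scoped Manifold ContDiff Topology

noncomputable section

/-! ### Alternating forms on a real vector space -/

namespace G2

section Forms

variable {V : Type*} [AddCommGroup V] [Module ℝ V]

/-- The wedge product of alternating forms, normalised by shuffles, so that
`(θ ∧ η)(u, v) = θ u * η v - θ v * η u` for one-forms. -/
def wedge {k l : ℕ} (a : V [⋀^Fin k]→ₗ[ℝ] ℝ) (b : V [⋀^Fin l]→ₗ[ℝ] ℝ) :
    V [⋀^Fin (k + l)]→ₗ[ℝ] ℝ :=
  ((LinearMap.mul' ℝ ℝ).compAlternatingMap (a.domCoprod b)).domDomCongr finSumFinEquiv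

theorem wedge_eq {k l : ℕ} (a : V [⋀^Fin k]→ₗ[ℝ] ℝ) (b : V [⋀^Fin l]→ₗ[ℝ] ℝ) :
    wedge a b = ((LinearMap.mul' ℝ ℝ).compAlternatingMap
      (AlternatingMap.domCoprod' (a ⊗ₜ[ℝ] b))).domDomCongr finSumFinEquiv := rfl

theorem wedge_add_left {k l : ℕ} (a a' : V [⋀^Fin k]→ₗ[ℝ] ℝ) (b : V [⋀^Fin l]→ₗ[ℝ] ℝ) :
    wedge (a + a') b = wedge a b + wedge a' b := by
  ext v; simp [wedge_eq, TensorProduct.add_tmul]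

theorem wedge_add_right {k l : ℕ} (a : V [⋀^Fin k]→ₗ[ℝ] ℝ) (b b' : V [⋀^Fin l]→ₗ[ℝ] ℝ) :
    wedge a (b + b') = wedge a b + wedge a b' := by
  ext v; simp [wedge_eq, TensorProduct.tmul_add]

theorem wedge_smul_left {k l : ℕ} (c : ℝ) (a : V [⋀^Fin k]→ₗ[ℝ] ℝ) (b : V [⋀^Fin l]→ₗ[ℝ] ℝ) :
    wedge (c • a) b = c • wedge a b := by
  ext v
  simp only [wedge_eq, ← TensorProduct.smul_tmul', map_smul]
  simp

theorem wedge_smul_right {k l : ℕ} (c : ℝ) (a : V [⋀^Fin k]→ₗ[ℝ] ℝ) (b : V [⋀^Fin l]→ₗ[ℝ] ℝ) :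
    wedge a (c • b) = c • wedge a b := by
  ext v
  simp only [wedge_eq, TensorProduct.tmul_smul, map_smul]
  simp

/-- For a basis `e` with dual basis `(e^i)` the form `e^{i_1} ∧ ⋯ ∧ e^{i_k}`, i.e.
`(v_1, …, v_k) ↦ det (e^{i_a}(v_b))`. -/
def basisForm {n k : ℕ} (e : Module.Basis (Fin n) ℝ V) (i : Fin k → Fin n) :
    V [⋀^Fin k]→ₗ[ℝ] ℝ :=
  Matrix.detRowAlternating.compLinearMap (LinearMap.pi fun a => e.coord (i a))

/-- The iterated interior product `v ↦ η (u_1, …, u_k, v)`. -/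
def contract {m : ℕ} : (k : ℕ) → (Fin k → V) → V [⋀^Fin (m + k)]→ₗ[ℝ] ℝ → V [⋀^Fin m]→ₗ[ℝ] ℝ
  | 0, _, η => η
  | k + 1, u, η => contract k (Fin.tail u) (AlternatingMap.curryLeft η (u 0))

/-- The bilinear form `(x, y) ↦ τ (x, y)` of a two-form. -/
def toBilin (τ : V [⋀^Fin 2]→ₗ[ℝ] ℝ) : LinearMap.BilinForm ℝ V :=
  LinearMap.mk₂ ℝ (fun x y => τ ![x, y])
    (fun x x' y => τ.map_vecCons_add ![y] x x')
    (fun c x y => τ.map_vecCons_smul ![y] c x)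
    (fun x y y' => (AlternatingMap.curryLeft τ x).map_vecCons_add ![] y y')
    (fun c x y => (AlternatingMap.curryLeft τ x).map_vecCons_smul ![] c y)

end Forms

/-! ### Inner products, Hodge star, and the metric of a three-form in dimension seven -/

section Seven

variable {V : Type*} [AddCommGroup V] [Module ℝ V] [hV : Fact (Module.finrank ℝ V = 7)]

instance (priority := low) instFiniteOfFinrankSeven : FiniteDimensional ℝ V :=
  Module.finite_of_finrank_pos (by rw [hV.out]; norm_num)

variable (V) in
/-- Some basis of a seven-dimensional space. The notions defined through it below do not
depend on its choice. -/
def someBasis : Module.Basis (Fin 7) ℝ V := Module.finBasisOfFinrankEq ℝ V hV.out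

open Classical in
/-- The musical isomorphism of a nondegenerate bilinear form: `g (sharp g θ) v = θ v`. -/
def sharp (g : LinearMap.BilinForm ℝ V) : Module.Dual ℝ V →ₗ[ℝ] V :=
  if h : g.Nondegenerate then (g.toDual h).symm.toLinearMap else 0

/-- The Hodge star of an inner product `g` and a volume form `vol`:
`(⋆β)_{J} = (1/k!) ∑_I β^{I} vol_{I J}`, where the indices of `β` are raised with `g`. Thus
`α ∧ ⋆β = g(α, β) vol`. -/
def hodgeStar (g : LinearMap.BilinForm ℝ V) (vol : V [⋀^Fin 7]→ₗ[ℝ] ℝ) {k m : ℕ}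
    (h : m + k = 7) (β : V [⋀^Fin k]→ₗ[ℝ] ℝ) : V [⋀^Fin m]→ₗ[ℝ] ℝ :=
  ((k.factorial : ℝ)⁻¹) • ∑ i : Fin k → Fin 7,
    β (fun a => sharp g ((someBasis V).coord (i a))) •
      contract k (fun a => someBasis V (i a)) (vol.domDomCongr (finCongr h.symm))

/-- `b_φ(u, v) = (1/6) ι_u φ ∧ ι_v φ ∧ φ`. -/
def bForm (φ : V [⋀^Fin 3]→ₗ[ℝ] ℝ) (u v : V) : V [⋀^Fin 7]→ₗ[ℝ] ℝ :=
  (1 / 6 : ℝ) • wedge (wedge (AlternatingMap.curryLeft φ u) (AlternatingMap.curryLeft φ v)) φ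

/-- The real bilinear form expressing `b_φ` in terms of the generator
`e^1 ∧ ⋯ ∧ e^7` of `Λ^7 V^*`, for the chosen basis. -/
def bBilin (φ : V [⋀^Fin 3]→ₗ[ℝ] ℝ) : LinearMap.BilinForm ℝ V :=
  LinearMap.mk₂ ℝ (fun u v => bForm φ u v (someBasis V))
    (fun u u' v => by
      simp only [bForm, map_add, wedge_add_left, smul_add, AlternatingMap.add_apply])
    (fun c u v => by
      simp only [bForm, map_smul, wedge_smul_left, AlternatingMap.smul_apply, smul_eq_mul]
      ring)
    (fun u v v' => by
      simp only [bForm, map_add, wedge_add_left, wedge_add_right, smul_add,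
        AlternatingMap.add_apply])
    (fun c u v => by
      simp only [bForm, map_smul, wedge_smul_left, wedge_smul_right, AlternatingMap.smul_apply,
        smul_eq_mul]
      ring)

/-- The coefficient of `det(b_φ)^{1/9}` with respect to `e^1 ∧ ⋯ ∧ e^7`: the real ninth root of
the determinant of the matrix of `b_φ`. -/
def volCoeff (φ : V [⋀^Fin 3]→ₗ[ℝ] ℝ) : ℝ :=
  let δ : ℝ := (LinearMap.BilinForm.toMatrix (someBasis V) (bBilin φ)).det
  Real.sign δ * |δ| ^ (1 / 9 : ℝ)

/-- `dV_φ = det(b_φ)^{1/9}`. -/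
def volForm (φ : V [⋀^Fin 3]→ₗ[ℝ] ℝ) : V [⋀^Fin 7]→ₗ[ℝ] ℝ :=
  volCoeff φ • basisForm (someBasis V) id

/-- `g_φ = det(b_φ)^{-1/9} b_φ`. -/
def metric (φ : V [⋀^Fin 3]→ₗ[ℝ] ℝ) : LinearMap.BilinForm ℝ V :=
  (volCoeff φ)⁻¹ • bBilin φ

/-- `φ` defines a `G₂`-structure: `det(b_φ)^{1/9} ≠ 0` and `g_φ` is positive definite. -/
def IsG2Structure (φ : V [⋀^Fin 3]→ₗ[ℝ] ℝ) : Prop :=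
  volForm φ ≠ 0 ∧ ∀ v : V, v ≠ 0 → 0 < metric φ v v

/-- The Hodge star of the metric and orientation induced by `φ`. -/
def starOf (φ : V [⋀^Fin 3]→ₗ[ℝ] ℝ) {k m : ℕ} (h : m + k = 7) (β : V [⋀^Fin k]→ₗ[ℝ] ℝ) :
    V [⋀^Fin m]→ₗ[ℝ] ℝ :=
  hodgeStar (metric φ) (volForm φ) h β

end Seven

/-! ### Lie algebras -/

section LieAlg

variable {𝔤 : Type*} [LieRing 𝔤] [LieAlgebra ℝ 𝔤]

/-- The map `(x, y) ↦ ι_{[x, y]} θ`. -/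
def bracketContract {n : ℕ} (θ : 𝔤 [⋀^Fin (n + 1)]→ₗ[ℝ] ℝ) :
    𝔤 →ₗ[ℝ] 𝔤 →ₗ[ℝ] 𝔤 [⋀^Fin n]→ₗ[ℝ] ℝ :=
  LinearMap.mk₂ ℝ (fun x y => AlternatingMap.curryLeft θ ⁅x, y⁆)
    (fun x x' y => by rw [add_lie, map_add])
    (fun c x y => by rw [smul_lie, map_smul])
    (fun x y y' => by rw [lie_add, map_add])
    (fun c x y => by rw [lie_smul, map_smul])

/-- The Chevalley–Eilenberg differential (trivial coefficients); see `ceDiff_apply` for the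
usual formula. -/
def ceDiff {n : ℕ} (θ : 𝔤 [⋀^Fin (n + 1)]→ₗ[ℝ] ℝ) : 𝔤 [⋀^Fin (n + 2)]→ₗ[ℝ] ℝ :=
  (-(1 / 2) : ℝ) • AlternatingMap.alternatizeUncurryFin
    (AlternatingMap.alternatizeUncurryFinLM ∘ₗ bracketContract θ)

/-- `dθ(v_0, …, v_{n+1}) = ∑_{i<j} (-1)^{i+j} θ([v_i, v_j], …, v̂_i, …, v̂_j, …)`. The pair
`i ≤ j` in the sum below stands for the pair of positions `i < j + 1`, which accounts for the sign
in front. -/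
theorem ceDiff_apply {n : ℕ} (θ : 𝔤 [⋀^Fin (n + 1)]→ₗ[ℝ] ℝ) (v : Fin (n + 2) → 𝔤) :
    ceDiff θ v = -∑ i : Fin (n + 1), ∑ j ≥ i, (-1 : ℤ) ^ (i + j : ℕ) •
      θ (Matrix.vecCons ⁅v i.castSucc, v j.succ⁆ (j.removeNth <| i.castSucc.removeNth v)) := by
  have key : ∀ i j : Fin (n + 1),
      bracketContract θ (v i.castSucc) (v j.succ) (j.removeNth <| i.castSucc.removeNth v) -
        bracketContract θ (v j.succ) (v i.castSucc) (j.removeNth <| i.castSucc.removeNth v) =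
      2 * θ (Matrix.vecCons ⁅v i.castSucc, v j.succ⁆
        (j.removeNth <| i.castSucc.removeNth v)) := by
    intro i j
    simp only [bracketContract, LinearMap.mk₂_apply]
    have h := θ.map_vecCons_smul (j.removeNth <| i.castSucc.removeNth v) (-1 : ℝ)
      ⁅v i.castSucc, v j.succ⁆
    rw [neg_one_smul, lie_skew] at h
    rw [AlternatingMap.curryLeft_apply_apply, AlternatingMap.curryLeft_apply_apply, h]
    simp only [smul_eq_mul]
    ring
  simp only [ceDiff, AlternatingMap.smul_apply,
    AlternatingMap.alternatizeUncurryFin_alternatizeUncurryFinLM_comp_apply, key, smul_eq_mul,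
    Finset.mul_sum, ← Finset.sum_neg_distrib]
  refine Finset.sum_congr rfl fun i _ => Finset.sum_congr rfl fun j _ => ?_
  simp only [zsmul_eq_mul]
  ring

/-- Unimodularity: all `ad x` are trace-free. -/
def IsUnimodular (𝔤 : Type*) [LieRing 𝔤] [LieAlgebra ℝ 𝔤] : Prop :=
  ∀ x : 𝔤, LinearMap.trace ℝ 𝔤 (LieAlgebra.ad ℝ 𝔤 x) = 0

/-- The functional `z ↦ (1/2)(g([x,y],z) - g([y,z],x) + g([z,x],y))` of the Koszul formula. -/
def koszul (g : LinearMap.BilinForm ℝ 𝔤) (x y : 𝔤) : Module.Dual ℝ 𝔤 :=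
  (1 / 2 : ℝ) • (g ⁅x, y⁆ - g.flip x ∘ₗ (LieAlgebra.ad ℝ 𝔤 y : 𝔤 →ₗ[ℝ] 𝔤)
    - g.flip y ∘ₗ (LieAlgebra.ad ℝ 𝔤 x : 𝔤 →ₗ[ℝ] 𝔤))

theorem koszul_apply (g : LinearMap.BilinForm ℝ 𝔤) (x y z : 𝔤) :
    koszul g x y z = (1 / 2) * (g ⁅x, y⁆ z - g ⁅y, z⁆ x + g ⁅z, x⁆ y) := by
  have h : g ⁅x, z⁆ y = - g ⁅z, x⁆ y := by rw [← lie_skew, map_neg, LinearMap.neg_apply]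
  simp [koszul, h]

variable [Fact (Module.finrank ℝ 𝔤 = 7)]

/-- The Levi-Civita connection of the left-invariant metric `g`, on left-invariant fields:
`g(∇_x y, z) = koszul g x y z`. -/
def nabla (g : LinearMap.BilinForm ℝ 𝔤) : 𝔤 →ₗ[ℝ] 𝔤 →ₗ[ℝ] 𝔤 :=
  LinearMap.mk₂ ℝ (fun x y => sharp g (koszul g x y))
    (fun x x' y => by
      rw [← map_add]; congr 1; ext z
      simp only [koszul_apply, LinearMap.add_apply, add_lie, lie_add, map_add]; ring)
    (fun c x y => by
      rw [← map_smul]; congr 1; ext z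
      simp only [koszul_apply, LinearMap.smul_apply, smul_lie, lie_smul, map_smul, smul_eq_mul]
      ring)
    (fun x y y' => by
      rw [← map_add]; congr 1; ext z
      simp only [koszul_apply, LinearMap.add_apply, add_lie, lie_add, map_add]; ring)
    (fun c x y => by
      rw [← map_smul]; congr 1; ext z
      simp only [koszul_apply, LinearMap.smul_apply, smul_lie, lie_smul, map_smul, smul_eq_mul]
      ring)

/-- The curvature `R(x, y) = ∇_x ∇_y - ∇_y ∇_x - ∇_{[x, y]}`. -/
def curvature (g : LinearMap.BilinForm ℝ 𝔤) : 𝔤 →ₗ[ℝ] 𝔤 →ₗ[ℝ] 𝔤 →ₗ[ℝ] 𝔤 :=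
  LinearMap.mk₂ ℝ
    (fun x y => nabla g x ∘ₗ nabla g y - nabla g y ∘ₗ nabla g x - nabla g ⁅x, y⁆)
    (fun x x' y => by
      ext z; simp only [LinearMap.sub_apply, LinearMap.comp_apply, LinearMap.add_apply, map_add,
        add_lie]; abel)
    (fun c x y => by
      ext z; simp only [LinearMap.sub_apply, LinearMap.comp_apply, LinearMap.smul_apply, map_smul,
        smul_lie, smul_sub])
    (fun x y y' => by
      ext z; simp only [LinearMap.sub_apply, LinearMap.comp_apply, LinearMap.add_apply, map_add,
        lie_add]; abel)
    (fun c x y => by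
      ext z; simp only [LinearMap.sub_apply, LinearMap.comp_apply, LinearMap.smul_apply, map_smul,
        lie_smul, smul_sub])

/-- The Ricci tensor `ric(x, y) = tr (z ↦ R(z, x) y)`. -/
def ricciForm (g : LinearMap.BilinForm ℝ 𝔤) : LinearMap.BilinForm ℝ 𝔤 :=
  LinearMap.mk₂ ℝ (fun x y => LinearMap.trace ℝ 𝔤 (((curvature g).flip x).flip y))
    (fun x x' y => by
      rw [← map_add]; congr 1; ext z; simp)
    (fun c x y => by
      rw [← map_smul]; congr 1; ext z; simp)
    (fun x y y' => by
      rw [← map_add]; congr 1; ext z; simp)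
    (fun c x y => by
      rw [← map_smul]; congr 1; ext z; simp)

/-- The Ricci endomorphism: `g(Ric x, y) = ric(x, y)`. -/
def ricci (g : LinearMap.BilinForm ℝ 𝔤) : 𝔤 →ₗ[ℝ] 𝔤 := sharp g ∘ₗ ricciForm g

/-- The endomorphism `τ_φ` with `τ(x, y) = g_φ(τ_φ x, y)`. -/
def torsionEnd (φ : 𝔤 [⋀^Fin 3]→ₗ[ℝ] ℝ) (τ : 𝔤 [⋀^Fin 2]→ₗ[ℝ] ℝ) : 𝔤 →ₗ[ℝ] 𝔤 :=
  sharp (metric φ) ∘ₗ toBilin τ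

/-- `φ` defines a closed `G₂`-structure on the Lie algebra. -/
def IsClosedG2Structure (φ : 𝔤 [⋀^Fin 3]→ₗ[ℝ] ℝ) : Prop :=
  IsG2Structure φ ∧ ceDiff φ = 0

/-- `d ⋆φ = τ ∧ φ = -⋆τ`. -/
def IsTorsionForm (φ : 𝔤 [⋀^Fin 3]→ₗ[ℝ] ℝ) (τ : 𝔤 [⋀^Fin 2]→ₗ[ℝ] ℝ) : Prop :=
  ceDiff (starOf φ (m := 4) rfl φ) = wedge τ φ ∧ wedge τ φ = -starOf φ (m := 5) rfl τ

/-- `Ric(g_φ) - (1/12) tr(τ_φ²) Id + (1/2) τ_φ² = -(λ/3) Id - D`. -/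
def SatisfiesAS (φ : 𝔤 [⋀^Fin 3]→ₗ[ℝ] ℝ) (τ : 𝔤 [⋀^Fin 2]→ₗ[ℝ] ℝ) (lam : ℝ)
    (D : 𝔤 →ₗ[ℝ] 𝔤) : Prop :=
  ricci (metric φ)
      - ((1 / 12 : ℝ) * LinearMap.trace ℝ 𝔤 (torsionEnd φ τ ∘ₗ torsionEnd φ τ)) • LinearMap.id
      + (1 / 2 : ℝ) • (torsionEnd φ τ ∘ₗ torsionEnd φ τ)
    = (-(lam / 3)) • LinearMap.id - D

/-- `φ` is an algebraic soliton on the Lie algebra with constant `λ` and derivation `D`: a closed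
`G₂`-structure whose torsion form satisfies the soliton equation, where the adjoint of `D` with
respect to `g_φ` is a derivation as well. -/
def IsAlgebraicSoliton (φ : 𝔤 [⋀^Fin 3]→ₗ[ℝ] ℝ) (lam : ℝ) (D : LieDerivation ℝ 𝔤 𝔤) : Prop :=
  IsClosedG2Structure φ ∧
  (∃ τ, IsTorsionForm φ τ ∧ SatisfiesAS φ τ lam D) ∧
  ∃ D' : LieDerivation ℝ 𝔤 𝔤, ∀ x y, metric φ (D x) y = metric φ x (D' y)

end LieAlg

/-! ### Differential forms and Laplacian solitons on seven-manifolds -/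

section Manifolds

variable {M : Type*} [TopologicalSpace M] [ChartedSpace (EuclideanSpace ℝ (Fin 7)) M]

instance instFactFinrankTangentSpace (x : M) :
    Fact (Module.finrank ℝ (TangentSpace (𝓡 7) x) = 7) :=
  ⟨(finrank_euclideanSpace_fin : Module.finrank ℝ (EuclideanSpace ℝ (Fin 7)) = 7)⟩

variable (M) in
/-- Fields of alternating `k`-forms on `M`. -/
abbrev DiffForm (k : ℕ) : Type _ := (x : M) → TangentSpace (𝓡 7) x [⋀^Fin k]→ₗ[ℝ] ℝ

theorem continuous_of_alternating {k : ℕ}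
    (θ : EuclideanSpace ℝ (Fin 7) [⋀^Fin k]→ₗ[ℝ] ℝ) : Continuous θ := by
  let e := (EuclideanSpace.basisFun (Fin 7) ℝ).toBasis
  have h : ∀ v : Fin k → EuclideanSpace ℝ (Fin 7),
      θ v = ∑ r : Fin k → Fin 7, (∏ i, e.repr (v i) (r i)) * θ (fun i => e (r i)) := by
    intro v
    have h1 : v = fun i => ∑ j, e.repr (v i) j • e j := by
      funext i; exact (e.sum_repr (v i)).symm
    conv_lhs => rw [h1]
    have h2 := θ.toMultilinearMap.map_sum (fun i j => e.repr (v i) j • e j)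
    refine h2.trans (Finset.sum_congr rfl fun r _ => ?_)
    exact θ.toMultilinearMap.map_smul_univ (fun i => e.repr (v i) (r i)) (fun i => e (r i))
  have h' : (θ : (Fin k → EuclideanSpace ℝ (Fin 7)) → ℝ) = fun v =>
      ∑ r : Fin k → Fin 7, (∏ i, (v i) (r i)) * θ (fun i => e (r i)) := by
    funext v; simpa [e] using h v
  rw [h']
  fun_prop

/-- An alternating form on `ℝ⁷`, as a continuous alternating form. -/
def toContinuous {k : ℕ} (θ : EuclideanSpace ℝ (Fin 7) [⋀^Fin k]→ₗ[ℝ] ℝ) :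
    EuclideanSpace ℝ (Fin 7) [⋀^Fin k]→L[ℝ] ℝ :=
  { θ with cont := continuous_of_alternating θ }

/-- The coordinate representation of a form in the chart at `c`: its pullback by the inverse of
the chart. -/
def localRep {k : ℕ} (θ : DiffForm M k) (c : M) (y : EuclideanSpace ℝ (Fin 7)) :
    EuclideanSpace ℝ (Fin 7) [⋀^Fin k]→L[ℝ] ℝ :=
  toContinuous ((θ ((extChartAt (𝓡 7) c).symm y)).compLinearMap
    (mfderiv (𝓡 7) (𝓡 7) (extChartAt (𝓡 7) c).symm y).toLinearMap)

/-- Smoothness of a form, in charts. -/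
def IsSmoothForm {k : ℕ} (θ : DiffForm M k) : Prop :=
  ∀ c : M, ContDiffOn ℝ ∞ (localRep θ c) (extChartAt (𝓡 7) c).target

/-- The exterior derivative, computed at `x` in the chart at `x`. -/
def extD {k : ℕ} (θ : DiffForm M k) : DiffForm M (k + 1) := fun x =>
  (extDeriv (localRep θ x) (extChartAt (𝓡 7) x x)).toAlternatingMap.compLinearMap
    (mfderiv (𝓡 7) (𝓡 7) (extChartAt (𝓡 7) x) x).toLinearMap

/-- The pullback of a form by a map. -/
def pullback {k : ℕ} (f : M → M) (θ : DiffForm M k) : DiffForm M k := fun x =>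
  (θ (f x)).compLinearMap (mfderiv (𝓡 7) (𝓡 7) f x).toLinearMap

/-- The Hodge star of a three-form `φ`, pointwise. -/
def starM (φ : DiffForm M 3) {k m : ℕ} (h : m + k = 7) (θ : DiffForm M k) : DiffForm M m :=
  fun x => starOf (φ x) h (θ x)

/-- The codifferential `δ = (-1)^k ⋆ d ⋆` on `k`-forms, `k = l + 1`, in dimension seven. -/
def codiff (φ : DiffForm M 3) {l m : ℕ} (h : m + (l + 1) = 7) (θ : DiffForm M (l + 1)) :
    DiffForm M l :=
  fun x => (-1 : ℝ) ^ (l + 1) •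
    starM φ (k := m + 1) (by omega) (extD (starM φ h θ)) x

/-- The Hodge Laplacian `Δ_φ = d δ + δ d` on three-forms. -/
def hodgeLaplacian (φ : DiffForm M 3) (θ : DiffForm M 3) : DiffForm M 3 :=
  fun x => extD (codiff φ (l := 2) (m := 4) rfl θ) x + codiff φ (l := 3) (m := 3) rfl (extD θ) x

/-- `F` is a flow of the vector field `X` for small times near `x`. -/
def IsLocalFlowAt (X : (x : M) → TangentSpace (𝓡 7) x) (x : M) (F : ℝ → M → M) : Prop :=
  ∃ ε > (0 : ℝ), ∃ U ∈ 𝓝 x,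
    ContMDiffOn (𝓘(ℝ, ℝ).prod (𝓡 7)) (𝓡 7) ∞ (fun p : ℝ × M => F p.1 p.2)
      (Set.Ioo (-ε) ε ×ˢ U) ∧
    ∀ y ∈ U, F 0 y = y ∧ IsMIntegralCurveOn (I := 𝓡 7) (fun t => F t y) X (Set.Ioo (-ε) ε)

/-- `η = (L_X θ)_x`: the derivative at `t = 0` of `(F_t^* θ)_x`, for the flow `F` of `X`. -/
def HasLieDerivAt {k : ℕ} (X : (x : M) → TangentSpace (𝓡 7) x) (θ : DiffForm M k) (x : M)
    (η : TangentSpace (𝓡 7) x [⋀^Fin k]→ₗ[ℝ] ℝ) : Prop :=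
  ∃ F : ℝ → M → M, IsLocalFlowAt X x F ∧
    ∀ v : Fin k → TangentSpace (𝓡 7) x,
      HasDerivAt (fun t => pullback (F t) θ x v) (η v) 0

/-- `φ` is a closed `G₂`-structure on `M`, `X` is a smooth vector field, and
`Δ_φ φ = λ φ + L_X φ`. The soliton is expanding when `λ > 0`. -/
def IsLaplacianSoliton [IsManifold (𝓡 7) ∞ M] (φ : DiffForm M 3) (lam : ℝ)
    (X : (x : M) → TangentSpace (𝓡 7) x) : Prop :=
  (IsSmoothForm φ ∧ (∀ x, IsG2Structure (φ x)) ∧ ∀ x, extD φ x = 0) ∧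
  ContMDiff (𝓡 7) (𝓡 7).tangent ∞ (fun x => (⟨x, X x⟩ : TangentBundle (𝓡 7) M)) ∧
  ∃ η : DiffForm M 3, (∀ x, HasLieDerivAt X φ x (η x)) ∧
    ∀ x, hodgeLaplacian φ φ x = lam • φ x + η x

end Manifolds

/-! ### Lie groups with a given Lie algebra -/

instance instLEInftyMinSmoothness : ENat.LEInfty (minSmoothness ℝ 3) :=
  ⟨by rw [minSmoothness_of_isRCLikeNormedField]; exact ENat.LEInfty.out⟩

section Groups

variable {G : Type*} [TopologicalSpace G] [ChartedSpace (EuclideanSpace ℝ (Fin 7)) G] [Group G]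
  [LieGroup (𝓡 7) ∞ G]
  {𝔤 : Type*} [LieRing 𝔤] [LieAlgebra ℝ 𝔤] [Fact (Module.finrank ℝ 𝔤 = 7)]

/-- The left-invariant form on `G` induced by a form on its Lie algebra `𝔤`, identified with
`T_1 G` by `ψ`: the value at `x` is the pullback of `θ` by the derivative of left translation
by `x⁻¹`. -/
def leftInvariantForm {k : ℕ} (ψ : 𝔤 ≃ₗ⁅ℝ⁆ GroupLieAlgebra (𝓡 7) G)
    (θ : 𝔤 [⋀^Fin k]→ₗ[ℝ] ℝ) : DiffForm G k := fun x =>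
  θ.compLinearMap ((ψ.symm : GroupLieAlgebra (𝓡 7) G →ₗ[ℝ] 𝔤) ∘ₗ
    (mfderiv (𝓡 7) (𝓡 7) (fun y : G => x⁻¹ * y) x).toLinearMap)

/-- The exponential of an endomorphism, through its matrix. -/
def expEnd (A : 𝔤 →ₗ[ℝ] 𝔤) : 𝔤 →ₗ[ℝ] 𝔤 :=
  Matrix.toLin (someBasis 𝔤) (someBasis 𝔤)
    (NormedSpace.exp (LinearMap.toMatrix (someBasis 𝔤) (someBasis 𝔤) A))

/-- `F` is a (smooth) one-parameter group of automorphisms of `G` with `dF_t|_1 = exp(tD)`. -/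
structure IsOneParameterGroupOf (ψ : 𝔤 ≃ₗ⁅ℝ⁆ GroupLieAlgebra (𝓡 7) G) (D : 𝔤 →ₗ[ℝ] 𝔤)
    (F : ℝ → G → G) : Prop where
  smooth : ContMDiff (𝓘(ℝ, ℝ).prod (𝓡 7)) (𝓡 7) ∞ (fun p : ℝ × G => F p.1 p.2)
  map_mul : ∀ t x y, F t (x * y) = F t x * F t y
  zero : ∀ x, F 0 x = x
  add : ∀ s t x, F (s + t) x = F s (F t x)
  deriv_one : ∀ (t : ℝ) (v : 𝔤),
    (mfderiv (𝓡 7) (𝓡 7) (F t) (1 : G) (ψ v) : EuclideanSpace ℝ (Fin 7)) = ψ (expEnd (t • D) v)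

/-- `X = X_D`: the vector field on `G` whose flow is the one-parameter group of automorphisms
generated by the derivation `D`. -/
def IsVectorFieldOf (ψ : 𝔤 ≃ₗ⁅ℝ⁆ GroupLieAlgebra (𝓡 7) G) (D : 𝔤 →ₗ[ℝ] 𝔤)
    (X : (x : G) → TangentSpace (𝓡 7) x) : Prop :=
  ∃ F : ℝ → G → G, IsOneParameterGroupOf ψ D F ∧
    ∀ x, IsMIntegralCurve (I := 𝓡 7) (fun t => F t x) X

end Groups

end G2

/-! ### The Lie algebras -/

/-- The underlying space of the Lie algebra `𝔨_α`. -/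
def KAlg (_α : ℝ) : Type := Fin 7 → ℝ

namespace KAlg

instance (α : ℝ) : AddCommGroup (KAlg α) := inferInstanceAs (AddCommGroup (Fin 7 → ℝ))
instance (α : ℝ) : Module ℝ (KAlg α) := inferInstanceAs (Module ℝ (Fin 7 → ℝ))

/-- The basis `(e_1, …, e_7)`, indexed by `0, …, 6`. -/
def basis (α : ℝ) : Module.Basis (Fin 7) ℝ (KAlg α) := Pi.basisFun ℝ (Fin 7)

instance (α : ℝ) : Fact (Module.finrank ℝ (KAlg α) = 7) :=
  ⟨by rw [Module.finrank_eq_card_basis (basis α)]; rfl⟩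

/-- `e^{ij}(x, y)`, with indices `1, …, 7` as on paper. -/
def w (x y : Fin 7 → ℝ) (i j : ℕ) (hi : i - 1 < 7 := by decide) (hj : j - 1 < 7 := by decide) : ℝ :=
  x ⟨i - 1, hi⟩ * y ⟨j - 1, hj⟩ - x ⟨j - 1, hj⟩ * y ⟨i - 1, hi⟩

/-- The tuple `(de^1(x, y), …, de^7(x, y))` of structure equations of `𝔨_α`. -/
def structureEq (α : ℝ) (x y : Fin 7 → ℝ) : Fin 7 → ℝ :=
  ![-α * w x y 1 7,
    -2 * w x y 3 5,
    -w x y 2 5 - w x y 5 7,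
    α / 2 * w x y 4 7 - w x y 6 7,
    w x y 2 3 + w x y 3 7,
    w x y 4 7 + α / 2 * w x y 6 7,
    0]

theorem structureEq_add_left (α : ℝ) (x y z : Fin 7 → ℝ) :
    structureEq α (x + y) z = structureEq α x z + structureEq α y z := by
  funext k; fin_cases k <;> simp [structureEq, w] <;> ring

theorem structureEq_add_right (α : ℝ) (x y z : Fin 7 → ℝ) :
    structureEq α x (y + z) = structureEq α x y + structureEq α x z := by
  funext k; fin_cases k <;> simp [structureEq, w] <;> ring

theorem structureEq_self (α : ℝ) (x : Fin 7 → ℝ) : structureEq α x x = 0 := by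
  funext k; fin_cases k <;> simp [structureEq, w, mul_comm]

theorem structureEq_smul_right (α c : ℝ) (x y : Fin 7 → ℝ) :
    structureEq α x (c • y) = c • structureEq α x y := by
  funext k; fin_cases k <;> simp [structureEq, w] <;> ring

theorem structureEq_jacobi (α : ℝ) (x y z : Fin 7 → ℝ) :
    -structureEq α x (-structureEq α y z) =
      -structureEq α (-structureEq α x y) z + -structureEq α y (-structureEq α x z) := by
  funext k; fin_cases k <;> simp [structureEq, w] <;> ring

/-- The bracket is determined by `e^k([x, y]) = -de^k(x, y)`. -/
instance (α : ℝ) : LieRing (KAlg α) where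
  bracket x y := -structureEq α x y
  add_lie x y z := (congrArg Neg.neg (structureEq_add_left α x y z)).trans (neg_add _ _)
  lie_add x y z := (congrArg Neg.neg (structureEq_add_right α x y z)).trans (neg_add _ _)
  lie_self x := (congrArg Neg.neg (structureEq_self α x)).trans neg_zero
  leibniz_lie x y z := structureEq_jacobi α x y z

instance (α : ℝ) : LieAlgebra ℝ (KAlg α) where
  lie_smul c x y :=
    (congrArg Neg.neg (structureEq_smul_right α c x y)).trans (smul_neg c (structureEq α x y)).symm

/-- `φ_α = (α/2)(e^127 + e^347 + e^567) + e^135 - e^146 - e^236 - e^245`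
(indices shifted by one). -/
def phi (α : ℝ) : KAlg α [⋀^Fin 3]→ₗ[ℝ] ℝ :=
  (α / 2) • (G2.basisForm (basis α) ![0, 1, 6] + G2.basisForm (basis α) ![2, 3, 6]
      + G2.basisForm (basis α) ![4, 5, 6])
    + G2.basisForm (basis α) ![0, 2, 4] - G2.basisForm (basis α) ![0, 3, 5]
    - G2.basisForm (basis α) ![1, 2, 5] - G2.basisForm (basis α) ![1, 3, 4]

/-- `τ_α = 4 e^12 - 2 e^34 - 2 e^56` (indices shifted by one). -/
def tau (α : ℝ) : KAlg α [⋀^Fin 2]→ₗ[ℝ] ℝ :=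
  (4 : ℝ) • G2.basisForm (basis α) ![0, 1] - (2 : ℝ) • G2.basisForm (basis α) ![2, 3]
    - (2 : ℝ) • G2.basisForm (basis α) ![4, 5]

end KAlg

/-- The underlying space of the Lie algebra `𝔯'_{4,γ,δ}`. -/
def RAlg (_γ _δ : ℝ) : Type := Fin 4 → ℝ

namespace RAlg

instance (γ δ : ℝ) : AddCommGroup (RAlg γ δ) := inferInstanceAs (AddCommGroup (Fin 4 → ℝ))
instance (γ δ : ℝ) : Module ℝ (RAlg γ δ) := inferInstanceAs (Module ℝ (Fin 4 → ℝ))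

/-- `[e_4, e_1] = γ e_1`, `[e_4, e_2] = δ e_2 - e_3`, `[e_4, e_3] = e_2 + δ e_3`; the other brackets
of basis vectors vanish. -/
def br (γ δ : ℝ) (x y : Fin 4 → ℝ) : Fin 4 → ℝ :=
  ![γ * (x 3 * y 0 - x 0 * y 3),
    δ * (x 3 * y 1 - x 1 * y 3) + (x 3 * y 2 - x 2 * y 3),
    -(x 3 * y 1 - x 1 * y 3) + δ * (x 3 * y 2 - x 2 * y 3),
    0]

theorem br_add_left (γ δ : ℝ) (x y z : Fin 4 → ℝ) :
    br γ δ (x + y) z = br γ δ x z + br γ δ y z := by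
  funext k; fin_cases k <;> simp [br] <;> ring

theorem br_add_right (γ δ : ℝ) (x y z : Fin 4 → ℝ) :
    br γ δ x (y + z) = br γ δ x y + br γ δ x z := by
  funext k; fin_cases k <;> simp [br] <;> ring

theorem br_self (γ δ : ℝ) (x : Fin 4 → ℝ) : br γ δ x x = 0 := by
  funext k; fin_cases k <;> simp [br, mul_comm]

theorem br_smul_right (γ δ c : ℝ) (x y : Fin 4 → ℝ) : br γ δ x (c • y) = c • br γ δ x y := by
  funext k; fin_cases k <;> simp [br] <;> ring

theorem br_jacobi (γ δ : ℝ) (x y z : Fin 4 → ℝ) :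
    br γ δ x (br γ δ y z) = br γ δ (br γ δ x y) z + br γ δ y (br γ δ x z) := by
  funext k; fin_cases k <;> simp [br] <;> ring

instance (γ δ : ℝ) : LieRing (RAlg γ δ) where
  bracket x y := br γ δ x y
  add_lie x y z := br_add_left γ δ x y z
  lie_add x y z := br_add_right γ δ x y z
  lie_self x := br_self γ δ x
  leibniz_lie x y z := br_jacobi γ δ x y z

instance (γ δ : ℝ) : LieAlgebra ℝ (RAlg γ δ) where
  lie_smul c x y := br_smul_right γ δ c x y

end RAlg

end

noncomputable section

/-! ### Multi-indices as lists and integer determinants -/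

namespace G2

/-! In the basis f = (e_1, …, e_6, (2/α) e_7) the form φ_α is the standard G₂ three-form with
coefficients ±1. Hence f is orthonormal and positively oriented, and the structure constants in f
are A + (2/α) B with integer tensors A and B (`KAlg.structureConstants`). Here B is the part of ad
f_7 that rotates the planes ⟨f_3, f_5⟩ and ⟨f_4, f_6⟩ simultaneously. It is a skew derivation lying
in su(2) ⊂ g₂, so it kills φ_α, ⋆φ_α and τ_α and adds nothing to the Ricci tensor. Thus α drops out
of the differentials and the curvature, and these become finitely many integer identities, settled
by evaluation. For this a form is coded by a list of pairs (coefficient, multi-index) and tested on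
increasing tuples of basis vectors (`lform_ext`); `wedge_lform`, `starOf_std_eq`, `ceDiff_lform` and
`ricciForm_integral` translate wedge, star, d and Ricci into list arithmetic.

For the Lie algebra itself, ⟨e_2, e_3, e_5⟩ is a copy of sl(2, ℝ) and e_2 + e_7 commutes with it, so
its centraliser ⟨e_1, e_4, e_6, e_2 + e_7⟩ is the complementary factor. An isomorphism preserves the
Levi factor, which is the second derived algebra, hence also the centraliser. There e_2 + e_7 acts
with eigenvalues -α and α/2 ± i; comparing the real and imaginary parts determines α
(`KAlg.eq_of_equiv`).

On the group, a left-invariant form is constant on left-invariant fields, so the exterior derivative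
reduces to the Chevalley–Eilenberg differential (`extD_leftInvariantForm`), while the star is
pointwise. Since dφ = 0 and δφ = τ, the Laplacian of φ is dτ. The automorphisms F_t pull φ back
through exp(tD), so the Lie derivative multiplies each e^I by the sum of its D-weights. The soliton
equation is then the algebraic identity dτ = 6φ + D·φ (`KAlg.soliton_lform`).

A group is built explicitly: the universal cover of SU(1, 1), in global coordinates (θ, b) ∈ ℝ × ℂ,
times ℝ ⋉ (ℝ × ℂ). Transported to ℝ⁷ by a linear map it is simply connected, and it surjects onto
the perfect group SL(2, ℝ), so it is not solvable. -/

/-- The ways to remove an entry equal to `b` from a list; the flag tells whether its position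
is odd. -/
def pick (b : ℕ) : List ℕ → List (Bool × List ℕ)
  | [] => []
  | a :: l => match Nat.beq a b with
    | true => (false, l) :: (pick b l).map fun q => (!q.1, a :: q.2)
    | false => (pick b l).map fun q => (!q.1, a :: q.2)

/-- The integer `det (δ (I b) (J a))`, by Laplace expansion along the first row. -/
def sgn : List ℕ → List ℕ → ℤ
  | _, [] => 1
  | I, b :: J => ((pick b I).map fun q => bif q.1 then -sgn q.2 J else sgn q.2 J).sum

/-- Links the recursive removal with the usual cofactor sum over positions: a position contributes
only if its entry is `b`, and the flag records the sign. -/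
theorem sum_pick (b : ℕ) (I : List ℕ) (F : List ℕ → ℤ) :
    ((pick b I).map fun q => bif q.1 then -F q.2 else F q.2).sum =
      ((List.range I.length).map fun p =>
        if I.getD p 0 = b then (-1) ^ p * F (I.eraseIdx p) else 0).sum := by
  induction I generalizing F with
  | nil => rfl
  | cons a I ih =>
    have h1 : (((pick b I).map fun q => (!q.1, a :: q.2)).map
        fun q => bif q.1 then -F q.2 else F q.2).sum =
        ((List.range I.length).map fun p =>
          if I.getD p 0 = b then (-1) ^ (p + 1) * F (a :: I.eraseIdx p) else 0).sum := by
      rw [List.map_map]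
      -- Putting `a` in front moves every later position by one; the resulting sign change is
      -- absorbed into the function.
      have h2 := ih fun m => -F (a :: m)
      refine (Eq.trans ?_ h2).trans ?_
      · congr 1
        refine List.map_congr_left fun q _ => ?_
        rcases q with ⟨_ | _, q⟩ <;> simp
      · congr 1
        refine List.map_congr_left fun p _ => ?_
        split_ifs <;> ring
    rw [List.length_cons, List.range_succ_eq_map, List.map_cons, List.sum_cons, List.map_map]
    have h3 : ((fun p => if (a :: I).getD p 0 = b then (-1) ^ p * F ((a :: I).eraseIdx p) else 0) ∘
        Nat.succ) = fun p => if I.getD p 0 = b then (-1) ^ (p + 1) * F (a :: I.eraseIdx p) else 0 := by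
      funext p; simp
    rw [h3, ← h1, pick]
    rcases h : Nat.beq a b with _ | _
    · have : a ≠ b := Nat.ne_of_beq_eq_false h
      simp [this]
    · have : a = b := Nat.eq_of_beq_eq_true h
      simp [this]

theorem list_sum_range {M : Type*} [AddCommMonoid M] (n : ℕ) (F : ℕ → M) :
    ((List.range n).map F).sum = ∑ i : Fin n, F i :=
  Eq.trans rfl (Finset.sum_range F)

/-- A multi-index, given by the list of its entries. -/
def toF (k : ℕ) (I : List ℕ) : Fin k → Fin 7 := fun a => Fin.ofNat 7 (I.getD a 0)

/-- The list has length `k` and entries below seven. -/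
def validIndex (k : ℕ) (I : List ℕ) : Bool := I.length == k && I.all (· < 7)

theorem validIndex_iff {k : ℕ} {I : List ℕ} :
    validIndex k I = true ↔ I.length = k ∧ ∀ x ∈ I, x < 7 := by
  simp [validIndex]

theorem validIndex_cons {k b : ℕ} {I : List ℕ} :
    validIndex (k + 1) (b :: I) = true ↔ b < 7 ∧ validIndex k I = true := by
  simp only [validIndex_iff, List.length_cons, List.mem_cons, forall_eq_or_imp]
  constructor
  · rintro ⟨h1, h2, h3⟩; exact ⟨h2, by omega, h3⟩
  · rintro ⟨h1, h2, h3⟩; exact ⟨by omega, h1, h3⟩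

theorem ofNat_inj {a b : ℕ} (ha : a < 7) (hb : b < 7) : Fin.ofNat 7 a = Fin.ofNat 7 b ↔ a = b := by
  rw [Fin.ext_iff]
  simp [Nat.mod_eq_of_lt ha, Nat.mod_eq_of_lt hb]

theorem toF_eraseIdx {k : ℕ} (I : List ℕ) (p : Fin (k + 1)) :
    toF k (I.eraseIdx p) = fun a => toF (k + 1) I (p.succAbove a) := by
  funext a
  simp only [toF, List.getD_eq_getElem?_getD, List.getElem?_eraseIdx, Fin.succAbove]
  split_ifs with h1 h2 h2
  · rfl
  · exact absurd (Fin.lt_def.2 h1) h2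
  · exact absurd h2 h1
  · rfl

theorem toF_cons_succ {k : ℕ} (b : ℕ) (J : List ℕ) (a : Fin k) :
    toF (k + 1) (b :: J) a.succ = toF k J a := by
  simp [toF]

theorem toF_cons {k : ℕ} (b : ℕ) (J : List ℕ) :
    toF (k + 1) (b :: J) = Matrix.vecCons (Fin.ofNat 7 b) (toF k J) := by
  funext a
  refine Fin.cases rfl (fun a => ?_) a
  rw [toF_cons_succ]; rfl

theorem validIndex_eraseIdx {k : ℕ} {I : List ℕ} (h : validIndex (k + 1) I = true)
    (p : Fin (k + 1)) : validIndex k (I.eraseIdx p) = true := by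
  rw [validIndex_iff] at h ⊢
  refine ⟨?_, fun x hx => h.2 x (List.mem_of_mem_eraseIdx hx)⟩
  rw [List.length_eraseIdx, h.1, if_pos p.2]
  rfl

/-- Expansion along the first row, whose entry in column p is 1 exactly when the p-th entry of I
equals the head of J; the minors are the same determinants for shorter lists. -/
theorem sgn_eq_det {k : ℕ} {I J : List ℕ} (hI : validIndex k I = true)
    (hJ : validIndex k J = true) :
    sgn I J = (Matrix.of fun a b => if toF k I b = toF k J a then (1 : ℤ) else 0).det := by
  induction k generalizing I J with
  | zero =>
    have : J = [] := List.length_eq_zero_iff.1 (validIndex_iff.1 hJ).1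
    subst this
    simp [sgn]
  | succ k ih =>
    rcases J with _ | ⟨b, J⟩
    · simp [validIndex] at hJ
    rw [validIndex_cons] at hJ
    rw [sgn, sum_pick b I fun m => sgn m J, (validIndex_iff.1 hI).1, Matrix.det_succ_row_zero,
      list_sum_range]
    refine Finset.sum_congr rfl fun p _ => ?_
    rw [ih (validIndex_eraseIdx hI p) hJ.2]
    have h1 : (toF (k + 1) I p = toF (k + 1) (b :: J) 0) ↔ I.getD p 0 = b := by
      refine ofNat_inj ?_ hJ.1
      refine (validIndex_iff.1 hI).2 _ ?_
      have : (p : ℕ) < I.length := by rw [(validIndex_iff.1 hI).1]; exact p.2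
      rw [List.getD_eq_getElem _ _ this]
      exact List.getElem_mem this
    by_cases h : I.getD p 0 = b
    · simp only [h, if_true, Matrix.of_apply, h1.2 h, mul_one, toF_eraseIdx]
      congr 2
    · simp only [Matrix.of_apply, if_neg h, if_neg (mt h1.1 h)]
      ring

/-! ### Basis forms, their values and their wedge products -/

section Forms

variable {V : Type*} [AddCommGroup V] [Module ℝ V] {n : ℕ}

theorem basisForm_apply {k : ℕ} (e : Module.Basis (Fin n) ℝ V) (i : Fin k → Fin n)
    (v : Fin k → V) :
    basisForm e i v = (Matrix.of fun a b => e.coord (i b) (v a)).det := rfl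

theorem basisForm_basis {k : ℕ} (e : Module.Basis (Fin 7) ℝ V) {I J : List ℕ}
    (hI : validIndex k I = true) (hJ : validIndex k J = true) :
    basisForm e (toF k I) (fun a => e (toF k J a)) = (sgn I J : ℝ) := by
  rw [basisForm_apply, sgn_eq_det hI hJ, ← eq_intCast (Int.castRingHom ℝ), RingHom.map_det]
  congr 1
  ext a b
  simp [Finsupp.single_apply, eq_comm]

theorem basisForm_map {W : Type*} [AddCommGroup W] [Module ℝ W] {k : ℕ}
    (e : Module.Basis (Fin n) ℝ V) (L : W ≃ₗ[ℝ] V) (i : Fin k → Fin n) :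
    (basisForm e i).compLinearMap (L : W →ₗ[ℝ] V) = basisForm (e.map L.symm) i := by
  ext v
  simp [basisForm_apply]

/-- The Leibniz formula for the determinant. -/
theorem basisForm_eq_alternatization {k : ℕ} (e : Module.Basis (Fin n) ℝ V) (i : Fin k → Fin n) :
    basisForm e i = MultilinearMap.alternatization
      ((MultilinearMap.mkPiAlgebra ℝ (Fin k) ℝ).compLinearMap fun b => e.coord (i b)) := by
  ext v
  rw [basisForm_apply, MultilinearMap.alternatization_apply, Matrix.det_apply]
  refine Finset.sum_congr rfl fun σ _ => ?_
  simp [MultilinearMap.domDomCongr_apply]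

/-- The shuffle product of two alternatizations is the alternatization of the tensor product, and
the tensor product of two monomials in the coordinates is again a monomial. Reindexing permutations
of the sum type as permutations of `Fin (k + l)` preserves signs. -/
theorem wedge_basisForm {k l : ℕ} (e : Module.Basis (Fin n) ℝ V) (i : Fin k → Fin n)
    (j : Fin l → Fin n) :
    wedge (basisForm e i) (basisForm e j) = basisForm e (Fin.append i j) := by
  rw [wedge, basisForm_eq_alternatization, basisForm_eq_alternatization,
    ← MultilinearMap.domCoprod_alternization]
  ext v
  simp only [AlternatingMap.domDomCongr_apply, LinearMap.compAlternatingMap_apply]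
  rw [MultilinearMap.alternatization_apply, map_sum, basisForm_apply, Matrix.det_apply]
  refine Fintype.sum_equiv (Equiv.permCongr finSumFinEquiv) _ _ fun σ => ?_
  rw [Equiv.Perm.sign_permCongr, map_zsmul_unit]
  congr 1
  simp only [MultilinearMap.domDomCongr_apply, MultilinearMap.domCoprod_apply,
    MultilinearMap.compLinearMap_apply, MultilinearMap.mkPiAlgebra_apply,
    LinearMap.mul'_apply, Matrix.of_apply]
  rw [← finSumFinEquiv.prod_comp, Fintype.prod_sum_type]
  simp

theorem wedge_zero_left {k m : ℕ} (b : V [⋀^Fin m]→ₗ[ℝ] ℝ) :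
    wedge (0 : V [⋀^Fin k]→ₗ[ℝ] ℝ) b = 0 := by
  have := wedge_smul_left 0 (0 : V [⋀^Fin k]→ₗ[ℝ] ℝ) b
  simpa using this

theorem wedge_zero_right {k m : ℕ} (a : V [⋀^Fin k]→ₗ[ℝ] ℝ) :
    wedge a (0 : V [⋀^Fin m]→ₗ[ℝ] ℝ) = 0 := by
  have := wedge_smul_right 0 a (0 : V [⋀^Fin m]→ₗ[ℝ] ℝ)
  simpa using this

end Forms

/-! ### Integral forms in a basis -/

section Integral

variable {V : Type*} [AddCommGroup V] [Module ℝ V]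

/-- The form `∑ c e^{i_1} ∧ ⋯ ∧ e^{i_k}` given by a list of pairs `(c, [i_1, …, i_k])`. -/
def lform (e : Module.Basis (Fin 7) ℝ V) (k : ℕ) (l : List (ℤ × List ℕ)) : V [⋀^Fin k]→ₗ[ℝ] ℝ :=
  (l.map fun p => (p.1 : ℝ) • basisForm e (toF k p.2)).sum

/-- The value of `lform e k l` on a tuple of basis vectors. -/
def leval (l : List (ℤ × List ℕ)) (J : List ℕ) : ℤ := (l.map fun p => p.1 * sgn p.2 J).sum

/-- All multi-indices of the list are valid. -/
def validForm (k : ℕ) (l : List (ℤ × List ℕ)) : Bool := l.all fun p => validIndex k p.2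

@[simp] theorem lform_nil (e : Module.Basis (Fin 7) ℝ V) (k : ℕ) : lform e k [] = 0 := rfl

@[simp] theorem lform_cons (e : Module.Basis (Fin 7) ℝ V) (k : ℕ) (p : ℤ × List ℕ)
    (l : List (ℤ × List ℕ)) :
    lform e k (p :: l) = (p.1 : ℝ) • basisForm e (toF k p.2) + lform e k l := by
  simp [lform]

theorem lform_append (e : Module.Basis (Fin 7) ℝ V) (k : ℕ) (l m : List (ℤ × List ℕ)) :
    lform e k (l ++ m) = lform e k l + lform e k m := by
  simp [lform]

theorem lform_basis (e : Module.Basis (Fin 7) ℝ V) {k : ℕ} {l : List (ℤ × List ℕ)}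
    (hl : validForm k l = true) {J : List ℕ} (hJ : validIndex k J = true) :
    lform e k l (fun a => e (toF k J a)) = (leval l J : ℝ) := by
  induction l with
  | nil => simp [leval]
  | cons p l ih =>
    simp only [validForm, List.all_cons, Bool.and_eq_true] at hl
    simp [ih hl.2, leval, basisForm_basis e hl.1 hJ]

theorem lform_map {W : Type*} [AddCommGroup W] [Module ℝ W] (k : ℕ)
    (e : Module.Basis (Fin 7) ℝ V) (L : W ≃ₗ[ℝ] V) (l : List (ℤ × List ℕ)) :
    (lform e k l).compLinearMap (L : W →ₗ[ℝ] V) = lform (e.map L.symm) k l := by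
  induction l with
  | nil => ext v; simp
  | cons p l ih =>
    rw [lform_cons, lform_cons, ← ih, ← basisForm_map]
    ext v; simp

/-- The increasing tuples with entries in a sorted list. -/
def increasing : ℕ → List ℕ → List (List ℕ)
  | 0, _ => [[]]
  | _ + 1, [] => []
  | k + 1, a :: l => ((increasing k l).map (List.cons a)) ++ increasing (k + 1) l

theorem of_mem_increasing {k : ℕ} {l J : List ℕ} (h : J ∈ increasing k l) :
    J.length = k ∧ ∀ x ∈ J, x ∈ l := by
  induction l generalizing k J with
  | nil =>
    cases k with
    | zero => simp [increasing] at h; simp [h]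
    | succ k => simp [increasing] at h
  | cons a l ih =>
    cases k with
    | zero => simp [increasing] at h; simp [h]
    | succ k =>
      rw [increasing, List.mem_append, List.mem_map] at h
      rcases h with ⟨J', h1, rfl⟩ | h
      · have := ih h1
        refine ⟨by simp [this.1], fun x hx => ?_⟩
        rcases List.mem_cons.1 hx with rfl | hx
        · exact List.mem_cons_self
        · exact List.mem_cons_of_mem _ (this.2 x hx)
      · have := ih h
        exact ⟨this.1, fun x hx => List.mem_cons_of_mem _ (this.2 x hx)⟩

theorem mem_increasing {k : ℕ} {l J : List ℕ} (hl : l.Pairwise (· < ·)) (hJ : J.Pairwise (· < ·))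
    (hk : J.length = k) (h : ∀ x ∈ J, x ∈ l) : J ∈ increasing k l := by
  induction l generalizing k J with
  | nil =>
    rcases J with _ | ⟨b, J⟩
    · subst hk; simp [increasing]
    · exact absurd (h b List.mem_cons_self) (by simp)
  | cons a l ih =>
    rcases J with _ | ⟨b, J⟩
    · subst hk; simp [increasing]
    subst hk
    rw [List.pairwise_cons] at hl hJ
    rw [List.length_cons, increasing, List.mem_append, List.mem_map]
    have hb := h b List.mem_cons_self
    have hJl : ∀ x ∈ J, x ∈ l := fun x hx => by
      rcases List.mem_cons.1 (h x (List.mem_cons_of_mem _ hx)) with h1 | h1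
      · subst h1
        rcases List.mem_cons.1 hb with h2 | h2
        · exact absurd (hJ.1 x hx) (by omega)
        · exact absurd ((hJ.1 x hx).trans (hl.1 b h2)) (by omega)
      · exact h1
    rcases List.mem_cons.1 hb with rfl | hb
    · exact Or.inl ⟨J, ih hl.2 hJ.2 rfl hJl, rfl⟩
    · refine Or.inr (ih hl.2 (List.pairwise_cons.2 hJ) rfl fun x hx => ?_)
      rcases List.mem_cons.1 hx with rfl | hx
      · exact hb
      · exact hJl x hx

/-- The indices of a basis. -/
def seven : List ℕ := [0, 1, 2, 3, 4, 5, 6]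

theorem validIndex_of_mem_increasing {k : ℕ} {J : List ℕ} (h : J ∈ increasing k seven) :
    validIndex k J = true := by
  have h1 := of_mem_increasing h
  refine validIndex_iff.2 ⟨h1.1, fun x hx => ?_⟩
  have := h1.2 x hx
  simp [seven] at this
  omega

/-- An alternating form is determined by injective tuples of basis vectors; sorting such a tuple
multiplies both forms by the same sign. -/
theorem ext_increasing {k : ℕ} (e : Module.Basis (Fin 7) ℝ V) {a b : V [⋀^Fin k]→ₗ[ℝ] ℝ}
    (h : ∀ J ∈ increasing k seven, a (fun t => e (toF k J t)) = b (fun t => e (toF k J t))) :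
    a = b := by
  refine Module.Basis.ext_alternating e fun v hv => ?_
  have hs : StrictMono (v ∘ Tuple.sort v) :=
    (Tuple.monotone_sort v).strictMono_of_injective (hv.comp (Tuple.sort v).injective)
  have h0 : List.ofFn (fun t => ((v ∘ Tuple.sort v) t : ℕ)) ∈ increasing k seven := by
    refine mem_increasing (by decide) ?_ List.length_ofFn fun x hx => ?_
    · rw [List.pairwise_ofFn]
      exact fun i j hij => hs hij
    · rw [List.mem_ofFn] at hx
      obtain ⟨i, rfl⟩ := hx
      generalize (v ∘ Tuple.sort v) i = y
      revert y
      decide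
  have h1 := h _ h0
  have h5 : toF k (List.ofFn fun t => ((v ∘ Tuple.sort v) t : ℕ)) = v ∘ Tuple.sort v := by
    funext t
    rw [toF, List.getD_eq_getElem _ _ (by simp)]
    ext
    simp
  rw [h5] at h1
  have h2 := a.map_perm (fun t => e (v t)) (Tuple.sort v)
  have h3 := b.map_perm (fun t => e (v t)) (Tuple.sort v)
  have h4 : (fun t => e ((v ∘ Tuple.sort v) t)) = (fun t => e (v t)) ∘ Tuple.sort v := rfl
  rw [h4, h2, h3] at h1
  exact smul_left_cancel _ h1

/-- The device by which an equality of forms becomes a finite list of integer identities. -/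
theorem lform_ext {k : ℕ} (e : Module.Basis (Fin 7) ℝ V) {a : V [⋀^Fin k]→ₗ[ℝ] ℝ}
    {l : List (ℤ × List ℕ)} (hl : validForm k l = true)
    (h : ∀ J ∈ increasing k seven, a (fun t => e (toF k J t)) = (leval l J : ℝ)) :
    a = lform e k l :=
  ext_increasing e fun J hJ => by
    rw [h J hJ, lform_basis e hl (validIndex_of_mem_increasing hJ)]

/-- The list of the interior product with a basis vector. -/
def lcurry (i : ℕ) (l : List (ℤ × List ℕ)) : List (ℤ × List ℕ) :=
  l.flatMap fun q => (pick i q.2).map fun r => (bif r.1 then -q.1 else q.1, r.2)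

theorem leval_append (l m : List (ℤ × List ℕ)) (J : List ℕ) :
    leval (l ++ m) J = leval l J + leval m J := by simp [leval]

/-- One step of the expansion defining `sgn` is exactly the interior product with the basis vector
of index `i`. -/
theorem leval_lcurry (i : ℕ) (l : List (ℤ × List ℕ)) (J : List ℕ) :
    leval (lcurry i l) J = leval l (i :: J) := by
  induction l with
  | nil => rfl
  | cons q l ih =>
    have h : lcurry i (q :: l) =
      ((pick i q.2).map fun r => (bif r.1 then -q.1 else q.1, r.2)) ++ lcurry i l := rfl
    rw [h, leval_append, ih, leval, leval, leval, List.map_cons, List.sum_cons, sgn,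
      ← List.sum_map_mul_left, List.map_map]
    congr 2
    refine List.map_congr_left fun r _ => ?_
    rcases r with ⟨_ | _, r⟩ <;> simp

theorem curryLeft_lform (e : Module.Basis (Fin 7) ℝ V) {k i : ℕ} {l : List (ℤ × List ℕ)}
    (hi : i < 7) (hl : validForm (k + 1) l = true) (hl' : validForm k (lcurry i l) = true) :
    AlternatingMap.curryLeft (lform e (k + 1) l) (e (Fin.ofNat 7 i)) = lform e k (lcurry i l) := by
  refine lform_ext e hl' fun J hJ => ?_
  rw [leval_lcurry, ← lform_basis e hl
    (validIndex_cons.2 ⟨hi, validIndex_of_mem_increasing hJ⟩), AlternatingMap.curryLeft_apply_apply,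
    toF_cons]
  congr 1
  funext t
  refine Fin.cases ?_ (fun t => ?_) t <;> simp

/-- The list of a wedge product. -/
def lwedge (a b : List (ℤ × List ℕ)) : List (ℤ × List ℕ) :=
  a.flatMap fun p => b.map fun q => (p.1 * q.1, p.2 ++ q.2)

theorem toF_append {k : ℕ} (m : ℕ) {I : List ℕ} (hI : I.length = k) (J : List ℕ) :
    toF (k + m) (I ++ J) = Fin.append (toF k I) (toF m J) := by
  funext a
  refine Fin.addCases (fun a => ?_) (fun a => ?_) a
  · rw [Fin.append_left, toF, toF, Fin.val_castAdd, List.getD_append _ _ _ _ (by omega)]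
  · rw [Fin.append_right, toF, toF, Fin.val_natAdd, List.getD_append_right _ _ _ _ (by omega)]
    congr 2
    omega

theorem wedge_lform (e : Module.Basis (Fin 7) ℝ V) {k m : ℕ} {a : List (ℤ × List ℕ)}
    (ha : validForm k a = true) (b : List (ℤ × List ℕ)) :
    wedge (lform e k a) (lform e m b) = lform e (k + m) (lwedge a b) := by
  induction a with
  | nil => simp [lwedge, wedge_zero_left]
  | cons p a ih =>
    simp only [validForm, List.all_cons, Bool.and_eq_true] at ha
    have h : (p.1 : ℝ) • wedge (basisForm e (toF k p.2)) (lform e m b) =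
        lform e (k + m) (b.map fun q => (p.1 * q.1, p.2 ++ q.2)) := by
      clear ih
      induction b with
      | nil => simp [wedge_zero_right]
      | cons q b ih =>
        rw [lform_cons, wedge_add_right, smul_add, ih, wedge_smul_right, wedge_basisForm,
          List.map_cons, lform_cons, toF_append m (validIndex_iff.1 ha.1).1, smul_smul]
        simp
    rw [lform_cons, wedge_add_left, wedge_smul_left, ih ha.2, h]
    exact (lform_append e _ _ _).symm

end Integral

end G2

/-! ### The Hodge star in an orthonormal basis -/

namespace G2

section Star

variable {V : Type*} [AddCommGroup V] [Module ℝ V]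

/-- The contracted vectors occupy the first slots in their given order. The cast reconciles the
degree m + k of `η` with the length k + m of the appended tuple. -/
theorem contract_apply {m k : ℕ} (u : Fin k → V) (η : V [⋀^Fin (m + k)]→ₗ[ℝ] ℝ)
    (v : Fin m → V) :
    contract k u η v = η fun t => Fin.append u v (Fin.cast (Nat.add_comm m k) t) := by
  induction k with
  | zero =>
    rw [contract]
    congr 1
    funext t
    have : Fin.cast (Nat.add_comm m 0) t = Fin.natAdd 0 t := by ext; simp
    rw [this, Fin.append_right]
  | succ k ih =>
    rw [contract, ih, AlternatingMap.curryLeft_apply_apply]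
    congr 1
    funext t
    refine Fin.cases ?_ (fun t => ?_) t
    · have : Fin.cast (Nat.add_comm m (k + 1)) 0 = Fin.castAdd m (0 : Fin (k + 1)) := by
        ext; simp
      rw [this, Fin.append_left]
      rfl
    · have h2 : Matrix.vecCons (u 0) (fun t => Fin.append (Fin.tail u) v
          (Fin.cast (Nat.add_comm m k) t)) t.succ = Fin.append (Fin.tail u) v
          (Fin.cast (Nat.add_comm m k) t) := rfl
      refine h2.trans ?_
      have h3 : Fin.append u v = Fin.append (Fin.cons (u 0) (Fin.tail u)) v := by
        rw [Fin.cons_self_tail]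
      rw [h3, Fin.append_cons]
      rfl


theorem contract_domDomCongr {m k N : ℕ} (h : m + k = N) (u : Fin k → V)
    (η : V [⋀^Fin N]→ₗ[ℝ] ℝ) (v : Fin m → V) :
    contract k u (η.domDomCongr (finCongr h.symm)) v =
      η fun t => Fin.append u v (Fin.cast (h.symm.trans (Nat.add_comm m k)) t) := by
  subst h
  rw [contract_apply]
  rfl

theorem basisForm_append {m k : ℕ} (f : Module.Basis (Fin 7) ℝ V) (h : 7 = k + m) {L I J : List ℕ}
    (hL : validIndex 7 L = true) (hI : validIndex k I = true) (hJ : validIndex m J = true) :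
    basisForm f (toF 7 L) (fun t => Fin.append (fun a => f (toF k I a)) (fun a => f (toF m J a))
      (Fin.cast h t)) = (sgn L (I ++ J) : ℝ) := by
  have hv : validIndex 7 (I ++ J) = true := by
    rw [validIndex_iff] at hI hJ ⊢
    refine ⟨by rw [List.length_append, hI.1, hJ.1, h], fun x hx => ?_⟩
    rcases List.mem_append.1 hx with hx | hx
    · exact hI.2 x hx
    · exact hJ.2 x hx
  rw [← basisForm_basis f hL hv]
  congr 1
  funext t
  have h1 : toF 7 (I ++ J) t = toF (k + m) (I ++ J) (Fin.cast h t) := rfl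
  rw [h1, toF_append m (validIndex_iff.1 hI).1]
  generalize Fin.cast h t = s
  refine Fin.addCases (fun s => ?_) (fun s => ?_) s <;> simp

/-- `η` as an alternating form on a sum type, so that `contract k u η v` is its value on
`Sum.elim u v`. -/
def splitForm {m k : ℕ} (η : V [⋀^Fin (m + k)]→ₗ[ℝ] ℝ) : V [⋀^Fin k ⊕ Fin m]→ₗ[ℝ] ℝ :=
  η.domDomCongr ((finCongr (Nat.add_comm m k)).trans finSumFinEquiv.symm)

theorem contract_eq_splitForm {m k : ℕ} (u : Fin k → V) (η : V [⋀^Fin (m + k)]→ₗ[ℝ] ℝ)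
    (v : Fin m → V) : contract k u η v = splitForm η (Sum.elim u v) := by
  rw [contract_apply, splitForm, AlternatingMap.domDomCongr_apply]
  congr 1
  funext t
  obtain ⟨s, rfl⟩ := (((finCongr (Nat.add_comm m k)).trans finSumFinEquiv.symm).symm).surjective t
  rcases s with s | s <;> simp [Function.comp_def]

/-- Extending σ by the identity on the uncontracted slots does not change its sign. -/
theorem contract_perm {m k : ℕ} (u : Fin k → V) (η : V [⋀^Fin (m + k)]→ₗ[ℝ] ℝ)
    (v : Fin m → V) (σ : Equiv.Perm (Fin k)) :
    contract k (u ∘ σ) η v = (Equiv.Perm.sign σ : ℤ) • contract k u η v := by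
  have h : Sum.elim (u ∘ σ) v = Sum.elim u v ∘ Equiv.Perm.sumCongr σ (1 : Equiv.Perm (Fin m)) := by
    funext t
    rcases t with t | t <;> simp
  rw [contract_eq_splitForm, contract_eq_splitForm, h, AlternatingMap.map_perm,
    Equiv.Perm.sign_sumCongr]
  simp [Units.smul_def]

/-- The multilinear map `u ↦ η (u, v)`. -/
def contractMultilinear {m k : ℕ} (η : V [⋀^Fin (m + k)]→ₗ[ℝ] ℝ) (v : Fin m → V) :
    MultilinearMap ℝ (fun _ : Fin k => V) ℝ :=
  LinearMap.compMultilinearMap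
    { toFun := fun f : MultilinearMap ℝ (fun _ : Fin m => V) ℝ => f v
      map_add' := fun _ _ => rfl
      map_smul' := fun _ _ => rfl }
    (splitForm η).toMultilinearMap.currySum

theorem contractMultilinear_apply {m k : ℕ} (η : V [⋀^Fin (m + k)]→ₗ[ℝ] ℝ) (v : Fin m → V)
    (u : Fin k → V) : contractMultilinear η v u = contract k u η v := by
  rw [contract_eq_splitForm]; rfl

theorem multilinear_expand {n k : ℕ} (e : Module.Basis (Fin n) ℝ V)
    (T : MultilinearMap ℝ (fun _ : Fin k => V) ℝ) (c : Fin k → Fin n → ℝ) :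
    T (fun a => ∑ q, c a q • e q) = ∑ p : Fin k → Fin n, (∏ a, c a (p a)) * T (fun a => e (p a)) := by
  rw [T.map_sum (fun a q => c a q • e q)]
  exact Finset.sum_congr rfl fun p _ => T.map_smul_univ (fun a => c a (p a)) fun a => e (p a)

/-- A sum over pairs of dual bases does not depend on the bases. -/
theorem sum_dual_bases {n k : ℕ} (e f : Module.Basis (Fin n) ℝ V)
    (S T : MultilinearMap ℝ (fun _ : Fin k => V) ℝ) :
    ∑ i : Fin k → Fin n, S (fun a => ∑ q, e.coord (i a) (f q) • f q) * T (fun a => e (i a)) =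
      ∑ p : Fin k → Fin n, S (fun a => f (p a)) * T (fun a => f (p a)) := by
  have h1 : ∀ i : Fin k → Fin n, S (fun a => ∑ q, e.coord (i a) (f q) • f q) =
      ∑ p : Fin k → Fin n, (∏ a, e.coord (i a) (f (p a))) * S (fun a => f (p a)) := fun i =>
    multilinear_expand f S fun a q => e.coord (i a) (f q)
  -- Both factors are expanded with the same coefficients e^i(f_p), in opposite directions, so the
  -- two double sums agree term by term.
  have h2 : ∀ p : Fin k → Fin n, T (fun a => f (p a)) =
      ∑ i : Fin k → Fin n, (∏ a, e.coord (i a) (f (p a))) * T (fun a => e (i a)) := fun p => by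
    rw [← multilinear_expand e T fun a q => e.coord q (f (p a))]
    congr 1
    funext a
    simp [e.sum_repr]
  simp_rw [h1, h2, Finset.sum_mul, Finset.mul_sum]
  rw [Finset.sum_comm]
  refine Finset.sum_congr rfl fun p _ => Finset.sum_congr rfl fun i _ => ?_
  ring

/-- In the Leibniz expansion, the term of σ survives only for p = i ∘ σ⁻¹. There the sign of the
determinant term cancels the sign from `hB`, so each of the k! permutations contributes the same
value. -/
theorem sum_basisForm_mul {n k : ℕ} (f : Module.Basis (Fin n) ℝ V) (i : Fin k → Fin n)
    (B : (Fin k → V) → ℝ)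
    (hB : ∀ u (σ : Equiv.Perm (Fin k)), B (u ∘ σ) = (Equiv.Perm.sign σ : ℤ) • B u) :
    ∑ p : Fin k → Fin n, basisForm f i (fun a => f (p a)) * B (fun a => f (p a)) =
      (k.factorial : ℝ) * B (fun a => f (i a)) := by
  have h1 : ∀ p : Fin k → Fin n, basisForm f i (fun a => f (p a)) * B (fun a => f (p a)) =
      ∑ σ : Equiv.Perm (Fin k), if p = i ∘ σ.symm then B (fun a => f (i a)) else 0 := by
    intro p
    rw [basisForm_apply, Matrix.det_apply, Finset.sum_mul]
    refine Finset.sum_congr rfl fun σ _ => ?_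
    split_ifs with h
    · subst h
      have h2 := hB (fun a => f (i a)) σ.symm
      have h3 : (fun a => f ((i ∘ σ.symm) a)) = (fun a => f (i a)) ∘ σ.symm := rfl
      rw [h3, h2]
      have h4 : ∏ a, (Matrix.of fun a b => (f.coord (i b)) (f ((i ∘ σ.symm) a))) (σ a) a = 1 := by
        refine Finset.prod_eq_one fun a _ => ?_
        simp
      rw [h4, ← Equiv.Perm.inv_def, Equiv.Perm.sign_inv, Units.smul_def]
      simp only [zsmul_eq_mul, mul_one]
      rw [← mul_assoc]
      have h5 : ((Equiv.Perm.sign σ : ℤ) : ℝ) * ((Equiv.Perm.sign σ : ℤ) : ℝ) = 1 := by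
        rcases Int.units_eq_one_or (Equiv.Perm.sign σ) with h | h <;> simp [h]
      rw [h5, one_mul]
    · have h4 : ∏ a, (Matrix.of fun a b => (f.coord (i b)) (f (p a))) (σ a) a = 0 := by
        have : ∃ a, p (σ a) ≠ i a := by
          by_contra hc
          push Not at hc
          apply h
          funext a
          simp [← hc]
        obtain ⟨a, ha⟩ := this
        refine Finset.prod_eq_zero (Finset.mem_univ a) ?_
        simp [Finsupp.single_apply, ha]
      rw [h4]; simp
  simp_rw [h1]
  rw [Finset.sum_comm]
  simp [Fintype.card_perm]

theorem alternatingMap_sum_apply {ι : Type*} {k : ℕ} (s : Finset ι) (F : ι → V [⋀^Fin k]→ₗ[ℝ] ℝ)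
    (v : Fin k → V) : (∑ i ∈ s, F i) v = ∑ i ∈ s, F i v :=
  map_sum (⟨⟨fun θ : V [⋀^Fin k]→ₗ[ℝ] ℝ => θ v, rfl⟩, fun _ _ => rfl⟩ :
    (V [⋀^Fin k]→ₗ[ℝ] ℝ) →+ ℝ) F s

/-- The metric for which `f` is an orthonormal basis. -/
def IsOrthonormalFor (f : Module.Basis (Fin 7) ℝ V) (g : LinearMap.BilinForm ℝ V) : Prop :=
  ∀ x y, g x y = ∑ i, f.coord i x * f.coord i y

theorem IsOrthonormalFor.apply_basis {f : Module.Basis (Fin 7) ℝ V} {g : LinearMap.BilinForm ℝ V}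
    (h : IsOrthonormalFor f g) (x : V) (i : Fin 7) : g x (f i) = f.coord i x := by
  rw [h]; simp [Finsupp.single_apply]

theorem IsOrthonormalFor.nondegenerate {f : Module.Basis (Fin 7) ℝ V} {g : LinearMap.BilinForm ℝ V}
    (h : IsOrthonormalFor f g) : g.Nondegenerate := by
  have h1 : ∀ x, (∀ y, g x y = 0) → x = 0 := fun x hx =>
    f.ext_elem fun i => by simpa using (h.apply_basis x i).symm.trans (hx _)
  refine ⟨h1, fun y hy => h1 y fun x => ?_⟩
  rw [h, ← hy x, h]
  exact Finset.sum_congr rfl fun i _ => mul_comm _ _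

section Seven

variable [hV : Fact (Module.finrank ℝ V = 7)]

variable {f : Module.Basis (Fin 7) ℝ V} {g : LinearMap.BilinForm ℝ V}

theorem IsOrthonormalFor.sharp_eq (h : IsOrthonormalFor f g) (θ : Module.Dual ℝ V) :
    sharp g θ = ∑ q, θ (f q) • f q := by
  refine f.ext_elem fun i => ?_
  have h1 : g (sharp g θ) (f i) = θ (f i) := by
    rw [sharp, dif_pos h.nondegenerate]
    exact LinearMap.BilinForm.apply_toDual_symm_apply _ _
  rw [h.apply_basis] at h1
  simpa [Finsupp.single_apply] using h1

/-- Raising an index is a sum over the orthonormal basis, so `sum_dual_bases` trades the arbitrary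
basis of the definition for `f`. -/
theorem hodgeStar_apply (hg : IsOrthonormalFor f g) (vol : V [⋀^Fin 7]→ₗ[ℝ] ℝ) {k m : ℕ}
    (h : m + k = 7) (β : V [⋀^Fin k]→ₗ[ℝ] ℝ) (v : Fin m → V) :
    hodgeStar g vol h β v = (k.factorial : ℝ)⁻¹ * ∑ p : Fin k → Fin 7,
      β (fun a => f (p a)) * contract k (fun a => f (p a))
        (vol.domDomCongr (finCongr h.symm)) v := by
  have h1 := sum_dual_bases (someBasis V) f β.toMultilinearMap
    (contractMultilinear (vol.domDomCongr (finCongr h.symm)) v)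
  simp only [contractMultilinear_apply, AlternatingMap.coe_multilinearMap] at h1
  rw [← h1, hodgeStar]
  simp only [AlternatingMap.smul_apply, alternatingMap_sum_apply, smul_eq_mul, hg.sharp_eq]

/-- The k! equal terms of `sum_basisForm_mul` cancel the normalising factor 1/k!. -/
theorem hodgeStar_basisForm (hg : IsOrthonormalFor f g) (vol : V [⋀^Fin 7]→ₗ[ℝ] ℝ) {k m : ℕ}
    (h : m + k = 7) (i : Fin k → Fin 7) (v : Fin m → V) :
    hodgeStar g vol h (basisForm f i) v =
      contract k (fun a => f (i a)) (vol.domDomCongr (finCongr h.symm)) v := by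
  rw [hodgeStar_apply hg, sum_basisForm_mul f i
    (fun u => contract k u (vol.domDomCongr (finCongr h.symm)) v)
    fun u σ => contract_perm u _ v σ, ← mul_assoc, inv_mul_cancel₀, one_mul]
  exact_mod_cast k.factorial_ne_zero

theorem hodgeStar_add (g : LinearMap.BilinForm ℝ V) (vol : V [⋀^Fin 7]→ₗ[ℝ] ℝ) {k m : ℕ}
    (h : m + k = 7) (β β' : V [⋀^Fin k]→ₗ[ℝ] ℝ) :
    hodgeStar g vol h (β + β') = hodgeStar g vol h β + hodgeStar g vol h β' := by
  simp only [hodgeStar, AlternatingMap.add_apply, add_smul, Finset.sum_add_distrib, smul_add]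

theorem hodgeStar_smul (g : LinearMap.BilinForm ℝ V) (vol : V [⋀^Fin 7]→ₗ[ℝ] ℝ) {k m : ℕ}
    (h : m + k = 7) (c : ℝ) (β : V [⋀^Fin k]→ₗ[ℝ] ℝ) :
    hodgeStar g vol h (c • β) = c • hodgeStar g vol h β := by
  simp only [hodgeStar, AlternatingMap.smul_apply, smul_assoc, ← Finset.smul_sum]
  rw [smul_comm]

theorem hodgeStar_zero (g : LinearMap.BilinForm ℝ V) (vol : V [⋀^Fin 7]→ₗ[ℝ] ℝ) {k m : ℕ}
    (h : m + k = 7) : hodgeStar g vol h (0 : V [⋀^Fin k]→ₗ[ℝ] ℝ) = 0 := by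
  have := hodgeStar_smul g vol h 0 (0 : V [⋀^Fin k]→ₗ[ℝ] ℝ)
  simpa using this

/-- The values of the Hodge star of `lform f k l` on tuples of vectors of an adapted basis. -/
def lstar (l : List (ℤ × List ℕ)) (J : List ℕ) : ℤ :=
  (l.map fun q => q.1 * sgn seven (q.2 ++ J)).sum

theorem hodgeStar_lform (hg : IsOrthonormalFor f g) {k m : ℕ} (h : m + k = 7)
    {l : List (ℤ × List ℕ)} (hl : validForm k l = true) {J : List ℕ}
    (hJ : validIndex m J = true) :
    hodgeStar g (basisForm f (toF 7 seven)) h (lform f k l) (fun a => f (toF m J a)) =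
      (lstar l J : ℝ) := by
  induction l with
  | nil => rw [lform_nil, hodgeStar_zero, lstar]; simp
  | cons q l ih =>
    simp only [validForm, List.all_cons, Bool.and_eq_true] at hl
    rw [lform_cons, hodgeStar_add, hodgeStar_smul, AlternatingMap.add_apply, ih hl.2,
      AlternatingMap.smul_apply, hodgeStar_basisForm hg, contract_domDomCongr h,
      basisForm_append f _ (by decide) hl.1 hJ, lstar, lstar, List.map_cons,
      List.sum_cons, Int.cast_add, Int.cast_mul, smul_eq_mul]

end Seven

end Star
end G2

/-! ### The standard G₂ three-form: metric, volume form and star -/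

namespace G2

section Standard

variable {V : Type*} [AddCommGroup V] [Module ℝ V]

/-- `e^127 + e^347 + e^567 + e^135 - e^146 - e^236 - e^245` (indices shifted by one). -/
def stdList : List (ℤ × List ℕ) :=
  [(1, [0, 1, 6]), (1, [2, 3, 6]), (1, [4, 5, 6]), (1, [0, 2, 4]), (-1, [0, 3, 5]),
    (-1, [1, 2, 5]), (-1, [1, 3, 4])]

/-- The 6 is what the factor 1/6 in `bForm` normalises to 1. -/
theorem leval_std_metric : ∀ i j : Fin 7,
    leval (lwedge (lwedge (lcurry i stdList) (lcurry j stdList)) stdList) seven =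
      if i = j then 6 else 0 := by
  decide +kernel

theorem validForm_std_metric : ∀ i j : Fin 7, validForm 2 (lcurry i stdList) = true ∧
    validForm 4 (lwedge (lcurry i stdList) (lcurry j stdList)) = true ∧
    validForm 7 (lwedge (lwedge (lcurry i stdList) (lcurry j stdList)) stdList) = true := by
  decide +kernel

theorem bForm_std (f : Module.Basis (Fin 7) ℝ V) (i j : Fin 7) :
    bForm (lform f 3 stdList) (f i) (f j) f = if i = j then 1 else 0 := by
  have hi : i = Fin.ofNat 7 i := by ext; simp
  have hj : j = Fin.ofNat 7 j := by ext; simp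
  obtain ⟨h1, h2, h3⟩ := validForm_std_metric i j
  have h1' := (validForm_std_metric j j).1
  rw [bForm]
  nth_rw 1 [hi]
  nth_rw 1 [hj]
  rw [curryLeft_lform f i.2 (by decide) h1,
    curryLeft_lform f j.2 (by decide) h1', wedge_lform f h1, wedge_lform f h2,
    AlternatingMap.smul_apply]
  have h := lform_basis f h3 (J := seven) (by decide)
  have h4 : toF 7 seven = id := by decide
  rw [leval_std_metric, h4] at h
  refine (congrArg (fun r : ℝ => (1 / 6 : ℝ) • r) h).trans ?_
  split_ifs <;> norm_num

theorem basisForm_id (f : Module.Basis (Fin 7) ℝ V) : basisForm f id = f.det := by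
  ext v
  rw [basisForm_apply, Module.Basis.det_apply, ← Matrix.det_transpose]
  rfl

variable [hV : Fact (Module.finrank ℝ V = 7)]

theorem top_form_someBasis (f : Module.Basis (Fin 7) ℝ V) (η : V [⋀^Fin 7]→ₗ[ℝ] ℝ) :
    η (someBasis V) = f.det (someBasis V) * η f := by
  conv_lhs => rw [η.eq_smul_basis_det f]
  rw [AlternatingMap.smul_apply, smul_eq_mul, mul_comm]

/-- A top-degree form on the chosen basis is its value on `f` times the determinant of the change of
basis; on `f` itself b_φ is the identity matrix. -/
theorem bBilin_std (f : Module.Basis (Fin 7) ℝ V) (x y : V) :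
    bBilin (lform f 3 stdList) x y =
      f.det (someBasis V) * ∑ i, f.coord i x * f.coord i y := by
  have h : ∀ i j, bBilin (lform f 3 stdList) (f i) (f j) =
      if i = j then f.det (someBasis V) else 0 := fun i j => by
    have h1 := top_form_someBasis f (bForm (lform f 3 stdList) (f i) (f j))
    rw [bForm_std] at h1
    refine h1.trans ?_
    split_ifs <;> simp
  rw [← LinearMap.BilinForm.sum_repr_mul_repr_mul f]
  simp only [h]
  simp [Finset.mul_sum, Finsupp.sum_fintype]
  exact Finset.sum_congr rfl fun i _ => by ring

/-- With P the change-of-basis matrix and κ = det P, the matrix of b_φ is κ PᵀP. Its determinant is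
κ⁷ · κ² = κ⁹, whose signed ninth root is κ; so dV_φ is the volume form of `f`, whatever basis was
chosen. -/
theorem volCoeff_std (f : Module.Basis (Fin 7) ℝ V) :
    volCoeff (lform f 3 stdList) = f.det (someBasis V) := by
  have hκ : f.det (someBasis V) ≠ 0 := (f.isUnit_det (someBasis V)).ne_zero
  set κ := f.det (someBasis V) with hκd
  have h : (LinearMap.BilinForm.toMatrix (someBasis V) (bBilin (lform f 3 stdList))).det =
      κ ^ 9 := by
    have h1 : LinearMap.BilinForm.toMatrix (someBasis V) (bBilin (lform f 3 stdList)) =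
        κ • ((f.toMatrix (someBasis V)).transpose * f.toMatrix (someBasis V)) := by
      ext i j
      rw [LinearMap.BilinForm.toMatrix_apply, bBilin_std]
      simp [Matrix.mul_apply, Module.Basis.toMatrix_apply, hκd]
    rw [h1, Matrix.det_smul, Matrix.det_mul, Matrix.det_transpose, ← Module.Basis.det_apply,
      ← hκd, Fintype.card_fin]
    ring
  have h9 : |κ ^ 9| ^ (1 / 9 : ℝ) = |κ| := by
    rw [abs_pow, ← Real.rpow_natCast, ← Real.rpow_mul (abs_nonneg κ)]
    norm_num
  rw [volCoeff]
  simp only [h, h9]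
  rcases lt_or_gt_of_ne hκ with h | h
  · rw [Real.sign_of_neg (by exact Odd.pow_neg (by decide) h), abs_of_neg h]; ring
  · rw [Real.sign_of_pos (by positivity), abs_of_pos h]; ring

theorem volForm_std (f : Module.Basis (Fin 7) ℝ V) :
    volForm (lform f 3 stdList) = basisForm f (toF 7 seven) := by
  rw [show toF 7 seven = id by decide, volForm, volCoeff_std, basisForm_id, basisForm_id]
  conv_rhs => rw [f.det.eq_smul_basis_det (someBasis V)]

theorem metric_std (f : Module.Basis (Fin 7) ℝ V) :
    IsOrthonormalFor f (metric (lform f 3 stdList)) := by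
  intro x y
  have hκ : f.det (someBasis V) ≠ 0 := (f.isUnit_det (someBasis V)).ne_zero
  rw [metric, volCoeff_std, LinearMap.smul_apply, LinearMap.smul_apply, bBilin_std, smul_eq_mul,
    inv_mul_cancel_left₀ hκ]

theorem isG2Structure_std (f : Module.Basis (Fin 7) ℝ V) : IsG2Structure (lform f 3 stdList) := by
  refine ⟨?_, fun v hv => ?_⟩
  · rw [volForm_std, show toF 7 seven = id by decide, basisForm_id]
    exact f.det_ne_zero
  · rw [metric_std]
    have h0 : ∃ i, f.coord i v ≠ 0 := by
      by_contra hc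
      push Not at hc
      exact hv (f.ext_elem fun i => by simpa using hc i)
    obtain ⟨i, hi⟩ := h0
    refine Finset.sum_pos' (fun j _ => mul_self_nonneg _) ⟨i, Finset.mem_univ _, ?_⟩
    exact mul_self_pos.2 hi

theorem starOf_std (f : Module.Basis (Fin 7) ℝ V) {k m : ℕ} (h : m + k = 7)
    {l : List (ℤ × List ℕ)} (hl : validForm k l = true) {J : List ℕ}
    (hJ : validIndex m J = true) :
    starOf (lform f 3 stdList) h (lform f k l) (fun a => f (toF m J a)) = (lstar l J : ℝ) := by
  rw [starOf, volForm_std]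
  exact hodgeStar_lform (metric_std f) h hl hJ

/-- The list `l'` represents the Hodge star of the `k`-form represented by `l`. -/
def isStar (k m : ℕ) (l l' : List (ℤ × List ℕ)) : Bool :=
  validForm k l && validForm m l' && (increasing m seven).all fun J => lstar l J == leval l' J

/-- The star of e^I takes the value `sgn seven (I ++ J)` on f_J, so a claimed star is checked by
comparing integers over increasing J. -/
theorem starOf_std_eq (f : Module.Basis (Fin 7) ℝ V) {k m : ℕ} (h : m + k = 7)
    {l l' : List (ℤ × List ℕ)} (hl : isStar k m l l' = true) :
    starOf (lform f 3 stdList) h (lform f k l) = lform f m l' := by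
  simp only [isStar, Bool.and_eq_true, List.all_eq_true, beq_iff_eq] at hl
  exact lform_ext f hl.1.2 fun J hJ => by
    rw [starOf_std f h hl.1.1 (validIndex_of_mem_increasing hJ), hl.2 J hJ]

/-- `⋆φ` in an adapted basis. -/
def starStdList : List (ℤ × List ℕ) :=
  [(1, [2, 3, 4, 5]), (1, [0, 1, 4, 5]), (1, [0, 1, 2, 3]), (-1, [1, 3, 5, 6]),
    (1, [1, 2, 4, 6]), (1, [0, 3, 4, 6]), (1, [0, 2, 5, 6])]

theorem starOf_std_std (f : Module.Basis (Fin 7) ℝ V) :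
    starOf (lform f 3 stdList) (m := 4) rfl (lform f 3 stdList) = lform f 4 starStdList :=
  starOf_std_eq f rfl (by decide +kernel)

theorem starOf_zero (φ : V [⋀^Fin 3]→ₗ[ℝ] ℝ) {k m : ℕ} (h : m + k = 7) :
    starOf φ h (0 : V [⋀^Fin k]→ₗ[ℝ] ℝ) = 0 := hodgeStar_zero _ _ h

end Standard
end G2

/-! ### Differential and Ricci tensor from structure constants -/

namespace G2

section Structure

variable {𝔤 : Type*} [LieRing 𝔤] [LieAlgebra ℝ 𝔤]

/-- `C` is the tensor of structure constants in the basis `f`. -/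
def HasStructureConstants (f : Module.Basis (Fin 7) ℝ 𝔤) (C : Fin 7 → Fin 7 → Fin 7 → ℝ) : Prop :=
  ∀ a b, ⁅f a, f b⁆ = ∑ c, C a b c • f c

/-- The contribution of the integral tensor `A` of structure constants to the differential
of the `k`-form represented by `l`. -/
def lce (k : ℕ) (A : ℕ → ℕ → ℕ → ℤ) (l : List (ℤ × List ℕ)) (J : List ℕ) : ℤ :=
  -((List.range k).map fun i => ((List.range k).map fun j => bif Nat.ble i j then
    (-1) ^ (i + j) * ((List.range 7).map fun c => A (J.getD i 0) (J.getD (j + 1) 0) c *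
      -- The guard does not affect the value; it avoids expanding determinants that a vanishing
      -- structure constant multiplies.
      bif A (J.getD i 0) (J.getD (j + 1) 0) c == 0 then 0 else
        leval l (c :: (J.eraseIdx i).eraseIdx j)).sum else 0).sum).sum

theorem vecCons_sum_smul {V : Type*} [AddCommGroup V] [Module ℝ V] {k : ℕ}
    (θ : V [⋀^Fin (k + 1)]→ₗ[ℝ] ℝ) (c : Fin n → ℝ) (f : Fin n → V) (v : Fin k → V) :
    θ (Matrix.vecCons (∑ q, c q • f q) v) = ∑ q, c q * θ (Matrix.vecCons (f q) v) := by
  simp_rw [← AlternatingMap.curryLeft_apply_apply]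
  rw [map_sum, alternatingMap_sum_apply]
  simp only [map_smul, AlternatingMap.smul_apply, smul_eq_mul]

theorem toF_getD {k : ℕ} (J : List ℕ) (a : Fin k) : toF k J a = Fin.ofNat 7 (J.getD a 0) := rfl

/-- The differential is linear in the structure constants, so its real parameter t separates from
two integer computations. -/
theorem ceDiff_lform {f : Module.Basis (Fin 7) ℝ 𝔤} {A B : ℕ → ℕ → ℕ → ℤ} {t : ℝ}
    (hC : HasStructureConstants f fun a b c => (A a b c : ℝ) + t * (B a b c : ℝ)) {k : ℕ}
    {l : List (ℤ × List ℕ)} (hl : validForm (k + 1) l = true) {J : List ℕ}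
    (hJ : validIndex (k + 2) J = true) :
    ceDiff (lform f (k + 1) l) (fun a => f (toF (k + 2) J a)) =
      (lce (k + 1) A l J : ℝ) + t * (lce (k + 1) B l J : ℝ) := by
  have hv : ∀ (i j : Fin (k + 1)), validIndex k ((J.eraseIdx i).eraseIdx j) = true := fun i j =>
    validIndex_eraseIdx (validIndex_eraseIdx hJ i.castSucc) j
  have hJ' : ∀ i : Fin (k + 2), ((toF (k + 2) J i : Fin 7) : ℕ) = J.getD i 0 := fun i => by
    rw [toF_getD, Fin.val_ofNat]
    refine Nat.mod_eq_of_lt ((validIndex_iff.1 hJ).2 _ ?_)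
    have : (i : ℕ) < J.length := by rw [(validIndex_iff.1 hJ).1]; exact i.2
    rw [List.getD_eq_getElem _ _ this]
    exact List.getElem_mem this
  have h1 : ∀ (i j : Fin (k + 1)), lform f (k + 1) l (Matrix.vecCons
      ⁅f (toF (k + 2) J i.castSucc), f (toF (k + 2) J j.succ)⁆
      (j.removeNth (i.castSucc.removeNth fun a => f (toF (k + 2) J a)))) =
      (∑ c : Fin 7, (A (J.getD i 0) (J.getD (j + 1) 0) c : ℝ) *
        (leval l ((c : ℕ) :: (J.eraseIdx i).eraseIdx j) : ℝ)) +
      t * (∑ c : Fin 7, (B (J.getD i 0) (J.getD (j + 1) 0) c : ℝ) *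
        (leval l ((c : ℕ) :: (J.eraseIdx i).eraseIdx j) : ℝ)) := by
    intro i j
    rw [hC, vecCons_sum_smul, Finset.mul_sum, ← Finset.sum_add_distrib]
    refine Finset.sum_congr rfl fun c _ => ?_
    -- Position i is removed first, so `j` indexes the shortened tuple and stands for position j + 1
    -- of the original one.
    have h2 : Matrix.vecCons (f c) (j.removeNth (i.castSucc.removeNth fun a =>
        f (toF (k + 2) J a))) = fun a =>
          f (toF (k + 1) ((c : ℕ) :: (J.eraseIdx i).eraseIdx j) a) := by
      funext a
      refine Fin.cases ?_ (fun a => ?_) a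
      · simp [toF]
      · rw [toF_cons_succ, toF_eraseIdx]
        have := toF_eraseIdx (k := k + 1) J i.castSucc
        simp only [Fin.val_castSucc] at this
        rw [this]
        rfl
    rw [h2, lform_basis f hl (validIndex_cons.2 ⟨c.2, hv i j⟩)]
    beta_reduce
    rw [hJ', hJ', Fin.val_castSucc,
      Fin.val_succ]
    ring
  have h3 : ∀ A : ℕ → ℕ → ℕ → ℤ, (lce (k + 1) A l J : ℝ) =
      -∑ i : Fin (k + 1), ∑ j ≥ i, (-1 : ℤ) ^ (i + j : ℕ) • ∑ c : Fin 7,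
        (A (J.getD i 0) (J.getD (j + 1) 0) c : ℝ) *
          (leval l ((c : ℕ) :: (J.eraseIdx i).eraseIdx j) : ℝ) := by
    intro A
    rw [lce, list_sum_range, Int.cast_neg, Int.cast_sum]
    congr 1
    refine Finset.sum_congr rfl fun i _ => ?_
    rw [list_sum_range, Int.cast_sum]
    have : (Finset.Ici i) = Finset.univ.filter fun j => i ≤ j := by ext; simp
    rw [this, Finset.sum_filter]
    refine Finset.sum_congr rfl fun j _ => ?_
    by_cases hij : i ≤ j
    · have hb : Nat.ble i j = true := Nat.ble_eq_true_of_le hij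
      rw [if_pos hij, hb, cond_true, zsmul_eq_mul, Int.cast_mul, list_sum_range, Int.cast_sum]
      congr 1
      refine Finset.sum_congr rfl fun c _ => ?_
      by_cases h : A (J.getD i 0) (J.getD (j + 1) 0) c = 0
      · rw [h]; simp
      · have : (A (J.getD i 0) (J.getD (j + 1) 0) c == 0) = false := by simpa using h
        rw [this, cond_false, Int.cast_mul]
    · have hb : Nat.ble i j = false := by
        rw [← Bool.not_eq_true, Nat.ble_eq]
        exact hij
      rw [if_neg hij, hb, cond_false, Int.cast_zero]
  rw [ceDiff_apply, h3, h3, mul_neg, ← neg_add, Finset.mul_sum, ← Finset.sum_add_distrib]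
  congr 1
  refine Finset.sum_congr rfl fun i _ => ?_
  rw [Finset.mul_sum, ← Finset.sum_add_distrib]
  refine Finset.sum_congr rfl fun j _ => ?_
  rw [h1, smul_add, mul_smul_comm]

/-- Twice the Christoffel symbols of an integral tensor of structure constants. -/
def lgamma (A : ℕ → ℕ → ℕ → ℤ) (a b c : ℕ) : ℤ := A a b c - A b c a + A c a b

/-- The polarised integral expression for four times the Ricci tensor. -/
def lricci (A B : ℕ → ℕ → ℕ → ℤ) (x y : ℕ) : ℤ :=
  ((List.range 7).map fun i => ((List.range 7).map fun k =>
    lgamma A x y k * lgamma B i k i - lgamma A i y k * lgamma B x k i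
      - 2 * A i x k * lgamma B k y i).sum).sum

variable [Fact (Module.finrank ℝ 𝔤 = 7)] {f : Module.Basis (Fin 7) ℝ 𝔤}
  {g : LinearMap.BilinForm ℝ 𝔤}

theorem nabla_basis (hg : IsOrthonormalFor f g) {C : Fin 7 → Fin 7 → Fin 7 → ℝ}
    (hC : HasStructureConstants f C) (a b : Fin 7) :
    nabla g (f a) (f b) = ∑ c, (1 / 2 * (C a b c - C b c a + C c a b)) • f c := by
  have h : ∀ a b c, g ⁅f a, f b⁆ (f c) = C a b c := fun a b c => by
    rw [hg.apply_basis, hC]; simp [Finsupp.single_apply]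
  rw [nabla, LinearMap.mk₂_apply, hg.sharp_eq]
  simp only [koszul_apply, h]

/-- The trace of z ↦ R(z, x)y, with each ∇ and the bracket [f_i, f_x] expanded in the basis. -/
theorem ricciForm_basis {C G : Fin 7 → Fin 7 → Fin 7 → ℝ}
    (hC : HasStructureConstants f C)
    (hG : ∀ a b, nabla g (f a) (f b) = ∑ c, G a b c • f c) (x y : Fin 7) :
    ricciForm g (f x) (f y) =
      ∑ i, ∑ k, (G x y k * G i k i - G i y k * G x k i - C i x k * G k y i) := by
  rw [ricciForm, LinearMap.mk₂_apply, LinearMap.trace_eq_matrix_trace ℝ f, Matrix.trace]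
  refine Finset.sum_congr rfl fun i _ => ?_
  rw [Matrix.diag_apply, LinearMap.toMatrix_apply, LinearMap.flip_apply, LinearMap.flip_apply,
    curvature, LinearMap.mk₂_apply]
  simp only [LinearMap.sub_apply, LinearMap.comp_apply, hC i x, map_sum, map_smul, hG,
    LinearMap.sum_apply, LinearMap.smul_apply, map_sub]
  simp [Finsupp.single_apply, Finset.sum_sub_distrib]

/-- Ricci is quadratic in the structure constants; the factor 4 clears the two halves of the Koszul
formula, and the powers of t carry the pure and mixed integer parts. -/
theorem ricciForm_integral (hg : IsOrthonormalFor f g) {A B : ℕ → ℕ → ℕ → ℤ} {t : ℝ}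
    (hC : HasStructureConstants f fun a b c => (A a b c : ℝ) + t * (B a b c : ℝ)) (x y : Fin 7) :
    4 * ricciForm g (f x) (f y) =
      (lricci A A x y : ℝ) + t * ((lricci A B x y + lricci B A x y : ℤ) : ℝ)
        + t ^ 2 * (lricci B B x y : ℝ) := by
  rw [ricciForm_basis hC (nabla_basis hg hC)]
  simp only [lricci, list_sum_range, lgamma, Int.cast_add, Int.cast_sum, Finset.mul_sum, ← Finset.sum_add_distrib]
  refine Finset.sum_congr rfl fun i _ => Finset.sum_congr rfl fun k _ => ?_
  push_cast
  ring

end Structure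

end G2

/-! ### 𝔨_α in an orthonormal basis: torsion, curvature, algebraic soliton -/

namespace KAlg

open G2

/-- The scaling factors of the orthonormal basis of `φ_α`. -/
def weight (α : ℝ) : Fin 7 → ℝ := ![1, 1, 1, 1, 1, 1, 2 / α]

theorem isUnit_weight {α : ℝ} (hα : 0 < α) (i : Fin 7) : IsUnit (weight α i) := by
  have h : 2 / α ≠ 0 := by positivity
  fin_cases i <;> simp [weight, h]

/-- The orthonormal basis `(e_1, …, e_6, (2/α) e_7)`. -/
def onb {α : ℝ} (hα : 0 < α) : Module.Basis (Fin 7) ℝ (KAlg α) :=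
  (basis α).isUnitSMul (isUnit_weight hα)

theorem onb_apply {α : ℝ} (hα : 0 < α) (i : Fin 7) : onb hα i = weight α i • basis α i :=
  Module.Basis.isUnitSMul_apply _ _

theorem onb_coord {α : ℝ} (hα : 0 < α) (i : Fin 7) :
    (onb hα).coord i = (weight α i)⁻¹ • (basis α).coord i := by
  refine (basis α).ext fun j => ?_
  have h : basis α j = (weight α j)⁻¹ • onb hα j := by
    rw [onb_apply, smul_smul, inv_mul_cancel₀ (isUnit_weight hα j).ne_zero, one_smul]
  by_cases hij : j = i
  · subst hij
    nth_rw 1 [h]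
    simp
  · nth_rw 1 [h]
    simp [hij]

theorem basisForm_onb {α : ℝ} (hα : 0 < α) {k : ℕ} (i : Fin k → Fin 7) :
    basisForm (onb hα) i = (∏ a, (weight α (i a))⁻¹) • basisForm (basis α) i := by
  ext v
  rw [AlternatingMap.smul_apply, basisForm_apply, basisForm_apply, smul_eq_mul,
    ← Matrix.det_mul_row]
  congr 1
  ext a b
  simp [onb_coord]

/-- `e^{pq}(e_a, e_b)`. -/
def pairing (a b p q : ℕ) : ℤ :=
  (bif Nat.beq a p && Nat.beq b q then 1 else 0) - (bif Nat.beq a q && Nat.beq b p then 1 else 0)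

/-- The part of the structure constants of `𝔨_α` in the basis `onb` that does not depend on
`α`. -/
def constA (a b : ℕ) : ℕ → ℤ
  | 0 => 2 * pairing a b 0 6
  | 1 => 2 * pairing a b 2 4
  | 2 => pairing a b 1 4
  | 3 => -pairing a b 3 6
  | 4 => -pairing a b 1 2
  | 5 => -pairing a b 5 6
  | _ => 0

/-- The coefficient of `2/α` in the structure constants of `𝔨_α` in the basis `onb`. -/
def constB (a b : ℕ) : ℕ → ℤ
  | 2 => pairing a b 4 6
  | 3 => pairing a b 5 6
  | 4 => -pairing a b 2 6
  | 5 => -pairing a b 3 6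
  | _ => 0

theorem pairing_eq (a b p q : Fin 7) : pairing a b p q =
    (if a = p then 1 else 0) * (if b = q then 1 else 0) -
      (if a = q then 1 else 0) * (if b = p then 1 else 0) := by
  have h : ∀ a b : Fin 7, Nat.beq a b = decide (a = b) := by decide
  have hb : ∀ (P Q : Prop) [Decidable P] [Decidable Q], (bif decide P && decide Q then (1 : ℤ)
      else 0) = (if P then 1 else 0) * (if Q then 1 else 0) := fun P Q _ _ => by
    by_cases hP : P <;> by_cases hQ : Q <;> simp [hP, hQ]
  rw [pairing, h, h, h, h, hb, hb]

theorem bracket_apply {α : ℝ} (x y : KAlg α) : ⁅x, y⁆ = -structureEq α x y := rfl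

/-- The tensor of structure constants of `𝔨_α` in the basis `e`. -/
theorem structureConstants {α : ℝ} (hα : 0 < α) : HasStructureConstants (onb hα)
    fun a b c => (constA a b c : ℝ) + (2 / α) * (constB a b c : ℝ) := by
  intro a b
  rw [← (onb hα).sum_repr ⁅onb hα a, onb hα b⁆]
  refine Finset.sum_congr rfl fun c _ => ?_
  congr 1
  rw [← Module.Basis.coord_apply, onb_coord, onb_apply, onb_apply, smul_lie, lie_smul]
  have h : ∀ c, (basis α).coord c ⁅basis α a, basis α b⁆ =
      -structureEq α (fun k => ((if a = k then 1 else 0 : ℤ) : ℝ))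
        (fun k => ((if b = k then 1 else 0 : ℤ) : ℝ)) c := by
    intro c
    rw [bracket_apply]
    have h1 : ∀ i : Fin 7, basis α i = fun k => ((if i = k then 1 else 0 : ℤ) : ℝ) := by
      intro i; funext k
      refine (congrFun (Pi.basisFun_apply ℝ (Fin 7) i) k).trans ?_
      simp [Pi.single_apply, eq_comm]
    rw [h1, h1]
    rfl
  simp only [LinearMap.smul_apply, map_smul, h, smul_eq_mul]
  have hα' := hα.ne'
  clear h
  -- The pairing vanishes unless {a, b} = {p, q}, so the weights may be read off at p and q.
  have hw : ∀ p q : Fin 7, weight α a * weight α b * (pairing a b p q : ℝ) =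
      weight α p * weight α q * (pairing a b p q : ℝ) := by
    intro p q
    rw [pairing_eq]
    split_ifs <;> simp_all [mul_comm]
  have hP : ∀ p q : Fin 7, ((if a = p then 1 else 0 : ℤ) : ℝ) * ((if b = q then 1 else 0 : ℤ) : ℝ) -
      ((if a = q then 1 else 0 : ℤ) : ℝ) * ((if b = p then 1 else 0 : ℤ) : ℝ) =
        (pairing a b p q : ℝ) := by
    intro p q
    rw [pairing_eq]
    split_ifs <;> simp
  -- Rescaling e_7 turns the coefficients α and α/2 into the integers 2 and 1, and puts 2/α on the
  -- rotation terms instead.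
  have ht : α * (2 / α) = 2 := by field_simp
  have h6 : weight α 6 = 2 / α := rfl
  have h1 : ∀ p : Fin 7, p ≠ 6 → weight α p = 1 := by
    intro p hp
    fin_cases p <;> first | rfl | exact absurd rfl hp
  have hw6 : ∀ p : Fin 7, p ≠ 6 → weight α a * weight α b * (pairing a b p 6 : ℝ) =
      2 / α * (pairing a b p 6 : ℝ) := fun p hp => (hw p 6).trans (by rw [h1 p hp, h6, one_mul]; rfl)
  have hw1 : ∀ p q : Fin 7, p ≠ 6 → q ≠ 6 → weight α a * weight α b * (pairing a b p q : ℝ) =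
      (pairing a b p q : ℝ) := fun p q hp hq => by rw [hw, h1 p hp, h1 q hq, one_mul, one_mul]
  have hS : structureEq α (fun k => ((if a = k then 1 else 0 : ℤ) : ℝ))
      (fun k => ((if b = k then 1 else 0 : ℤ) : ℝ)) =
      ![-α * (pairing a b 0 6 : ℝ), -2 * (pairing a b 2 4 : ℝ),
        -(pairing a b 1 4 : ℝ) - (pairing a b 4 6 : ℝ),
        α / 2 * (pairing a b 3 6 : ℝ) - (pairing a b 5 6 : ℝ),
        (pairing a b 1 2 : ℝ) + (pairing a b 2 6 : ℝ),
        (pairing a b 3 6 : ℝ) + α / 2 * (pairing a b 5 6 : ℝ), 0] := by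
    rw [show (pairing a b 0 6 : ℝ) = _ from (hP 0 6).symm,
      show (pairing a b 2 4 : ℝ) = _ from (hP 2 4).symm,
      show (pairing a b 1 4 : ℝ) = _ from (hP 1 4).symm,
      show (pairing a b 4 6 : ℝ) = _ from (hP 4 6).symm,
      show (pairing a b 3 6 : ℝ) = _ from (hP 3 6).symm,
      show (pairing a b 5 6 : ℝ) = _ from (hP 5 6).symm,
      show (pairing a b 1 2 : ℝ) = _ from (hP 1 2).symm,
      show (pairing a b 2 6 : ℝ) = _ from (hP 2 6).symm]
    rfl
  rw [hS]
  have e06 : weight α a * weight α b * (pairing a b 0 6 : ℝ) = 2 / α * (pairing a b 0 6 : ℝ) :=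
    hw6 0 (by decide)
  have e24 : weight α a * weight α b * (pairing a b 2 4 : ℝ) = (pairing a b 2 4 : ℝ) :=
    hw1 2 4 (by decide) (by decide)
  have e14 : weight α a * weight α b * (pairing a b 1 4 : ℝ) = (pairing a b 1 4 : ℝ) :=
    hw1 1 4 (by decide) (by decide)
  have e46 : weight α a * weight α b * (pairing a b 4 6 : ℝ) = 2 / α * (pairing a b 4 6 : ℝ) :=
    hw6 4 (by decide)
  have e36 : weight α a * weight α b * (pairing a b 3 6 : ℝ) = 2 / α * (pairing a b 3 6 : ℝ) :=
    hw6 3 (by decide)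
  have e56 : weight α a * weight α b * (pairing a b 5 6 : ℝ) = 2 / α * (pairing a b 5 6 : ℝ) :=
    hw6 5 (by decide)
  have e12 : weight α a * weight α b * (pairing a b 1 2 : ℝ) = (pairing a b 1 2 : ℝ) :=
    hw1 1 2 (by decide) (by decide)
  have e26 : weight α a * weight α b * (pairing a b 2 6 : ℝ) = 2 / α * (pairing a b 2 6 : ℝ) :=
    hw6 2 (by decide)
  clear hS hP hw hw1 hw6
  fin_cases c <;> simp only [constA, constB, Fin.zero_eta, Fin.mk_one, Fin.reduceFinMk,
    Matrix.cons_val, Int.cast_mul, Int.cast_neg, Int.cast_zero, Int.cast_ofNat]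
  · rw [h1 0 (by decide)]
    linear_combination α * e06 + (pairing a b 0 6 : ℝ) * ht
  · rw [h1 1 (by decide)]
    linear_combination 2 * e24
  · rw [h1 2 (by decide)]
    linear_combination e14 + e46
  · rw [h1 3 (by decide)]
    linear_combination -α / 2 * e36 + e56 - (pairing a b 3 6 : ℝ) / 2 * ht
  · rw [h1 4 (by decide)]
    linear_combination -e12 - e26
  · rw [h1 5 (by decide)]
    linear_combination -e36 - α / 2 * e56 - (pairing a b 5 6 : ℝ) / 2 * ht
  · simp

/-- `τ_α` in the basis `onb`. -/
def tauList : List (ℤ × List ℕ) := [(4, [0, 1]), (-2, [2, 3]), (-2, [4, 5])]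

/-- `d τ_α` in the basis `onb`. -/
def dTauList : List (ℤ × List ℕ) :=
  [(8, [0, 1, 6]), (8, [0, 2, 4]), (-2, [1, 3, 4]), (-2, [1, 2, 5]), (2, [2, 3, 6]),
    (2, [4, 5, 6])]

/-- `d ⋆φ_α` in the basis `onb`. -/
def dStarList : List (ℤ × List ℕ) := lwedge tauList stdList

theorem phi_eq {α : ℝ} (hα : 0 < α) : phi α = lform (onb hα) 3 stdList := by
  simp only [stdList, lform_cons, lform_nil, basisForm_onb, phi,
    show toF 3 [0, 1, 6] = ![0, 1, 6] by decide,
    show toF 3 [2, 3, 6] = ![2, 3, 6] by decide,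
    show toF 3 [4, 5, 6] = ![4, 5, 6] by decide,
    show toF 3 [0, 2, 4] = ![0, 2, 4] by decide,
    show toF 3 [0, 3, 5] = ![0, 3, 5] by decide,
    show toF 3 [1, 2, 5] = ![1, 2, 5] by decide,
    show toF 3 [1, 3, 4] = ![1, 3, 4] by decide]
  simp [Fin.prod_univ_succ, weight]
  module

theorem tau_eq {α : ℝ} (hα : 0 < α) : tau α = lform (onb hα) 2 tauList := by
  simp only [tauList, lform_cons, lform_nil, basisForm_onb, tau,
    show toF 2 [0, 1] = ![0, 1] by decide,
    show toF 2 [2, 3] = ![2, 3] by decide,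
    show toF 2 [4, 5] = ![4, 5] by decide]
  simp [Fin.prod_univ_succ, weight]
  module

/-- The list `l'` represents the differential of the `k`-form represented by `l`. -/
def isDiff (k : ℕ) (l l' : List (ℤ × List ℕ)) : Bool :=
  validForm k l && validForm (k + 1) l' && ((increasing (k + 1) seven).all fun J =>
    lce k constA l J == leval l' J && lce k constB l J == 0)

/-- `isDiff` demands that the contribution of `constB` be zero. This holds for φ, τ and ⋆φ because
`constB` is an infinitesimal rotation in su(2) preserving all three; their differentials thus do not
involve α. -/
theorem ceDiff_onb {α : ℝ} (hα : 0 < α) {k : ℕ} {l l' : List (ℤ × List ℕ)}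
    (h : isDiff (k + 1) l l' = true) :
    ceDiff (lform (onb hα) (k + 1) l) = lform (onb hα) (k + 2) l' := by
  simp only [isDiff, Bool.and_eq_true, List.all_eq_true, beq_iff_eq] at h
  exact lform_ext (onb hα) h.1.2 fun J hJ => by
    rw [ceDiff_lform (structureConstants hα) h.1.1 (validIndex_of_mem_increasing hJ),
      (h.2 J hJ).1, (h.2 J hJ).2]
    simp

theorem ceDiff_phi {α : ℝ} (hα : 0 < α) : ceDiff (phi α) = 0 := by
  rw [phi_eq hα]
  exact ceDiff_onb hα (k := 2) (l' := []) (by decide +kernel)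

theorem ceDiff_tau {α : ℝ} (hα : 0 < α) : ceDiff (tau α) = lform (onb hα) 3 dTauList := by
  rw [tau_eq hα]
  exact ceDiff_onb hα (k := 1) (by decide +kernel)

theorem ceDiff_star_phi {α : ℝ} (hα : 0 < α) :
    ceDiff (lform (onb hα) 4 starStdList) = lform (onb hα) 5 dStarList :=
  ceDiff_onb hα (k := 3) (by decide +kernel)

/-- The mixed and quadratic terms in the skew derivation `constB` vanish; the diagonal entries are
four times the Ricci eigenvalues. -/
theorem lricci_const : ∀ x y : Fin 7, lricci constA constA x y =
      (if x = y then ![0, 8, -16, 0, -16, 0, -24] x else 0) ∧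
    lricci constA constB x y + lricci constB constA x y = 0 ∧
    lricci constB constB x y = 0 := by
  decide +kernel

theorem ricciForm_onb {α : ℝ} (hα : 0 < α) (x y : Fin 7) :
    ricciForm (metric (phi α)) (onb hα x) (onb hα y) =
      if x = y then ![0, 2, -4, 0, -4, 0, -6] x else 0 := by
  rw [phi_eq hα]
  have h := ricciForm_integral (metric_std (onb hα))
    (structureConstants hα) x y
  obtain ⟨h1, h2, h3⟩ := lricci_const x y
  rw [h1, h2, h3] at h
  by_cases hxy : x = y
  · rw [if_pos hxy] at h ⊢
    fin_cases x <;> norm_num at h ⊢ <;> linarith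
  · rw [if_neg hxy] at h ⊢
    norm_num at h
    exact h

theorem metric_phi {α : ℝ} (hα : 0 < α) : IsOrthonormalFor (onb hα) (metric (phi α)) := by
  rw [phi_eq hα]; exact metric_std (onb hα)

/-- The diagonal entries of the derivation. -/
def derivEntry : Fin 7 → ℝ := ![2, 0, 0, -4, 0, -4, 0]

/-- The derivation `diag(2, 0, 0, -4, 0, -4, 0)`. -/
def deriv (α : ℝ) : LieDerivation ℝ (KAlg α) (KAlg α) where
  toFun x := (fun i => derivEntry i * x i : Fin 7 → ℝ)
  map_add' x y := funext fun i => mul_add _ (x i) (y i)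
  map_smul' c x := funext fun i => mul_left_comm _ c (x i)
  leibniz' x y := by
    change (fun i => derivEntry i * (-structureEq α x y) i) =
      -structureEq α x (fun i => derivEntry i * y i) -
        -structureEq α y (fun i => derivEntry i * x i)
    funext k
    fin_cases k <;> simp [structureEq, w, derivEntry] <;> ring

theorem deriv_basis (α : ℝ) (i : Fin 7) : deriv α (basis α i) = derivEntry i • basis α i := by
  have h : basis α i = (Pi.single i 1 : Fin 7 → ℝ) := Pi.basisFun_apply ℝ (Fin 7) i
  rw [h]
  refine funext fun k => ?_
  change derivEntry k * (Pi.single i 1 : Fin 7 → ℝ) k = derivEntry i * (Pi.single i 1 : Fin 7 → ℝ) k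
  by_cases hk : k = i
  · subst hk; rfl
  · simp [hk]

theorem deriv_onb {α : ℝ} (hα : 0 < α) (i : Fin 7) :
    deriv α (onb hα i) = derivEntry i • onb hα i := by
  rw [onb_apply, map_smul, deriv_basis, smul_comm]

theorem toMatrix_deriv (α : ℝ) :
    LinearMap.toMatrix (basis α) (basis α) (deriv α) =
      Matrix.diagonal ![2, 0, 0, -4, 0, -4, 0] := by
  ext i j
  rw [LinearMap.toMatrix_apply]
  have h : (deriv α : KAlg α →ₗ[ℝ] KAlg α) (basis α j) = derivEntry j • basis α j :=
    deriv_basis α j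
  rw [h, map_smul, Module.Basis.repr_self, Finsupp.smul_single, Finsupp.single_apply,
    Matrix.diagonal_apply]
  by_cases hij : i = j
  · subst hij; simp [derivEntry]
  · rw [if_neg hij, if_neg (Ne.symm hij)]

/-- τ is a sum of multiples 4, -2, -2 of the area forms of orthogonal planes, so its endomorphism
squares to minus the squares of these multiples. -/
theorem torsion_squares : ∀ x r : Fin 7, (∑ q : Fin 7, leval tauList [(x : ℕ), (q : ℕ)] *
    leval tauList [(q : ℕ), (r : ℕ)]) = if x = r then ![-16, -16, -4, -4, -4, -4, 0] x else 0 := by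
  decide +kernel

theorem tau_onb {α : ℝ} (hα : 0 < α) (x y : Fin 7) :
    tau α ![onb hα x, onb hα y] = (leval tauList [(x : ℕ), (y : ℕ)] : ℝ) := by
  rw [tau_eq hα, ← lform_basis (onb hα) (k := 2) (by decide)
    (validIndex_cons.2 ⟨x.2, validIndex_cons.2 ⟨y.2, rfl⟩⟩)]
  congr 1
  funext t
  refine Fin.cases ?_ (fun t => ?_) t
  · simp [toF]
  · rw [toF_cons_succ, Fin.fin_one_eq_zero t]
    simp [toF]

theorem toBilin_apply {V : Type*} [AddCommGroup V] [Module ℝ V] (τ : V [⋀^Fin 2]→ₗ[ℝ] ℝ) (x y : V) :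
    toBilin τ x y = τ ![x, y] := rfl

theorem torsionEnd_onb {α : ℝ} (hα : 0 < α) (x : Fin 7) :
    torsionEnd (phi α) (tau α) (onb hα x) =
      ∑ q : Fin 7, (leval tauList [(x : ℕ), (q : ℕ)] : ℝ) • onb hα q := by
  rw [torsionEnd, LinearMap.comp_apply, (metric_phi hα).sharp_eq]
  exact Finset.sum_congr rfl fun q _ => by rw [toBilin_apply, tau_onb]

/-- The eigenvalues of the square of the torsion endomorphism. -/
def torsionEntry : Fin 7 → ℝ := ![-16, -16, -4, -4, -4, -4, 0]

theorem torsionEnd_sq_onb {α : ℝ} (hα : 0 < α) (x : Fin 7) :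
    (torsionEnd (phi α) (tau α) ∘ₗ torsionEnd (phi α) (tau α)) (onb hα x) =
      torsionEntry x • onb hα x := by
  rw [LinearMap.comp_apply, torsionEnd_onb, map_sum]
  simp only [map_smul, torsionEnd_onb, Finset.smul_sum, smul_smul]
  rw [Finset.sum_comm]
  simp only [← Finset.sum_smul]
  have h : ∀ r : Fin 7, (∑ q : Fin 7, (leval tauList [(x : ℕ), (q : ℕ)] : ℝ) *
      (leval tauList [(q : ℕ), (r : ℕ)] : ℝ)) = if x = r then torsionEntry x else 0 := by
    intro r
    have := congrArg (Int.cast : ℤ → ℝ) (torsion_squares x r)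
    push_cast at this
    rw [this]
    split_ifs
    · fin_cases x <;> simp [torsionEntry]
    · simp
  simp [h]

theorem trace_torsionEnd_sq {α : ℝ} (hα : 0 < α) :
    LinearMap.trace ℝ (KAlg α) (torsionEnd (phi α) (tau α) ∘ₗ torsionEnd (phi α) (tau α)) =
      -48 := by
  rw [LinearMap.trace_eq_matrix_trace ℝ (onb hα), Matrix.trace]
  have h : ∀ i, (LinearMap.toMatrix (onb hα) (onb hα)
      (torsionEnd (phi α) (tau α) ∘ₗ torsionEnd (phi α) (tau α))).diag i = torsionEntry i := by
    intro i
    rw [Matrix.diag_apply, LinearMap.toMatrix_apply, torsionEnd_sq_onb]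
    simp
  simp only [h, torsionEntry, Fin.sum_univ_succ]
  norm_num [Fin.succ]

theorem ricci_onb {α : ℝ} (hα : 0 < α) (x : Fin 7) :
    ricci (metric (phi α)) (onb hα x) = (![0, 2, -4, 0, -4, 0, -6] : Fin 7 → ℝ) x • onb hα x := by
  rw [ricci, LinearMap.comp_apply, (metric_phi hα).sharp_eq]
  simp [ricciForm_onb]

theorem satisfiesAS {α : ℝ} (hα : 0 < α) : SatisfiesAS (phi α) (tau α) 6 (deriv α) := by
  refine (onb hα).ext fun i => ?_
  have hD : (deriv α : KAlg α →ₗ[ℝ] KAlg α) (onb hα i) = derivEntry i • onb hα i := deriv_onb hα i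
  rw [LinearMap.add_apply, LinearMap.sub_apply, LinearMap.sub_apply, LinearMap.smul_apply,
    LinearMap.smul_apply, LinearMap.smul_apply, torsionEnd_sq_onb, trace_torsionEnd_sq hα,
    ricci_onb, hD, LinearMap.id_apply, smul_smul, ← sub_smul, ← add_smul, ← sub_smul]
  congr 1
  fin_cases i <;> norm_num [derivEntry, torsionEntry]

theorem isStar_tau : isStar 2 5 tauList (dStarList.map fun p => (-p.1, p.2)) = true := by
  decide +kernel

theorem lform_neg {V : Type*} [AddCommGroup V] [Module ℝ V] (e : Module.Basis (Fin 7) ℝ V) (k : ℕ)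
    (l : List (ℤ × List ℕ)) : lform e k (l.map fun p => (-p.1, p.2)) = -lform e k l := by
  induction l with
  | nil => simp
  | cons p l ih =>
    rw [List.map_cons, lform_cons, lform_cons, ih]
    simp only [Int.cast_neg]
    module

theorem starOf_std_eq_neg {V : Type*} [AddCommGroup V] [Module ℝ V]
    [Fact (Module.finrank ℝ V = 7)] (f : Module.Basis (Fin 7) ℝ V) {k m : ℕ} (h : m + k = 7)
    {l l' : List (ℤ × List ℕ)} (hl : isStar k m l (l'.map fun p => (-p.1, p.2)) = true) :
    starOf (lform f 3 stdList) h (lform f k l) = -lform f m l' := by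
  rw [← lform_neg]
  exact starOf_std_eq f h hl

theorem wedge_tau_phi {α : ℝ} (hα : 0 < α) :
    wedge (tau α) (phi α) = lform (onb hα) 5 dStarList := by
  rw [phi_eq hα, tau_eq hα, dStarList]
  exact wedge_lform (onb hα) (by decide) stdList

theorem star_tau {α : ℝ} (hα : 0 < α) :
    starOf (phi α) (m := 5) rfl (tau α) = -lform (onb hα) 5 dStarList := by
  rw [phi_eq hα, tau_eq hα]
  exact starOf_std_eq_neg (onb hα) rfl isStar_tau

theorem star_phi {α : ℝ} (hα : 0 < α) :
    starOf (phi α) (m := 4) rfl (phi α) = lform (onb hα) 4 starStdList := by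
  rw [phi_eq hα]
  exact starOf_std_std (onb hα)

/-- Gives ⋆τ a name S, so that two torsion forms can be compared through their stars as abstract
five-forms. -/
theorem isTorsionForm_iff_starOf {𝔤 : Type*} [LieRing 𝔤] [LieAlgebra ℝ 𝔤]
    [Fact (Module.finrank ℝ 𝔤 = 7)] {φ : 𝔤 [⋀^Fin 3]→ₗ[ℝ] ℝ} {τ : 𝔤 [⋀^Fin 2]→ₗ[ℝ] ℝ}
    (h : 4 + 3 = 7) (h' : 5 + 2 = 7) :
    IsTorsionForm φ τ ↔ ceDiff (starOf φ h φ) = wedge τ φ ∧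
      ∃ S, starOf φ h' τ = S ∧ wedge τ φ = -S := by
  constructor
  · intro hτ
    refine ⟨hτ.1, _, ?_, hτ.2⟩
    rfl
  · rintro ⟨h1, S, h2, h3⟩
    exact ⟨h1, h3.trans (congrArg Neg.neg h2.symm)⟩

theorem isTorsionForm_tau {α : ℝ} (hα : 0 < α) : IsTorsionForm (phi α) (tau α) := by
  have h1 := ceDiff_star_phi hα
  have h2 := wedge_tau_phi hα
  have h3 := star_tau hα
  have h4 := star_phi hα
  generalize lform (onb hα) 5 dStarList = A at h1 h2 h3
  refine (isTorsionForm_iff_starOf rfl rfl).2 ⟨?_, _, h3, ?_⟩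
  · rw [h4]
    exact h1.trans h2.symm
  · exact h2.trans (neg_neg A).symm

theorem sgn_increasing_two : ∀ I ∈ increasing 2 seven, ∀ J ∈ increasing 2 seven,
    sgn I J = if I = J then 1 else 0 := by decide +kernel

/-- J is the complement of I: a five-tuple completes exactly one pair to a permutation of all seven
indices. -/
theorem exists_complement_two : ∀ I ∈ increasing 2 seven, ∃ J ∈ increasing 5 seven,
    sgn seven (I ++ J) ≠ 0 ∧ ∀ K ∈ increasing 2 seven, K ≠ I → sgn seven (K ++ J) = 0 := by
  decide +kernel

theorem two_form_expand {V : Type*} [AddCommGroup V] [Module ℝ V]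
    (f : Module.Basis (Fin 7) ℝ V) (β : V [⋀^Fin 2]→ₗ[ℝ] ℝ) :
    β = ∑ I ∈ (increasing 2 seven).toFinset,
      β (fun a => f (toF 2 I a)) • lform f 2 [(1, I)] := by
  refine ext_increasing f fun J hJ => ?_
  rw [alternatingMap_sum_apply, Finset.sum_eq_single_of_mem J (List.mem_toFinset.2 hJ)]
  · rw [AlternatingMap.smul_apply, lform_basis f (by
      simpa [validForm] using validIndex_of_mem_increasing hJ) (validIndex_of_mem_increasing hJ)]
    simp [leval, sgn_increasing_two J hJ J hJ]
  · intro I hI hIJ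
    rw [List.mem_toFinset] at hI
    rw [AlternatingMap.smul_apply, lform_basis f (by
      simpa [validForm] using validIndex_of_mem_increasing hI) (validIndex_of_mem_increasing hJ)]
    simp [leval, sgn_increasing_two I hI J hJ, hIJ]

/-- On the complementary five-tuple the star of β returns, up to sign, the single coefficient
β(f_I). -/
theorem starOf_two_injective {V : Type*} [AddCommGroup V] [Module ℝ V]
    [Fact (Module.finrank ℝ V = 7)] (f : Module.Basis (Fin 7) ℝ V)
    {φ : V [⋀^Fin 3]→ₗ[ℝ] ℝ} (hφ : φ = lform f 3 stdList) (h : 5 + 2 = 7)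
    {β γ : V [⋀^Fin 2]→ₗ[ℝ] ℝ} (hβ : starOf φ h β = starOf φ h γ) : β = γ := by
  let L : V [⋀^Fin 2]→ₗ[ℝ] ℝ →ₗ[ℝ] V [⋀^Fin 5]→ₗ[ℝ] ℝ :=
    { toFun := starOf φ h
      map_add' := hodgeStar_add _ _ h
      map_smul' := fun c β => hodgeStar_smul _ _ h c β }
  have key : ∀ (β : V [⋀^Fin 2]→ₗ[ℝ] ℝ) (J : List ℕ), J ∈ increasing 5 seven →
      starOf φ h β (fun a => f (toF 5 J a)) = ∑ I ∈ (increasing 2 seven).toFinset,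
        β (fun a => f (toF 2 I a)) * (sgn seven (I ++ J) : ℝ) := by
    intro β J hJ
    have h1 : starOf φ h β = L β := rfl
    conv_lhs => rw [h1, two_form_expand f β, map_sum, alternatingMap_sum_apply]
    refine Finset.sum_congr rfl fun I hI => ?_
    rw [List.mem_toFinset] at hI
    rw [map_smul, AlternatingMap.smul_apply, smul_eq_mul]
    congr 1
    have h2 : L (lform f 2 [(1, I)]) = starOf φ h (lform f 2 [(1, I)]) := rfl
    rw [h2, hφ, starOf_std f h (by simpa [validForm] using validIndex_of_mem_increasing hI)
      (validIndex_of_mem_increasing hJ)]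
    simp [lstar]
  refine ext_increasing f fun I hI => ?_
  obtain ⟨J, hJ, hne, hz⟩ := exists_complement_two I hI
  have h3 : ∀ β : V [⋀^Fin 2]→ₗ[ℝ] ℝ, starOf φ h β (fun a => f (toF 5 J a)) =
      β (fun a => f (toF 2 I a)) * (sgn seven (I ++ J) : ℝ) := by
    intro β
    rw [key β J hJ, Finset.sum_eq_single_of_mem I (List.mem_toFinset.2 hI)]
    intro K hK hKI
    rw [hz K (List.mem_toFinset.1 hK) hKI]
    simp
  have h4 := h3 β
  rw [hβ, h3 γ] at h4
  exact (mul_right_cancel₀ (Int.cast_ne_zero.2 hne) h4).symm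

/-- Any torsion form satisfies ⋆τ = -d⋆φ, and the star is injective on two-forms. -/
theorem isTorsionForm_iff {α : ℝ} (hα : 0 < α) (τ : KAlg α [⋀^Fin 2]→ₗ[ℝ] ℝ) :
    IsTorsionForm (phi α) τ ↔ τ = tau α := by
  refine ⟨fun h => ?_, fun h => h ▸ isTorsionForm_tau hα⟩
  obtain ⟨h1, S, h2, h3⟩ := (isTorsionForm_iff_starOf rfl rfl).1 h
  obtain ⟨k1, T, k2, k3⟩ := (isTorsionForm_iff_starOf rfl rfl).1 (isTorsionForm_tau hα)
  have hST : S = T := neg_injective ((h1.trans h3).symm.trans (k1.trans k3))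
  exact starOf_two_injective (onb hα) (phi_eq hα) rfl (h2.trans (hST.trans k2.symm))

theorem isClosedG2Structure_phi {α : ℝ} (hα : 0 < α) : IsClosedG2Structure (phi α) :=
  ⟨by rw [phi_eq hα]; exact isG2Structure_std _, ceDiff_phi hα⟩

/-- D is diagonal in an orthonormal basis, hence self-adjoint, so D itself serves as the adjoint
derivation. -/
theorem isAlgebraicSoliton_phi {α : ℝ} (hα : 0 < α) :
    IsAlgebraicSoliton (phi α) 6 (deriv α) := by
  refine ⟨isClosedG2Structure_phi hα, ⟨tau α, isTorsionForm_tau hα, satisfiesAS hα⟩, deriv α, ?_⟩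
  have h : ∀ (x : KAlg α) i, (onb hα).coord i (deriv α x) = derivEntry i * (onb hα).coord i x := by
    intro x i
    have h1 : (onb hα).coord i ∘ₗ (deriv α : KAlg α →ₗ[ℝ] KAlg α) =
        derivEntry i • (onb hα).coord i := by
      refine (onb hα).ext fun j => ?_
      rw [LinearMap.comp_apply, LinearMap.smul_apply]
      refine (congrArg _ (deriv_onb hα j)).trans ?_
      by_cases hij : j = i
      · subst hij; simp
      · simp [hij]
    exact LinearMap.congr_fun h1 x
  intro x y
  rw [metric_phi hα, metric_phi hα]
  refine Finset.sum_congr rfl fun i _ => ?_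
  rw [h, h]; ring

theorem metric_phi_apply {α : ℝ} (hα : 0 < α) (x y : KAlg α) : metric (phi α) x y =
    (∑ i : Fin 6, (basis α).coord i.castSucc x * (basis α).coord i.castSucc y)
      + α ^ 2 / 4 * ((basis α).coord 6 x * (basis α).coord 6 y) := by
  rw [metric_phi hα, Fin.sum_univ_castSucc]
  congr 1
  · refine Finset.sum_congr rfl fun i _ => ?_
    have : weight α i.castSucc = 1 := by fin_cases i <;> rfl
    rw [onb_coord, this, inv_one, one_smul]
  · have : weight α (Fin.last 6) = 2 / α := rfl
    rw [onb_coord, this, LinearMap.smul_apply, LinearMap.smul_apply, smul_eq_mul, smul_eq_mul,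
      inv_div]
    change α / 2 * (basis α).coord 6 x * (α / 2 * (basis α).coord 6 y) = _
    ring

theorem volForm_phi {α : ℝ} (hα : 0 < α) :
    volForm (phi α) = (α / 2) • basisForm (basis α) ![0, 1, 2, 3, 4, 5, 6] := by
  rw [phi_eq hα, volForm_std, show toF 7 seven = ![0, 1, 2, 3, 4, 5, 6] by decide, basisForm_onb]
  simp [Fin.prod_univ_succ, weight]

end KAlg

/-! ### Lie structure of 𝔨_α: non-solvability, splitting, isomorphism classes -/

namespace KAlg

open G2

/-- The coordinates of an element of `𝔨_α`. -/
def coords (α : ℝ) : KAlg α ≃ₗ[ℝ] (Fin 7 → ℝ) := (basis α).equivFun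

theorem coords_lie {α : ℝ} (x y : KAlg α) :
    coords α ⁅x, y⁆ = -structureEq α (coords α x) (coords α y) := rfl

theorem coords_basis {α : ℝ} (i j : Fin 7) : coords α (basis α i) j = if i = j then 1 else 0 := by
  rw [coords, Module.Basis.equivFun_self]

theorem lie_basis_3_5 (α : ℝ) : ⁅basis α 2, basis α 4⁆ = (2 : ℝ) • basis α 1 := by
  refine (coords α).injective (funext fun k => ?_)
  rw [coords_lie, map_smul]
  fin_cases k <;> simp [structureEq, w, coords_basis]

theorem lie_basis_2_5 (α : ℝ) : ⁅basis α 1, basis α 4⁆ = basis α 2 := by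
  refine (coords α).injective (funext fun k => ?_)
  rw [coords_lie]
  fin_cases k <;> simp [structureEq, w, coords_basis]

theorem lie_basis_3_2 (α : ℝ) : ⁅basis α 2, basis α 1⁆ = basis α 4 := by
  refine (coords α).injective (funext fun k => ?_)
  rw [coords_lie]
  fin_cases k <;> simp [structureEq, w, coords_basis]

/-- e_2, e_3 and e_5 are, up to a factor, brackets of one another, so they survive in every term of
the derived series. -/
theorem not_isSolvable (α : ℝ) : ¬ LieAlgebra.IsSolvable (KAlg α) := by
  intro h
  obtain ⟨k, hk⟩ := (LieAlgebra.isSolvable_iff ℝ (KAlg α)).1 h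
  have key : ∀ k, basis α 1 ∈ LieAlgebra.derivedSeries ℝ (KAlg α) k ∧
      basis α 2 ∈ LieAlgebra.derivedSeries ℝ (KAlg α) k ∧
      basis α 4 ∈ LieAlgebra.derivedSeries ℝ (KAlg α) k := by
    intro k
    induction k with
    | zero => simp [LieAlgebra.derivedSeries_def]
    | succ k ih =>
      obtain ⟨h1, h2, h3⟩ := ih
      rw [LieAlgebra.derivedSeries_def, LieAlgebra.derivedSeriesOfIdeal_succ]
      rw [LieAlgebra.derivedSeries_def] at h1 h2 h3
      refine ⟨?_, ?_, ?_⟩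
      · have h4 : basis α 1 = (1 / 2 : ℝ) • ⁅basis α 2, basis α 4⁆ := by
          rw [lie_basis_3_5, smul_smul]; norm_num
        rw [h4]
        exact Submodule.smul_mem _ _ (LieSubmodule.lie_mem_lie h2 h3)
      · rw [← lie_basis_2_5]
        exact LieSubmodule.lie_mem_lie h1 h3
      · rw [← lie_basis_3_2]
        exact LieSubmodule.lie_mem_lie h2 h1
  have h1 := (key k).1
  rw [hk, LieSubmodule.mem_bot] at h1
  exact (basis α).ne_zero 1 h1

theorem isUnimodular (α : ℝ) : IsUnimodular (KAlg α) := by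
  intro x
  rw [LinearMap.trace_eq_matrix_trace ℝ (basis α), Matrix.trace]
  have h : ∀ i, (LinearMap.toMatrix (basis α) (basis α) (LieAlgebra.ad ℝ (KAlg α) x)).diag i =
      coords α ⁅x, basis α i⁆ i := fun i => by
    rw [Matrix.diag_apply, LinearMap.toMatrix_apply, LieAlgebra.ad_apply]; rfl
  simp only [h, coords_lie, Fin.sum_univ_succ, Pi.neg_apply]
  simp [structureEq, w, coords_basis, Fin.succ]
  ring

/-- The `𝔰𝔩(2, ℝ)` component. -/
def toSl (x : Fin 7 → ℝ) : Matrix (Fin 2) (Fin 2) ℝ :=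
  !![x 2 / √2, (x 1 - x 6) / 2 + x 4 / √2; -(x 1 - x 6) / 2 + x 4 / √2, -x 2 / √2]

/-- The isomorphism `𝔨_α ≅ 𝔰𝔩(2, ℝ) ⊕ 𝔯'_{4, α, -α/2}`. -/
def equivProd (α : ℝ) :
    KAlg α ≃ₗ⁅ℝ⁆ LieAlgebra.SpecialLinear.sl (Fin 2) ℝ × RAlg α (-α / 2) where
  toFun x := (⟨toSl (coords α x), by
      change Matrix.trace (toSl (coords α x)) = 0
      rw [toSl, Matrix.trace_fin_two_of]
      ring⟩,
    -- e_7 is -e_2 plus the element e_2 + e_7 commuting with the Levi factor; this gives the x 1 - x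
    -- 6 in `toSl`. The sign here arises because ad(e_2 + e_7) acts on e_1 by -α, so f_4 corresponds
    -- to -(e_2 + e_7).
    (![coords α x 0, coords α x 3, coords α x 5, -coords α x 6] : Fin 4 → ℝ))
  map_add' x y := by
    refine Prod.ext (Subtype.ext ?_) (funext fun k => ?_)
    · change toSl (coords α (x + y)) = toSl (coords α x) + toSl (coords α y)
      rw [map_add]
      ext i j
      fin_cases i <;> fin_cases j <;> simp [toSl] <;> ring
    · change (![_, _, _, _] : Fin 4 → ℝ) k = (![_, _, _, _] : Fin 4 → ℝ) k +
        (![_, _, _, _] : Fin 4 → ℝ) k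
      rw [map_add]
      fin_cases k <;> simp; ring
  map_smul' c x := by
    refine Prod.ext (Subtype.ext ?_) (funext fun k => ?_)
    · change toSl (coords α (c • x)) = c • toSl (coords α x)
      rw [map_smul]
      ext i j
      fin_cases i <;> fin_cases j <;> simp [toSl] <;> ring
    · change (![_, _, _, _] : Fin 4 → ℝ) k = c * (![_, _, _, _] : Fin 4 → ℝ) k
      rw [map_smul]
      fin_cases k <;> simp
  map_lie' := by
    intro x y
    refine Prod.ext (Subtype.ext ?_) (funext fun k => ?_)
    · change toSl (coords α ⁅x, y⁆) = toSl (coords α x) * toSl (coords α y) -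
        toSl (coords α y) * toSl (coords α x)
      rw [coords_lie]
      generalize coords α x = x
      generalize coords α y = y
      have h : (√2)⁻¹ * (√2)⁻¹ = (1 / 2 : ℝ) := by
        rw [← mul_inv, Real.mul_self_sqrt (by norm_num)]; norm_num
      ext i j
      fin_cases i <;> fin_cases j <;>
        simp [toSl, structureEq, w, div_eq_mul_inv]
      · ring
      · linear_combination 2 * (x 4 * y 2 - x 2 * y 4) * h
      · linear_combination 2 * (x 2 * y 4 - x 4 * y 2) * h
      · ring
    · change (![_, _, _, _] : Fin 4 → ℝ) k = RAlg.br α (-α / 2) ![_, _, _, _] ![_, _, _, _] k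
      rw [coords_lie]
      generalize coords α x = x
      generalize coords α y = y
      fin_cases k <;> simp [structureEq, w, RAlg.br]
      · exact Or.inl (by ring)
      all_goals ring
  invFun p :=
    let A : Matrix (Fin 2) (Fin 2) ℝ := p.1
    let r : Fin 4 → ℝ := p.2
    -- The antisymmetric part of A returns x 1 - x 6, and x 6 is -r 3.
    (![r 0, A 0 1 - A 1 0 - r 3, A 0 0 * √2, r 1, (A 0 1 + A 1 0) / 2 * √2, r 2, -r 3] :
      Fin 7 → ℝ)
  left_inv x := by
    refine funext fun k => ?_
    change (![_, _, _, _, _, _, _] : Fin 7 → ℝ) k = coords α x k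
    fin_cases k <;> simp [toSl]
    · ring
    · field_simp
      ring
  right_inv p := by
    obtain ⟨⟨A, hA⟩, r⟩ := p
    have hA' : A 1 1 = -A 0 0 := by
      have h : A.trace = 0 := hA
      rw [Matrix.trace_fin_two] at h
      linarith
    refine Prod.ext (Subtype.ext ?_) (funext fun k => ?_)
    · change toSl (![r 0, A 0 1 - A 1 0 - r 3, A 0 0 * √2, r 1, (A 0 1 + A 1 0) / 2 * √2, r 2,
        -r 3] : Fin 7 → ℝ) = A
      ext i j
      fin_cases i <;> fin_cases j <;> simp [toSl, hA']
      · ring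
      · ring
      · field_simp
    · fin_cases k <;> first | rfl | exact neg_neg _

/-- The complementary factor is metabelian: brackets have no e_7-component, and ⟨e_1, e_4, e_6⟩ is
abelian. So double brackets fall into the Levi factor. -/
theorem coords_lie_lie {α : ℝ} (a b c d : KAlg α) {k : Fin 7} (hk : k ∈ ({0, 3, 5, 6} : Finset (Fin 7))) :
    coords α ⁅⁅a, b⁆, ⁅c, d⁆⁆ k = 0 := by
  rw [coords_lie, coords_lie, coords_lie]
  fin_cases hk <;> simp [structureEq, w]

/-- Membership in the Levi factor `⟨e_2, e_3, e_5⟩`. -/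
def InLevi {α : ℝ} (x : KAlg α) : Prop := ∀ k ∈ ({0, 3, 5, 6} : Finset (Fin 7)), coords α x k = 0

theorem eq_of_inLevi {α : ℝ} {x : KAlg α} (hx : InLevi x) :
    x = coords α x 1 • basis α 1 + coords α x 2 • basis α 2 + coords α x 4 • basis α 4 := by
  refine (coords α).injective (funext fun k => ?_)
  have h0 := hx 0 (by decide)
  have h3 := hx 3 (by decide)
  have h5 := hx 5 (by decide)
  have h6 := hx 6 (by decide)
  simp only [map_add, map_smul, Pi.add_apply, Pi.smul_apply, coords_basis, smul_eq_mul]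
  fin_cases k <;> simp [h0, h3, h5, h6]

/-- The Levi factor is spanned by brackets of brackets, and in the target all of these lie in the
Levi factor again. -/
theorem inLevi_map {α β : ℝ} (f : KAlg α ≃ₗ⁅ℝ⁆ KAlg β) {x : KAlg α} (hx : InLevi x) :
    InLevi (f x) := by
  intro k hk
  have h1 : basis α 1 = (1 / 2 : ℝ) • ⁅⁅basis α 1, basis α 4⁆, ⁅basis α 2, basis α 1⁆⁆ := by
    rw [lie_basis_2_5, lie_basis_3_2, lie_basis_3_5, smul_smul]; norm_num
  have h2 : basis α 2 = (1 / 2 : ℝ) • ⁅⁅basis α 2, basis α 4⁆, ⁅basis α 2, basis α 1⁆⁆ := by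
    rw [lie_basis_3_5, lie_basis_3_2, smul_lie, lie_basis_2_5, smul_smul]; norm_num
  have h4 : basis α 4 = (1 / 2 : ℝ) • ⁅⁅basis α 1, basis α 4⁆, ⁅basis α 2, basis α 4⁆⁆ := by
    rw [lie_basis_3_5, lie_basis_2_5, lie_smul, lie_basis_3_2, smul_smul]; norm_num
  have h : ∀ a b c d : KAlg α, coords β (f ((1 / 2 : ℝ) • ⁅⁅a, b⁆, ⁅c, d⁆⁆)) k = 0 := by
    intro a b c d
    rw [map_smul, LieEquiv.map_lie, LieEquiv.map_lie, LieEquiv.map_lie, map_smul, Pi.smul_apply,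
      coords_lie_lie _ _ _ _ hk, smul_zero]
  rw [eq_of_inLevi hx]
  simp only [map_add, map_smul]
  rw [ Pi.add_apply, Pi.add_apply, Pi.smul_apply, Pi.smul_apply, Pi.smul_apply]
  have k1 := h (basis α 1) (basis α 4) (basis α 2) (basis α 1)
  have k2 := h (basis α 2) (basis α 4) (basis α 2) (basis α 1)
  have k4 := h (basis α 1) (basis α 4) (basis α 2) (basis α 4)
  rw [← h1] at k1
  rw [← h2] at k2
  rw [← h4] at k4
  rw [k1, k2, k4]
  simp

theorem inLevi_basis (α : ℝ) {i : Fin 7} (hi : i ∈ ({1, 2, 4} : Finset (Fin 7))) :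
    InLevi (basis α i) := by
  intro k hk
  rw [coords_basis, if_neg]
  fin_cases hi <;> fin_cases hk <;> decide

/-- The image of an element commuting with the Levi factor commutes with the Levi factor. -/
theorem coords_of_commutes {α β : ℝ} (f : KAlg α ≃ₗ⁅ℝ⁆ KAlg β) {x : KAlg α}
    (hx : ∀ s : KAlg α, InLevi s → ⁅x, s⁆ = 0) : coords β (f x) 1 = coords β (f x) 6 ∧
      coords β (f x) 2 = 0 ∧ coords β (f x) 4 = 0 := by
  have h : ∀ i ∈ ({1, 2, 4} : Finset (Fin 7)), coords β ⁅f x, basis β i⁆ = 0 := by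
    intro i hi
    have h1 := hx _ (inLevi_map f.symm (inLevi_basis β hi))
    have h2 := congrArg f h1
    rw [LieEquiv.map_lie, map_zero, LieEquiv.apply_symm_apply] at h2
    rw [h2, map_zero]
  have h1 := congrFun (h 1 (by decide)) 2
  have h2 := congrFun (h 1 (by decide)) 4
  have h3 := congrFun (h 2 (by decide)) 4
  rw [coords_lie] at h1 h2 h3
  simp [structureEq, w, coords_basis] at h1 h2 h3
  refine ⟨by linarith, by linarith, by linarith⟩

theorem lie_levi_eq_zero {α : ℝ} {x : KAlg α} (h1 : coords α x 1 = coords α x 6)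
    (h2 : coords α x 2 = 0) (h4 : coords α x 4 = 0) {s : KAlg α} (hs : InLevi s) : ⁅x, s⁆ = 0 := by
  refine (coords α).injective (funext fun k => ?_)
  have k0 := hs 0 (by decide)
  have k3 := hs 3 (by decide)
  have k5 := hs 5 (by decide)
  have k6 := hs 6 (by decide)
  rw [coords_lie]
  fin_cases k <;> simp [structureEq, w, h1, h2, h4, k0, k3, k5, k6]

-- X = e_2 + e_7 acts on the rest of the centraliser of the Levi factor with eigenvalue -α on e_1
-- and α/2 ± i on ⟨e_4, e_6⟩. Its image acts like y X for the analogous X of 𝔨_β, where y is the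
-- e_7-coordinate `y 6`. Matching spectra gives β y = α, hence y > 0, and y² = 1.
set_option maxHeartbeats 800000 in
theorem eq_of_equiv {α β : ℝ} (hα : 0 < α) (hβ : 0 < β) (f : KAlg α ≃ₗ⁅ℝ⁆ KAlg β) : β = α := by
  have hX := coords_of_commutes f (x := basis α 1 + basis α 6)
    fun s hs => lie_levi_eq_zero (by simp [coords_basis]) (by simp [coords_basis])
      (by simp [coords_basis]) hs
  have hN : ∀ i ∈ ({0, 3, 5} : Finset (Fin 7)), coords β (f (basis α i)) 1 =
      coords β (f (basis α i)) 6 ∧ coords β (f (basis α i)) 2 = 0 ∧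
        coords β (f (basis α i)) 4 = 0 := by
    intro i hi
    refine coords_of_commutes f fun s hs => ?_
    fin_cases hi <;> exact lie_levi_eq_zero (by simp [coords_basis]) (by simp [coords_basis])
      (by simp [coords_basis]) hs
  have b0 : ⁅basis α 1 + basis α 6, basis α 0⁆ = (-α) • basis α 0 := by
    refine (coords α).injective (funext fun k => ?_)
    rw [coords_lie, map_add, map_smul]
    fin_cases k <;> simp [structureEq, w, coords_basis]
  have b3 : ⁅basis α 1 + basis α 6, basis α 3⁆ = (α / 2) • basis α 3 + basis α 5 := by
    refine (coords α).injective (funext fun k => ?_)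
    rw [coords_lie, map_add, map_add, map_smul]
    fin_cases k <;> simp [structureEq, w, coords_basis]
  have b5 : ⁅basis α 1 + basis α 6, basis α 5⁆ = -basis α 3 + (α / 2) • basis α 5 := by
    refine (coords α).injective (funext fun k => ?_)
    rw [coords_lie, map_add, map_add, map_smul, map_neg]
    fin_cases k <;> simp [structureEq, w, coords_basis]
  generalize basis α 1 + basis α 6 = X at *
  have c0 := congrArg (fun z => coords β (f z)) b0
  have c3 := congrArg (fun z => coords β (f z)) b3
  have c5 := congrArg (fun z => coords β (f z)) b5
  simp only [LieEquiv.map_lie, coords_lie] at c0 c3 c5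
  simp only [map_add, map_smul, map_neg] at c0 c3 c5
  have n0 : coords β (f (basis α 0)) ≠ 0 := by simp [Module.Basis.ne_zero]
  have n3 : coords β (f (basis α 3)) ≠ 0 := by simp [Module.Basis.ne_zero]
  obtain ⟨y1, y2, y4⟩ := hX
  obtain ⟨p1, p2, p4⟩ := hN 0 (by decide)
  obtain ⟨u1, u2, u4⟩ := hN 3 (by decide)
  obtain ⟨v1, v2, v4⟩ := hN 5 (by decide)
  generalize coords β (f X) = y at *
  generalize coords β (f (basis α 0)) = p at *
  generalize coords β (f (basis α 3)) = u at *
  generalize coords β (f (basis α 5)) = v at *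
  have p6 := congrFun c0 6
  have u6 := congrFun c3 6
  have v6 := congrFun c5 6
  simp [structureEq, hα.ne'] at p6 u6 v6
  -- No bracket has an e_7-component, so the e_7-coordinates of f(e_4), f(e_6) solve a homogeneous 2
  -- × 2 system of determinant 1 + α²/4.
  have hv6 : v 6 = 0 := by
    have : (1 + α ^ 2 / 4) * v 6 = 0 := by linear_combination -u6 - α / 2 * v6
    exact (mul_eq_zero.1 this).resolve_left (by positivity)
  have hu6 : u 6 = 0 := by rw [hv6] at v6; linarith
  have p0 := congrFun c0 0
  have p3 := congrFun c0 3
  have p5 := congrFun c0 5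
  have u0 := congrFun c3 0
  have u3 := congrFun c3 3
  have u5 := congrFun c3 5
  have v0 := congrFun c5 0
  have v3 := congrFun c5 3
  have v5 := congrFun c5 5
  simp [structureEq, w, p6, hu6, hv6] at p0 p3 p5 u0 u3 u5 v0 v3 v5
  clear c0 c3 c5 hN b0 b3 b5
  -- f(e_1) is an eigenvector for -α. If β y ≠ α it has no e_1-component, and -α would be an
  -- eigenvalue on the complex plane.
  have hμ : β * y 6 = α := by
    by_contra hne
    have hp0 : p 0 = 0 := by
      have : (β * y 6 - α) * p 0 = 0 := by linear_combination p0
      exact (mul_eq_zero.1 this).resolve_left (sub_ne_zero.2 hne)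
    -- The determinant of the action on ⟨e_4, e_6⟩ shifted by α.
    have hq : 0 < (β * y 6 / 2 + α) ^ 2 + y 6 ^ 2 := by
      rcases eq_or_ne (y 6) 0 with h | h
      · rw [h]; ring_nf; positivity
      · positivity
    have hp3 : p 3 = 0 := by
      have : ((β * y 6 / 2 + α) ^ 2 + y 6 ^ 2) * p 3 = 0 := by
        linear_combination (β * y 6 / 2 + α) * p3 + y 6 * p5
      exact (mul_eq_zero.1 this).resolve_left hq.ne'
    have hp5 : p 5 = 0 := by
      have : ((β * y 6 / 2 + α) ^ 2 + y 6 ^ 2) * p 5 = 0 := by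
        linear_combination (β * y 6 / 2 + α) * p5 - y 6 * p3
      exact (mul_eq_zero.1 this).resolve_left hq.ne'
    refine n0 (funext fun k => ?_)
    fin_cases k <;> simp [hp0, hp3, hp5, p1, p2, p4, p6]
  have hμ0 : 0 < y 6 := pos_of_mul_pos_right (hμ ▸ hα) hβ.le
  -- f(e_4) and f(e_6) span the plane belonging to α/2 ± i, which cannot meet the real eigenvalue
  -- -α.
  have hu0 : u 0 = 0 := by
    have h1 : v 0 = -(3 * α / 2) * u 0 := by linear_combination -u0 - u 0 * hμ
    have h2 : (1 + 9 * α ^ 2 / 4) * u 0 = 0 := by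
      rw [h1] at v0
      linear_combination v0 - 3 * α / 2 * u 0 * hμ
    exact (mul_eq_zero.1 h2).resolve_left (by positivity)
  have hv3 : v 3 = -y 6 * u 5 := by linear_combination -u3 + u 3 / 2 * hμ
  have hv5 : v 5 = y 6 * u 3 := by linear_combination -u5 + u 5 / 2 * hμ
  -- Eliminating v between the two rotation equations gives (1 - y²) u = 0, and u ≠ 0.
  have hs : y 6 = 1 := by
    by_contra hne
    have hsq : 1 - y 6 ^ 2 ≠ 0 := by
      intro h
      have : (1 - y 6) * (1 + y 6) = 0 := by linear_combination h
      rcases mul_eq_zero.1 this with h | h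
      · exact hne (by linarith)
      · linarith
    have hu3 : u 3 = 0 := by
      rw [hv3, hv5] at v3
      have : (1 - y 6 ^ 2) * u 3 = 0 := by linear_combination v3 + y 6 * u 5 / 2 * hμ
      exact (mul_eq_zero.1 this).resolve_left hsq
    have hu5 : u 5 = 0 := by
      rw [hv3, hv5] at v5
      have : (1 - y 6 ^ 2) * u 5 = 0 := by linear_combination v5 - y 6 * u 3 / 2 * hμ
      exact (mul_eq_zero.1 this).resolve_left hsq
    refine n3 (funext fun k => ?_)
    fin_cases k <;> simp [hu0, hu3, hu5, u1, u2, u4, hu6]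
  rw [hs, mul_one] at hμ
  exact hμ

end KAlg

/-! ### Exterior derivative of left-invariant forms -/

namespace G2

section LieGroups

variable {G : Type*} [TopologicalSpace G] [ChartedSpace (EuclideanSpace ℝ (Fin 7)) G] [Group G]
  [LieGroup (𝓡 7) ∞ G]

theorem mdifferentiable_mul_left (x : G) : MDifferentiable (𝓡 7) (𝓡 7) (fun y : G => x * y) :=
  (contMDiff_mul_left (I := 𝓡 7) (n := ∞)).mdifferentiable (by simp)

/-- The differential of left translation by `x⁻¹` at `x`, with values in `T_1 G`. -/
def maurerCartan (x : G) : TangentSpace (𝓡 7) x →L[ℝ] GroupLieAlgebra (𝓡 7) G :=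
  mfderiv (𝓡 7) (𝓡 7) (fun y : G => x⁻¹ * y) x

theorem maurerCartan_mulInvariant (x : G) (v : GroupLieAlgebra (𝓡 7) G) :
    maurerCartan x (mulInvariantVectorField v x) = v := by
  have h := mfderiv_comp (I := 𝓡 7) (I' := 𝓡 7) (I'' := 𝓡 7) (1 : G)
    (g := fun y : G => x⁻¹ * y) (f := fun y : G => x * y)
    (mdifferentiable_mul_left x⁻¹ (x * 1)) (mdifferentiable_mul_left x 1)
  have h1 : (fun y : G => x⁻¹ * y) ∘ (fun y : G => x * y) = id := by
    funext y; simp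
  rw [h1, mfderiv_id, mul_one] at h
  exact (DFunLike.congr_fun h v).symm

theorem mulInvariant_maurerCartan (x : G) (v : TangentSpace (𝓡 7) x) :
    mulInvariantVectorField (maurerCartan x v) x = v := by
  have h := mfderiv_comp (I := 𝓡 7) (I' := 𝓡 7) (I'' := 𝓡 7) x
    (g := fun y : G => x * y) (f := fun y : G => x⁻¹ * y)
    (mdifferentiable_mul_left x (x⁻¹ * x)) (mdifferentiable_mul_left x⁻¹ x)
  have h1 : (fun y : G => x * y) ∘ (fun y : G => x⁻¹ * y) = id := by
    funext y; simp
  rw [h1, mfderiv_id, inv_mul_cancel] at h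
  exact (DFunLike.congr_fun h v).symm

variable {𝔤 : Type*} [LieRing 𝔤] [LieAlgebra ℝ 𝔤]

/-- The identification of `T_x G` with the Lie algebra by left translation. -/
def leftTriv (ψ : 𝔤 ≃ₗ⁅ℝ⁆ GroupLieAlgebra (𝓡 7) G) (x : G) : TangentSpace (𝓡 7) x ≃ₗ[ℝ] 𝔤 where
  toFun v := ψ.symm (maurerCartan x v)
  map_add' v w := by rw [map_add, map_add]
  map_smul' c v := by rw [map_smul, map_smul]; rfl
  invFun u := mulInvariantVectorField (ψ u) x
  left_inv v := by
    beta_reduce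
    rw [LieEquiv.apply_symm_apply, mulInvariant_maurerCartan]
  right_inv u := by
    beta_reduce
    rw [maurerCartan_mulInvariant, LieEquiv.symm_apply_apply]

theorem leftInvariantForm_eq (ψ : 𝔤 ≃ₗ⁅ℝ⁆ GroupLieAlgebra (𝓡 7) G) {k : ℕ}
    (θ : 𝔤 [⋀^Fin k]→ₗ[ℝ] ℝ) (x : G) :
    leftInvariantForm ψ θ x = θ.compLinearMap (leftTriv ψ x : TangentSpace (𝓡 7) x →ₗ[ℝ] 𝔤) := rfl

theorem leftInvariantForm_zero (ψ : 𝔤 ≃ₗ⁅ℝ⁆ GroupLieAlgebra (𝓡 7) G) {k : ℕ} :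
    leftInvariantForm ψ (0 : 𝔤 [⋀^Fin k]→ₗ[ℝ] ℝ) = 0 := rfl

theorem leftInvariantForm_lform (ψ : 𝔤 ≃ₗ⁅ℝ⁆ GroupLieAlgebra (𝓡 7) G) {k : ℕ}
    (e : Module.Basis (Fin 7) ℝ 𝔤) (l : List (ℤ × List ℕ)) (x : G) :
    leftInvariantForm ψ (lform e k l) x = lform (e.map (leftTriv ψ x).symm) k l := by
  rw [leftInvariantForm_eq, lform_map]

/-- The left-invariant vector field generated by `v`, in the chart at `c`. -/
def chartField (v : GroupLieAlgebra (𝓡 7) G) (c : G) :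
    EuclideanSpace ℝ (Fin 7) → EuclideanSpace ℝ (Fin 7) :=
  VectorField.mpullbackWithin 𝓘(ℝ, EuclideanSpace ℝ (Fin 7)) (𝓡 7) (extChartAt (𝓡 7) c).symm
    (mulInvariantVectorField v) (Set.range (𝓡 7))

theorem differentiableAt_chartField (v : GroupLieAlgebra (𝓡 7) G) (c : G) :
    DifferentiableAt ℝ (chartField v c) (extChartAt (𝓡 7) c c) := by
  have h := (mdifferentiableAt_mulInvariantVectorField (I := 𝓡 7) v
    (g := c)).mdifferentiableWithinAt (s := Set.univ)
  have h2 := h.differentiableWithinAt_mpullbackWithin_vectorField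
  have h3 : ((extChartAt (𝓡 7) c).symm ⁻¹' Set.univ ∩ Set.range (𝓡 7)) = Set.univ := by simp
  rw [h3] at h2
  exact differentiableWithinAt_univ.1 h2

theorem mfderiv_chart_symm_chartField (v : GroupLieAlgebra (𝓡 7) G) (c : G)
    {y : EuclideanSpace ℝ (Fin 7)} (hy : y ∈ (extChartAt (𝓡 7) c).target) :
    (mfderiv (𝓡 7) (𝓡 7) (extChartAt (𝓡 7) c).symm y (chartField v c y) :
      EuclideanSpace ℝ (Fin 7)) = mulInvariantVectorField v ((extChartAt (𝓡 7) c).symm y) := by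
  have h1 := isInvertible_mfderivWithin_extChartAt_symm (I := 𝓡 7) hy
  rw [chartField, VectorField.mpullbackWithin_apply, ← mfderivWithin_univ]
  rw [modelWithCornersSelf_coe, Set.range_id] at h1 ⊢
  exact h1.self_apply_inverse _

theorem leftTriv_mulInvariant (ψ : 𝔤 ≃ₗ⁅ℝ⁆ GroupLieAlgebra (𝓡 7) G) (x : G) (u : 𝔤) :
    leftTriv ψ x (mulInvariantVectorField (ψ u) x) = u := (leftTriv ψ x).apply_symm_apply u

/-- The local form of the principle that left-invariant forms are constant on left-invariant fields:
it holds on the whole chart domain, so it may be differentiated. -/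
theorem localRep_chartField (ψ : 𝔤 ≃ₗ⁅ℝ⁆ GroupLieAlgebra (𝓡 7) G) {k : ℕ}
    (θ : 𝔤 [⋀^Fin k]→ₗ[ℝ] ℝ) (c : G) {y : EuclideanSpace ℝ (Fin 7)}
    (hy : y ∈ (extChartAt (𝓡 7) c).target) (u : Fin k → 𝔤) :
    localRep (leftInvariantForm ψ θ) c y (fun i => chartField (ψ (u i)) c y) = θ u := by
  change θ (fun i => leftTriv ψ ((extChartAt (𝓡 7) c).symm y)
    (mfderiv (𝓡 7) (𝓡 7) (extChartAt (𝓡 7) c).symm y (chartField (ψ (u i)) c y))) = θ u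
  congr 1
  funext i
  refine Eq.trans ?_ (leftTriv_mulInvariant ψ ((extChartAt (𝓡 7) c).symm y) (u i))
  exact congrArg _ (mfderiv_chart_symm_chartField (ψ (u i)) c hy)

theorem chartField_self (v : GroupLieAlgebra (𝓡 7) G) (c : G) :
    chartField v c (extChartAt (𝓡 7) c c) =
      mfderiv (𝓡 7) (𝓡 7) (extChartAt (𝓡 7) c) c (mulInvariantVectorField v c) := by
  have hy := mem_extChartAt_target (I := 𝓡 7) c
  have h2 := mfderiv_extChartAt_comp_mfderivWithin_extChartAt_symm' (I := 𝓡 7)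
    (mem_extChartAt_source (I := 𝓡 7) c)
  rw [modelWithCornersSelf_coe, Set.range_id, mfderivWithin_univ] at h2
  let X : G → EuclideanSpace ℝ (Fin 7) := fun z => mulInvariantVectorField v z
  have h3 : (mfderiv (𝓡 7) (𝓡 7) (extChartAt (𝓡 7) c).symm (extChartAt (𝓡 7) c c)
      (chartField v c (extChartAt (𝓡 7) c c)) : EuclideanSpace ℝ (Fin 7)) = X c :=
    (mfderiv_chart_symm_chartField v c hy).trans (congrArg X (extChartAt_to_inv c))
  have h4 := DFunLike.congr_fun h2 (chartField v c (extChartAt (𝓡 7) c c))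
  exact h4.symm.trans (congrArg _ h3)

/-- The manifold bracket is the chart bracket carried back by the invertible derivative of the
chart, and the bracket of left-invariant fields is left-invariant. -/
theorem lieBracket_chartField (v w : GroupLieAlgebra (𝓡 7) G) (c : G) :
    VectorField.lieBracket ℝ (chartField v c) (chartField w c) (extChartAt (𝓡 7) c c) =
      chartField ⁅v, w⁆ c (extChartAt (𝓡 7) c c) := by
  have h0 := congrFun (mulInvariantVector_mlieBracket (I := 𝓡 7) v w) c
  rw [chartField_self, GroupLieAlgebra.bracket_def, h0,
    ← VectorField.mlieBracketWithin_univ, VectorField.mlieBracketWithin_apply]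
  have h3 : ((extChartAt (𝓡 7) c).symm ⁻¹' Set.univ ∩ Set.range (𝓡 7)) = Set.univ := by simp
  have h1 := isInvertible_mfderiv_extChartAt (I := 𝓡 7) (mem_extChartAt_source (I := 𝓡 7) c)
  rw [h3]
  refine Eq.trans ?_ (h1.self_apply_inverse _).symm
  exact (congrFun (VectorField.lieBracketWithin_univ (𝕜 := ℝ) (V := chartField v c)
    (W := chartField w c)) (extChartAt (𝓡 7) c c)).symm

/-- The exterior derivative of left-invariant forms is the Chevalley–Eilenberg differential. -/
theorem extD_leftInvariantForm (ψ : 𝔤 ≃ₗ⁅ℝ⁆ GroupLieAlgebra (𝓡 7) G) {k : ℕ}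
    (θ : 𝔤 [⋀^Fin (k + 1)]→ₗ[ℝ] ℝ)
    (hθ : ∀ c : G, DifferentiableAt ℝ (localRep (leftInvariantForm ψ θ) c)
      (extChartAt (𝓡 7) c c)) :
    extD (leftInvariantForm ψ θ) = leftInvariantForm ψ (ceDiff θ) := by
  funext c
  refine AlternatingMap.ext fun v => ?_
  -- Every tangent vector at c extends to a left-invariant field.
  obtain ⟨u, rfl⟩ : ∃ u : Fin (k + 2) → 𝔤, v = fun i => mulInvariantVectorField (ψ (u i)) c :=
    ⟨fun i => leftTriv ψ c (v i), funext fun i => ((leftTriv ψ c).symm_apply_apply (v i)).symm⟩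
  have h1 : leftInvariantForm ψ (ceDiff θ) c (fun i => mulInvariantVectorField (ψ (u i)) c) =
      ceDiff θ u := by
    change ceDiff θ (fun i => leftTriv ψ c (mulInvariantVectorField (ψ (u i)) c)) = _
    simp only [leftTriv_mulInvariant]
  rw [h1, ceDiff_apply]
  have h2 : extD (leftInvariantForm ψ θ) c (fun i => mulInvariantVectorField (ψ (u i)) c) =
      extDeriv (localRep (leftInvariantForm ψ θ) c) (extChartAt (𝓡 7) c c)
        (fun i => chartField (ψ (u i)) c (extChartAt (𝓡 7) c c)) := by
    simp only [chartField_self]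
    rfl
  have htgt : (extChartAt (𝓡 7) c).target ∈ 𝓝 (extChartAt (𝓡 7) c c) :=
    (isOpen_extChartAt_target c).mem_nhds (mem_extChartAt_target c)
  rw [h2, extDeriv_apply_vectorField (V := fun i => chartField (ψ (u i)) c) (hθ c)
    fun i => differentiableAt_chartField _ c]
  -- The derivative terms of the invariant formula for d differentiate constants; only the bracket
  -- terms remain, and these are `ceDiff_apply`.
  have h3 : ∀ i : Fin (k + 2), fderiv ℝ (fun y => localRep (leftInvariantForm ψ θ) c y
      (i.removeNth fun j => chartField (ψ (u j)) c y)) (extChartAt (𝓡 7) c c) = 0 := by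
    intro i
    have : (fun y => localRep (leftInvariantForm ψ θ) c y
      (i.removeNth fun j => chartField (ψ (u j)) c y)) =ᶠ[𝓝 (extChartAt (𝓡 7) c c)]
        fun _ => θ (i.removeNth u) := by
      filter_upwards [htgt] with y hy
      exact localRep_chartField ψ θ c hy (i.removeNth u)
    rw [this.fderiv_eq, fderiv_fun_const]
    rfl
  simp only [h3, zero_apply, smul_zero, Finset.sum_const_zero, zero_sub]
  congr 1
  refine Finset.sum_congr rfl fun i _ => Finset.sum_congr rfl fun j _ => ?_
  congr 1
  rw [lieBracket_chartField, ← LieEquiv.map_lie,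
    ← localRep_chartField ψ θ c (mem_extChartAt_target c)]
  congr 1
  funext a
  refine Fin.cases rfl (fun a => rfl) a

end LieGroups

end G2

/-! ### Smoothness of left-invariant forms -/

namespace G2

/-- Evaluation on basis tuples embeds the forms linearly in a finite power of ℝ; a linear left
inverse recovers the form from its smooth components. -/
theorem contDiffAt_alternating {k : ℕ} {n : ℕ∞ω}
    {η : EuclideanSpace ℝ (Fin 7) → EuclideanSpace ℝ (Fin 7) [⋀^Fin k]→L[ℝ] ℝ}
    {y : EuclideanSpace ℝ (Fin 7)} (h : ∀ v, ContDiffAt ℝ n (fun z => η z v) y) :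
    ContDiffAt ℝ n η y := by
  let e := (EuclideanSpace.basisFun (Fin 7) ℝ).toBasis
  let L : EuclideanSpace ℝ (Fin 7) [⋀^Fin k]→L[ℝ] ℝ →ₗ[ℝ] ((Fin k → Fin 7) → ℝ) :=
    { toFun := fun θ i => θ (fun a => e (i a))
      map_add' := fun _ _ => rfl
      map_smul' := fun _ _ => rfl }
  have hL : L.ker = ⊥ := by
    refine LinearMap.ker_eq_bot'.2 fun θ hθ => ?_
    have : θ.toAlternatingMap = 0 := Module.Basis.ext_alternating e fun i _ => congrFun hθ i
    ext v
    exact DFunLike.congr_fun this v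
  obtain ⟨g, hg⟩ := L.exists_leftInverse_of_injective hL
  have h1 : η = fun z => LinearMap.toContinuousLinearMap g (L (η z)) :=
    funext fun z => (LinearMap.congr_fun hg (η z)).symm
  rw [h1]
  refine (ContinuousLinearMap.contDiff _).contDiffAt.comp y ?_
  exact contDiffAt_pi.2 fun i => h _

section LieGroups

variable {G : Type*} [TopologicalSpace G] [ChartedSpace (EuclideanSpace ℝ (Fin 7)) G] [Group G]
  [LieGroup (𝓡 7) ∞ G]

/-- The left Maurer–Cartan form in the chart at `c`. -/
def chartMaurerCartan (c : G) (y : EuclideanSpace ℝ (Fin 7)) :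
    EuclideanSpace ℝ (Fin 7) →L[ℝ] EuclideanSpace ℝ (Fin 7) :=
  fderiv ℝ (fun w => extChartAt (𝓡 7) (1 : G)
    (((extChartAt (𝓡 7) c).symm y)⁻¹ * (extChartAt (𝓡 7) c).symm w)) y

theorem contMDiffAt_chart_symm (c : G) {y : EuclideanSpace ℝ (Fin 7)}
    (hy : y ∈ (extChartAt (𝓡 7) c).target) :
    ContMDiffAt (𝓡 7) (𝓡 7) ∞ (extChartAt (𝓡 7) c).symm y :=
  (contMDiffOn_extChartAt_symm c).contMDiffAt ((isOpen_extChartAt_target c).mem_nhds hy)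

/-- A partial derivative, along the diagonal, of the map (y, w) ↦ y⁻¹w written in charts. This map
is jointly smooth there because the product is 1 on the diagonal, inside the chart at 1. -/
theorem contDiffAt_chartMaurerCartan (c : G) {y : EuclideanSpace ℝ (Fin 7)}
    (hy : y ∈ (extChartAt (𝓡 7) c).target) : ContDiffAt ℝ ∞ (chartMaurerCartan c) y := by
  refine ContDiffAt.fderiv (n := ∞) (m := ∞) (g := id)
    (f := fun y w => extChartAt (𝓡 7) (1 : G)
      (((extChartAt (𝓡 7) c).symm y)⁻¹ * (extChartAt (𝓡 7) c).symm w)) ?_ contDiffAt_id (by simp)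
  rw [← contMDiffAt_iff_contDiffAt]
  have h1 : ContMDiffAt 𝓘(ℝ, EuclideanSpace ℝ (Fin 7) × EuclideanSpace ℝ (Fin 7)) (𝓡 7) ∞
      (fun p : EuclideanSpace ℝ (Fin 7) × EuclideanSpace ℝ (Fin 7) =>
        (extChartAt (𝓡 7) c).symm p.1) (y, y) :=
    ContMDiffAt.comp (I' := 𝓡 7) (y, y) (contMDiffAt_chart_symm c hy)
      (contDiff_fst.contMDiff.contMDiffAt)
  have h2 : ContMDiffAt 𝓘(ℝ, EuclideanSpace ℝ (Fin 7) × EuclideanSpace ℝ (Fin 7)) (𝓡 7) ∞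
      (fun p : EuclideanSpace ℝ (Fin 7) × EuclideanSpace ℝ (Fin 7) =>
        (extChartAt (𝓡 7) c).symm p.2) (y, y) :=
    ContMDiffAt.comp (I' := 𝓡 7) (y, y) (contMDiffAt_chart_symm c hy)
      (contDiff_snd.contMDiff.contMDiffAt)
  have h3 := (h1.inv (n := ∞)).mul h2
  refine ContMDiffAt.comp (I' := 𝓡 7) (y, y) (g := extChartAt (𝓡 7) (1 : G)) ?_ h3
  simp only [inv_mul_cancel]
  exact contMDiffAt_extChartAt

theorem maurerCartan_chart (c : G) {y : EuclideanSpace ℝ (Fin 7)}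
    (hy : y ∈ (extChartAt (𝓡 7) c).target) (v : EuclideanSpace ℝ (Fin 7)) :
    maurerCartan ((extChartAt (𝓡 7) c).symm y)
      (mfderiv (𝓡 7) (𝓡 7) (extChartAt (𝓡 7) c).symm y v) = chartMaurerCartan c y v := by
  have hs : MDifferentiableAt (𝓡 7) (𝓡 7) (extChartAt (𝓡 7) c).symm y :=
    (contMDiffAt_chart_symm c hy).mdifferentiableAt (by simp)
  have hm := mdifferentiable_mul_left ((extChartAt (𝓡 7) c).symm y)⁻¹
    ((extChartAt (𝓡 7) c).symm y)
  have h := mfderiv_comp (I := 𝓡 7) (I' := 𝓡 7) (I'' := 𝓡 7) y hm hs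
  have h' := (hm.comp y hs).mfderiv
  rw [h] at h'
  refine (DFunLike.congr_fun h' v).trans ?_
  rw [chartMaurerCartan, modelWithCornersSelf_coe, Set.range_id, fderivWithin_univ]
  simp only [writtenInExtChartAt, Function.comp_def, inv_mul_cancel, extChartAt_self_eq,
    modelWithCornersSelf_coe, id]
  simp only [extChartAt_model_space_eq_id, PartialEquiv.refl_symm, PartialEquiv.refl_coe, id]
  rfl

variable {𝔤 : Type*} [LieRing 𝔤] [LieAlgebra ℝ 𝔤]

theorem isSmoothForm_leftInvariantForm (ψ : 𝔤 ≃ₗ⁅ℝ⁆ GroupLieAlgebra (𝓡 7) G) {k : ℕ}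
    (θ : 𝔤 [⋀^Fin k]→ₗ[ℝ] ℝ) : IsSmoothForm (leftInvariantForm ψ θ) := by
  intro c
  let θ' : EuclideanSpace ℝ (Fin 7) [⋀^Fin k]→L[ℝ] ℝ := toContinuous
    (θ.compLinearMap (ψ.symm : GroupLieAlgebra (𝓡 7) G →ₗ[ℝ] 𝔤))
  intro y hy
  refine (contDiffAt_alternating fun v => ?_).contDiffWithinAt
  have h1 : (fun z => localRep (leftInvariantForm ψ θ) c z v) =ᶠ[𝓝 y]
      fun z => θ' (fun i => chartMaurerCartan c z (v i)) := by
    filter_upwards [(isOpen_extChartAt_target c).mem_nhds hy] with z hz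
    change θ (fun i => ψ.symm (maurerCartan ((extChartAt (𝓡 7) c).symm z)
      (mfderiv (𝓡 7) (𝓡 7) (extChartAt (𝓡 7) c).symm z (v i)))) = _
    simp only [maurerCartan_chart c hz]
    rfl
  refine ContDiffAt.congr_of_eventuallyEq ?_ h1
  refine (θ'.toContinuousMultilinearMap.contDiff.contDiffAt).comp y ?_
  exact contDiffAt_pi.2 fun i => (contDiffAt_chartMaurerCartan c hy).clm_apply contDiffAt_const

theorem extD_leftInvariant (ψ : 𝔤 ≃ₗ⁅ℝ⁆ GroupLieAlgebra (𝓡 7) G) {k : ℕ}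
    (θ : 𝔤 [⋀^Fin (k + 1)]→ₗ[ℝ] ℝ) :
    extD (leftInvariantForm ψ θ) = leftInvariantForm ψ (ceDiff θ) :=
  extD_leftInvariantForm ψ θ fun c =>
    (((isSmoothForm_leftInvariantForm ψ θ) c).contDiffAt
      ((isOpen_extChartAt_target c).mem_nhds (mem_extChartAt_target c))).differentiableAt (by simp)

/-- Left translation carries `f` to a basis of each tangent space adapted to φ, so one list
computation serves at all points. -/
theorem starM_leftInvariant (ψ : 𝔤 ≃ₗ⁅ℝ⁆ GroupLieAlgebra (𝓡 7) G) (f : Module.Basis (Fin 7) ℝ 𝔤)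
    {k m : ℕ} (h : m + k = 7) {l l' : List (ℤ × List ℕ)} (hl : isStar k m l l' = true) :
    starM (leftInvariantForm ψ (lform f 3 stdList)) h (leftInvariantForm ψ (lform f k l)) =
      leftInvariantForm ψ (lform f m l') := by
  funext x
  rw [starM, leftInvariantForm_lform, leftInvariantForm_lform, leftInvariantForm_lform,
    starOf_std_eq _ h hl]

theorem starM_zero {M : Type*} [TopologicalSpace M] [ChartedSpace (EuclideanSpace ℝ (Fin 7)) M]
    (φ : DiffForm M 3) {k m : ℕ} (h : m + k = 7) : starM φ h (0 : DiffForm M k) = 0 :=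
  funext fun x => starOf_zero (φ x) h

theorem ceDiff_zero {k : ℕ} : ceDiff (0 : 𝔤 [⋀^Fin (k + 1)]→ₗ[ℝ] ℝ) = 0 := by
  ext v
  simp [ceDiff_apply]

end LieGroups

end G2

/-! ### One-parameter groups of automorphisms and Lie derivatives -/

namespace G2

section Exponential

variable {𝔤 : Type*} [LieRing 𝔤] [LieAlgebra ℝ 𝔤] [Fact (Module.finrank ℝ 𝔤 = 7)]

/-- The matrix exponential commutes with conjugation, so the arbitrary basis in the definition may
be replaced by an eigenbasis. -/
theorem expEnd_apply_basis (f : Module.Basis (Fin 7) ℝ 𝔤) {A : 𝔤 →ₗ[ℝ] 𝔤} {d : Fin 7 → ℝ}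
    (hA : ∀ i, A (f i) = d i • f i) (i : Fin 7) : expEnd A (f i) = Real.exp (d i) • f i := by
  have hdiag : ∀ (B : 𝔤 →ₗ[ℝ] 𝔤) (c : Fin 7 → ℝ), (∀ i, B (f i) = c i • f i) →
      LinearMap.toMatrix f f B = Matrix.diagonal c := by
    intro B c hB
    ext i j
    rw [LinearMap.toMatrix_apply, hB, map_smul, Module.Basis.repr_self, Finsupp.smul_single,
      Finsupp.single_apply, Matrix.diagonal_apply]
    by_cases hij : i = j
    · subst hij; simp
    · rw [if_neg hij, if_neg (Ne.symm hij)]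
  have hconj : ∀ B : 𝔤 →ₗ[ℝ] 𝔤, LinearMap.toMatrix (someBasis 𝔤) (someBasis 𝔤) B =
      (someBasis 𝔤).toMatrix f * LinearMap.toMatrix f f B * f.toMatrix (someBasis 𝔤) := fun B =>
    (basis_toMatrix_mul_linearMap_toMatrix_mul_basis_toMatrix _ _ _ _ B).symm
  have hPQ : (someBasis 𝔤).toMatrix f * f.toMatrix (someBasis 𝔤) = 1 :=
    Module.Basis.toMatrix_mul_toMatrix_flip _ _
  have hinv : ((someBasis 𝔤).toMatrix f)⁻¹ = f.toMatrix (someBasis 𝔤) :=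
    Matrix.inv_eq_right_inv hPQ
  have hunit : IsUnit ((someBasis 𝔤).toMatrix f) := IsUnit.of_mul_eq_one _ hPQ
  let B : 𝔤 →ₗ[ℝ] 𝔤 := f.constr ℝ fun i => Real.exp (d i) • f i
  have hB : ∀ i, B (f i) = Real.exp (d i) • f i := fun i => f.constr_basis _ _ i
  have h1 : expEnd A = B := by
    rw [expEnd, hconj, hdiag A d hA, ← hinv, Matrix.exp_conj _ _ hunit, Matrix.exp_diagonal, hinv]
    have h2 : NormedSpace.exp d = fun i => Real.exp (d i) := by
      funext i
      rw [Pi.coe_exp, Real.exp_eq_exp_ℝ]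
    rw [h2, ← hdiag B _ hB, ← hconj, Matrix.toLin_toMatrix]
  rw [h1, hB]

theorem coord_expEnd (f : Module.Basis (Fin 7) ℝ 𝔤) {A : 𝔤 →ₗ[ℝ] 𝔤} {d : Fin 7 → ℝ}
    (hA : ∀ i, A (f i) = d i • f i) (i : Fin 7) (v : 𝔤) :
    f.coord i (expEnd A v) = Real.exp (d i) * f.coord i v := by
  have h1 : f.coord i ∘ₗ expEnd A = Real.exp (d i) • f.coord i := by
    refine f.ext fun j => ?_
    rw [LinearMap.comp_apply, LinearMap.smul_apply, expEnd_apply_basis f hA]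
    by_cases hij : j = i
    · subst hij; simp
    · simp [hij]
  exact LinearMap.congr_fun h1 v

/-- The weight of a multi-index under the diagonal endomorphism with entries `d`. -/
def ldegree (d : ℕ → ℤ) (I : List ℕ) : ℤ := (I.map d).sum

/-- The action of a diagonal endomorphism on forms. -/
def lscale (d : ℕ → ℤ) (l : List (ℤ × List ℕ)) : List (ℤ × List ℕ) :=
  l.map fun p => (p.1 * ldegree d p.2, p.2)

/-- Each e^I is scaled by exp(t · deg I), where deg I is the sum of the weights of its indices;
differentiating at 0 brings down deg I. -/
theorem hasDerivAt_lform_expEnd (f : Module.Basis (Fin 7) ℝ 𝔤) {A : 𝔤 →ₗ[ℝ] 𝔤} {d : ℕ → ℤ}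
    (hA : ∀ i : Fin 7, A (f i) = (d i : ℝ) • f i) {k : ℕ} {l : List (ℤ × List ℕ)}
    (hl : validForm k l = true) (v : Fin k → 𝔤) :
    HasDerivAt (fun t : ℝ => lform f k l (fun i => expEnd (t • A) (v i)))
      (lform f k (lscale d l) v) 0 := by
  have hcoord : ∀ (t : ℝ) (i : Fin 7) (v : 𝔤),
      f.coord i (expEnd (t • A) v) = Real.exp (t * d i) * f.coord i v := fun t i v =>
    coord_expEnd f (d := fun i => t * d i) (fun i => by
      rw [LinearMap.smul_apply, hA, smul_smul]) i v
  induction l with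
  | nil => simpa [lscale] using hasDerivAt_const (0 : ℝ) (0 : ℝ)
  | cons p l ih =>
    simp only [validForm, List.all_cons, Bool.and_eq_true] at hl
    have hdeg : ∑ a : Fin k, (d (toF k p.2 a) : ℝ) = (ldegree d p.2 : ℝ) := by
      obtain ⟨hlen, hlt⟩ := validIndex_iff.1 hl.1
      obtain ⟨c, I⟩ := p
      simp only at hlen hlt
      subst hlen
      rw [ldegree, ← Fin.sum_univ_fun_getElem, Int.cast_sum]
      refine Finset.sum_congr rfl fun a _ => ?_
      rw [toF_getD, Fin.val_ofNat, List.getD_eq_getElem _ _ a.2,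
        Nat.mod_eq_of_lt (hlt _ (List.getElem_mem a.2))]
    have h1 : ∀ t : ℝ, basisForm f (toF k p.2) (fun i => expEnd (t • A) (v i)) =
        Real.exp (t * ldegree d p.2) * basisForm f (toF k p.2) v := by
      intro t
      rw [basisForm_apply, basisForm_apply, ← hdeg, Finset.mul_sum, Real.exp_sum,
        ← Matrix.det_mul_row]
      congr 1
      ext a b
      simp only [Matrix.of_apply, hcoord]
    have h2 : HasDerivAt (fun t : ℝ => Real.exp (t * ldegree d p.2)) (ldegree d p.2 : ℝ) 0 := by
      have := ((hasDerivAt_id (0 : ℝ)).mul_const (ldegree d p.2 : ℝ)).exp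
      simpa using this
    simp only [lscale, List.map_cons, lform_cons, AlternatingMap.add_apply,
      AlternatingMap.smul_apply, smul_eq_mul, h1]
    refine HasDerivAt.add ?_ (ih hl.2)
    have h3 := (h2.mul_const (basisForm f (toF k p.2) v)).const_mul (p.1 : ℝ)
    exact h3.congr_deriv (by push_cast; ring)

end Exponential

section Soliton

variable {G : Type*} [TopologicalSpace G] [ChartedSpace (EuclideanSpace ℝ (Fin 7)) G] [Group G]
  [LieGroup (𝓡 7) ∞ G] {𝔤 : Type*} [LieRing 𝔤] [LieAlgebra ℝ 𝔤] [Fact (Module.finrank ℝ 𝔤 = 7)]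

namespace IsOneParameterGroupOf

variable {ψ : 𝔤 ≃ₗ⁅ℝ⁆ GroupLieAlgebra (𝓡 7) G} {D : 𝔤 →ₗ[ℝ] 𝔤} {F : ℝ → G → G}

theorem contMDiff (hF : IsOneParameterGroupOf ψ D F) (t : ℝ) : ContMDiff (𝓡 7) (𝓡 7) ∞ (F t) :=
  hF.smooth.comp (contMDiff_const.prodMk contMDiff_id)

theorem map_inv_mul (hF : IsOneParameterGroupOf ψ D F) (t : ℝ) (x y : G) :
    F t (x⁻¹ * y) = (F t x)⁻¹ * F t y := by
  rw [eq_inv_mul_iff_mul_eq, ← hF.map_mul, mul_inv_cancel_left]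

/-- Differentiate F_t(x)⁻¹ F_t(y) = F_t(x⁻¹y) at y = x: the derivative of F_t at x is, in left
trivialisations, its derivative at 1. -/
theorem leftTriv_mfderiv (hF : IsOneParameterGroupOf ψ D F) (t : ℝ) (x : G)
    (v : TangentSpace (𝓡 7) x) :
    leftTriv ψ (F t x) (mfderiv (𝓡 7) (𝓡 7) (F t) x v) = expEnd (t • D) (leftTriv ψ x v) := by
  have hd : ∀ z, MDifferentiableAt (𝓡 7) (𝓡 7) (F t) z := (hF.contMDiff t).mdifferentiable (by simp)
  have h1 := mfderiv_comp (I := 𝓡 7) (I' := 𝓡 7) (I'' := 𝓡 7) x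
    (mdifferentiable_mul_left (F t x)⁻¹ (F t x)) (hd x)
  have h2 := mfderiv_comp (I := 𝓡 7) (I' := 𝓡 7) (I'' := 𝓡 7) x
    (g := F t) (f := fun y => x⁻¹ * y) (hd (x⁻¹ * x)) (mdifferentiable_mul_left x⁻¹ x)
  have h3 : (fun y => (F t x)⁻¹ * y) ∘ F t = F t ∘ fun y => x⁻¹ * y :=
    funext fun y => (hF.map_inv_mul t x y).symm
  rw [h3, h2, inv_mul_cancel] at h1
  have h4 := hF.deriv_one t (leftTriv ψ x v)
  have h5 := DFunLike.congr_fun h1 v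
  change ψ.symm (maurerCartan (F t x) (mfderiv (𝓡 7) (𝓡 7) (F t) x v)) = _
  have h6 : maurerCartan (F t x) (mfderiv (𝓡 7) (𝓡 7) (F t) x v) =
      ψ (expEnd (t • D) (leftTriv ψ x v)) := by
    refine Eq.trans h5.symm (Eq.trans ?_ h4)
    have h7 : ψ (leftTriv ψ x v) = maurerCartan x v := LieEquiv.apply_symm_apply ψ _
    rw [h7]
    rfl
  rw [h6, LieEquiv.symm_apply_apply]

theorem pullback_leftInvariant (hF : IsOneParameterGroupOf ψ D F) (t : ℝ) {k : ℕ}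
    (θ : 𝔤 [⋀^Fin k]→ₗ[ℝ] ℝ) (x : G) (v : Fin k → TangentSpace (𝓡 7) x) :
    pullback (F t) (leftInvariantForm ψ θ) x v =
      θ (fun i => expEnd (t • D) (leftTriv ψ x (v i))) := by
  change θ (fun i => leftTriv ψ (F t x) (mfderiv (𝓡 7) (𝓡 7) (F t) x (v i))) = _
  simp only [hF.leftTriv_mfderiv]

theorem isLocalFlowAt (hF : IsOneParameterGroupOf ψ D F) {X : (x : G) → TangentSpace (𝓡 7) x}
    (hX : ∀ x, IsMIntegralCurve (I := 𝓡 7) (fun t => F t x) X) (x : G) : IsLocalFlowAt X x F :=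
  ⟨1, one_pos, Set.univ, Filter.univ_mem, hF.smooth.contMDiffOn, fun y _ =>
    ⟨hF.zero y, (hX y).isMIntegralCurveOn _⟩⟩

/-- X is the tangent map of the jointly smooth flow (t, x) ↦ F_t(x) applied to the smooth section
(∂_t, 0) along t = 0. -/
theorem contMDiff_generator (hF : IsOneParameterGroupOf ψ D F)
    {X : (x : G) → TangentSpace (𝓡 7) x}
    (hX : ∀ x, IsMIntegralCurve (I := 𝓡 7) (fun t => F t x) X) :
    ContMDiff (𝓡 7) (𝓡 7).tangent ∞ (fun x => (⟨x, X x⟩ : TangentBundle (𝓡 7) G)) := by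
  let f0 : G → TangentBundle 𝓘(ℝ, ℝ) ℝ := fun _ => ⟨0, (1 : ℝ)⟩
  have s0 : ContMDiff (𝓡 7) 𝓘(ℝ, ℝ).tangent ∞ f0 := contMDiff_const
  let f1 : G → TangentBundle (𝓡 7) G := fun x => ⟨x, 0⟩
  have s1 : ContMDiff (𝓡 7) (𝓡 7).tangent ∞ f1 :=
    Bundle.contMDiff_zeroSection ℝ (TangentSpace (𝓡 7) : G → Type _)
  have s2 : ContMDiff (𝓘(ℝ, ℝ).tangent.prod (𝓡 7).tangent) (𝓘(ℝ, ℝ).prod (𝓡 7)).tangent ∞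
      (equivTangentBundleProd 𝓘(ℝ, ℝ) ℝ (𝓡 7) G).symm := contMDiff_equivTangentBundleProd_symm
  have s3 : ContMDiff (𝓘(ℝ, ℝ).prod (𝓡 7)).tangent (𝓡 7).tangent ∞
      (tangentMap (𝓘(ℝ, ℝ).prod (𝓡 7)) (𝓡 7) fun p : ℝ × G => F p.1 p.2) :=
    hF.smooth.contMDiff_tangentMap (by simp)
  have s4 := (s3.comp s2).comp (s0.prodMk s1)
  have key : ∀ x, (mfderiv (𝓘(ℝ, ℝ).prod (𝓡 7)) (𝓡 7) (fun p : ℝ × G => F p.1 p.2) (0, x)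
      ((1 : ℝ), (0 : TangentSpace (𝓡 7) x)) : EuclideanSpace ℝ (Fin 7)) = X (F 0 x) := by
    intro x
    have h1 := mfderiv_prod_eq_add_apply (I := 𝓘(ℝ, ℝ)) (I' := 𝓡 7) (I'' := 𝓡 7)
      (f := fun p : ℝ × G => F p.1 p.2) (p := (0, x)) (v := ((1 : ℝ), (0 : TangentSpace (𝓡 7) x)))
      (hF.smooth.mdifferentiable (by simp) _)
    refine h1.trans ?_
    have h2 := (hX x 0).mfderiv
    have h3 : (mfderiv 𝓘(ℝ, ℝ) (𝓡 7) (fun t => F t x) 0 (1 : ℝ) : EuclideanSpace ℝ (Fin 7)) =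
        X (F 0 x) := by
      rw [h2]
      exact one_smul ℝ (X (F 0 x))
    refine Eq.trans (congrArg₂ (· + ·) h3 (map_zero _)) (add_zero _)
  have h5 : (fun x => (⟨x, X x⟩ : TangentBundle (𝓡 7) G)) =
      ((tangentMap (𝓘(ℝ, ℝ).prod (𝓡 7)) (𝓡 7) fun p : ℝ × G => F p.1 p.2) ∘
        (equivTangentBundleProd 𝓘(ℝ, ℝ) ℝ (𝓡 7) G).symm) ∘ fun x => (f0 x, f1 x) := by
    funext x
    have h6 : (⟨x, X x⟩ : TangentBundle (𝓡 7) G) = ⟨F 0 x, X (F 0 x)⟩ := by rw [hF.zero x]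
    rw [h6]
    exact congrArg (Bundle.TotalSpace.mk (F 0 x)) (key x).symm
  rw [h5]
  exact s4

end IsOneParameterGroupOf

end Soliton

end G2

/-! ### The Laplacian soliton equation on the group -/

namespace KAlg

open G2

/-- The weights of the derivation. -/
def derivWeight : ℕ → ℤ
  | 0 => 2
  | 3 => -4
  | 5 => -4
  | _ => 0

theorem deriv_onb' {α : ℝ} (hα : 0 < α) (i : Fin 7) :
    (deriv α : KAlg α →ₗ[ℝ] KAlg α) (onb hα i) = (derivWeight i : ℝ) • onb hα i := by
  refine (deriv_onb hα i).trans ?_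
  congr 1
  fin_cases i <;> norm_num [derivEntry, derivWeight]

theorem codiff_eq {M : Type*} [TopologicalSpace M] [ChartedSpace (EuclideanSpace ℝ (Fin 7)) M]
    {φ : DiffForm M 3} {l m : ℕ} (h : m + (l + 1) = 7) {θ : DiffForm M (l + 1)}
    {A : DiffForm M (m + 1)} {B : DiffForm M l} (h1 : extD (starM φ h θ) = A)
    (h2 : ∀ h' : l + (m + 1) = 7, starM φ h' A = B) :
    codiff φ h θ = fun x => (-1 : ℝ) ^ (l + 1) • B x := by
  funext x
  rw [codiff, h1, h2]

theorem codiff_zero {M : Type*} [TopologicalSpace M]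
    [ChartedSpace (EuclideanSpace ℝ (Fin 7)) M] {φ : DiffForm M 3} {l m : ℕ}
    (h : m + (l + 1) = 7) (hd : extD (0 : DiffForm M m) = 0) :
    codiff φ h (0 : DiffForm M (l + 1)) = 0 := by
  rw [codiff_eq h (by rw [starM_zero]; exact hd) fun h' => starM_zero _ h']
  exact funext fun x => smul_zero _

theorem hodgeLaplacian_eq {M : Type*} [TopologicalSpace M]
    [ChartedSpace (EuclideanSpace ℝ (Fin 7)) M] {φ θ : DiffForm M 3} {B : DiffForm M 2}
    {C D : DiffForm M 3} {Z : DiffForm M 4} (h1 : codiff φ (l := 2) (m := 4) rfl θ = B)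
    (h2 : extD B = C) (h3 : extD θ = Z)
    (h4 : ∀ h : 3 + (3 + 1) = 7, codiff φ (l := 3) (m := 3) h Z = D) :
    hodgeLaplacian φ θ = fun x => C x + D x := by
  funext x
  rw [hodgeLaplacian, h1, h2, h3, h4]

theorem isStar_dStar : isStar 5 2 dStarList (tauList.map fun p => (-p.1, p.2)) = true := by
  decide +kernel

/-- The soliton equation dτ = 6φ + D·φ, coefficient by coefficient. -/
theorem leval_soliton : ∀ J ∈ increasing 3 seven,
    leval dTauList J = 6 * leval stdList J + leval (lscale derivWeight stdList) J := by
  decide +kernel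

theorem soliton_lform {V : Type*} [AddCommGroup V] [Module ℝ V] (f : Module.Basis (Fin 7) ℝ V) :
    lform f 3 dTauList = (6 : ℝ) • lform f 3 stdList + lform f 3 (lscale derivWeight stdList) := by
  refine ext_increasing f fun J hJ => ?_
  have hJ' := validIndex_of_mem_increasing hJ
  rw [AlternatingMap.add_apply, AlternatingMap.smul_apply, lform_basis f (by decide) hJ',
    lform_basis f (by decide) hJ', lform_basis f (by decide) hJ', leval_soliton J hJ]
  push_cast
  rfl

section

variable {α : ℝ} {G : Type*} [TopologicalSpace G]
  [ChartedSpace (EuclideanSpace ℝ (Fin 7)) G] [Group G] [LieGroup (𝓡 7) ∞ G]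
  (ψ : KAlg α ≃ₗ⁅ℝ⁆ GroupLieAlgebra (𝓡 7) G)

/-- δφ = -⋆d⋆φ = -⋆(τ ∧ φ) = ⋆⋆τ = τ, by the defining property of the torsion form. -/
theorem codiff_phi (hα : 0 < α) :
    codiff (leftInvariantForm ψ (phi α)) (l := 2) (m := 4) rfl (leftInvariantForm ψ (phi α)) =
      leftInvariantForm ψ (tau α) := by
  have h1 : starM (leftInvariantForm ψ (phi α)) (k := 3) (m := 4) rfl
      (leftInvariantForm ψ (phi α)) = leftInvariantForm ψ (lform (onb hα) 4 starStdList) := by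
    rw [phi_eq hα]
    exact starM_leftInvariant ψ (onb hα) rfl (by decide +kernel)
  have h2 : ∀ h : 2 + 5 = 7, starM (leftInvariantForm ψ (phi α)) h
      (leftInvariantForm ψ (lform (onb hα) 5 dStarList)) =
        leftInvariantForm ψ (lform (onb hα) 2 (tauList.map fun p => (-p.1, p.2))) := by
    intro h
    rw [phi_eq hα]
    exact starM_leftInvariant ψ (onb hα) h isStar_dStar
  have h3 := ceDiff_star_phi hα
  generalize lform (onb hα) 5 dStarList = A at h2 h3
  have h4 : extD (leftInvariantForm ψ (lform (onb hα) 4 starStdList)) = leftInvariantForm ψ A := by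
    rw [extD_leftInvariant, h3]
  rw [codiff_eq (l := 2) (m := 4) rfl (by rw [h1]; exact h4) h2]
  funext x
  rw [tau_eq hα, leftInvariantForm_lform, leftInvariantForm_lform, lform_neg]
  norm_num

/-- Since dφ = 0, only dδφ = dτ is left. -/
theorem hodgeLaplacian_phi (hα : 0 < α) :
    hodgeLaplacian (leftInvariantForm ψ (phi α)) (leftInvariantForm ψ (phi α)) =
      leftInvariantForm ψ (lform (onb hα) 3 dTauList) := by
  have h1 : extD (leftInvariantForm ψ (phi α)) = 0 := by
    rw [extD_leftInvariant, ceDiff_phi hα, leftInvariantForm_zero]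
  have h2 : ∀ m : ℕ, extD (0 : DiffForm G (m + 1)) = 0 := fun m => by
    rw [← leftInvariantForm_zero ψ, extD_leftInvariant, ceDiff_zero]; rfl
  have h3 : extD (leftInvariantForm ψ (tau α)) = leftInvariantForm ψ (lform (onb hα) 3 dTauList) := by
    rw [extD_leftInvariant, ceDiff_tau hα]
  rw [hodgeLaplacian_eq (codiff_phi ψ hα) h3 h1 fun h => codiff_zero h (h2 2)]
  exact funext fun x => add_zero _

theorem isLaplacianSoliton (hα : 0 < α) (X : (x : G) → TangentSpace (𝓡 7) x)
    (hX : IsVectorFieldOf ψ (deriv α : KAlg α →ₗ[ℝ] KAlg α) X) :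
    IsLaplacianSoliton (leftInvariantForm ψ (phi α)) 6 X := by
  obtain ⟨F, hF, hFX⟩ := hX
  refine ⟨⟨isSmoothForm_leftInvariantForm ψ _, fun x => ?_, fun x => ?_⟩,
    hF.contMDiff_generator hFX,
    leftInvariantForm ψ (lform (onb hα) 3 (lscale derivWeight stdList)), fun x =>
      ⟨F, hF.isLocalFlowAt hFX x, fun v => ?_⟩, fun x => ?_⟩
  · rw [phi_eq hα, leftInvariantForm_lform]
    exact isG2Structure_std _
  · rw [extD_leftInvariant, ceDiff_phi hα, leftInvariantForm_zero]
    rfl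
  · simp only [hF.pullback_leftInvariant, phi_eq hα]
    exact hasDerivAt_lform_expEnd (onb hα) (deriv_onb' hα) (by decide) _
  · rw [hodgeLaplacian_phi ψ hα, phi_eq hα, soliton_lform]
    rfl

end

end KAlg

/-! ### The universal covering group of `SU(1, 1)` -/

namespace UnivSU

open scoped ComplexConjugate

/-- The upper left entry of the matrix in `SU(1, 1)` below `(θ, b)`; the upper right entry
is `b`. -/
def amp (p : ℝ × ℂ) : ℂ := (√(1 + Complex.normSq p.2) : ℝ) * Complex.exp (p.1 * Complex.I)

/-- The relative correction `b b̄' / (a a')` of the upper left entry of a product. -/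
def cross (p q : ℝ × ℂ) : ℂ := p.2 * conj q.2 * (amp p * amp q)⁻¹

/-- The product of the universal covering group of `SU(1, 1)`. -/
def mul (p q : ℝ × ℂ) : ℝ × ℂ :=
  (p.1 + q.1 + Complex.arg (1 + cross p q), amp p * q.2 + p.2 * conj (amp q))

theorem one_add_normSq_pos (b : ℂ) : 0 < 1 + Complex.normSq b := by
  have := Complex.normSq_nonneg b
  linarith

theorem norm_amp (p : ℝ × ℂ) : ‖amp p‖ = √(1 + Complex.normSq p.2) := by
  rw [amp, norm_mul, Complex.norm_exp_ofReal_mul_I, mul_one, Complex.norm_real, Real.norm_eq_abs,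
    abs_of_nonneg (Real.sqrt_nonneg _)]

theorem normSq_amp (p : ℝ × ℂ) : Complex.normSq (amp p) = 1 + Complex.normSq p.2 := by
  rw [Complex.normSq_eq_norm_sq, norm_amp, Real.sq_sqrt (one_add_normSq_pos _).le]

theorem amp_ne_zero (p : ℝ × ℂ) : amp p ≠ 0 := by
  rw [← Complex.normSq_pos, normSq_amp]
  exact one_add_normSq_pos _

theorem amp_mul_conj (p : ℝ × ℂ) : amp p * conj (amp p) = 1 + p.2 * conj p.2 := by
  rw [Complex.mul_conj, Complex.mul_conj, normSq_amp]
  push_cast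
  rfl

/-- |a|² = 1 + |b|² gives |b| < |a|. So 1 + `cross` stays in the right half-plane, where the
principal argument is smooth and below π/2 in size. -/
theorem norm_cross_lt_one (p q : ℝ × ℂ) : ‖cross p q‖ < 1 := by
  have h : ∀ p : ℝ × ℂ, ‖p.2‖ < ‖amp p‖ := fun p => by
    rw [norm_amp]
    refine Real.lt_sqrt_of_sq_lt ?_
    rw [Complex.normSq_eq_norm_sq]
    linarith
  have h' : ∀ p : ℝ × ℂ, 0 < ‖amp p‖ := fun p => norm_pos_iff.2 (amp_ne_zero p)
  rw [cross, norm_mul, norm_inv, norm_mul, norm_mul, RCLike.norm_conj, ← div_eq_mul_inv,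
    div_lt_one (mul_pos (h' p) (h' q))]
  exact mul_lt_mul'' (h p) (h q) (norm_nonneg _) (norm_nonneg _)

theorem re_one_add_cross_pos (p q : ℝ × ℂ) : 0 < (1 + cross p q).re := by
  have h1 := norm_cross_lt_one p q
  have h2 := Complex.abs_re_le_norm (cross p q)
  have h3 := neg_abs_le (cross p q).re
  rw [Complex.add_re, Complex.one_re]
  linarith

theorem abs_arg_cross_lt (p q : ℝ × ℂ) : |Complex.arg (1 + cross p q)| < Real.pi / 2 :=
  Complex.abs_arg_lt_pi_div_two_iff.2 (Or.inl (re_one_add_cross_pos p q))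

theorem amp_mul_amp (p q : ℝ × ℂ) :
    amp p * amp q * (1 + cross p q) = amp p * amp q + p.2 * conj q.2 := by
  have h := mul_ne_zero (amp_ne_zero p) (amp_ne_zero q)
  rw [cross, mul_add, mul_one, mul_left_comm, mul_inv_cancel₀ h, mul_one]

theorem normSq_mul (p q : ℝ × ℂ) :
    1 + Complex.normSq (mul p q).2 = Complex.normSq (amp p * amp q + p.2 * conj q.2) := by
  have h1 := amp_mul_conj p
  have h2 := amp_mul_conj q
  have h3 : (1 + Complex.normSq (mul p q).2 : ℂ) =
      Complex.normSq (amp p * amp q + p.2 * conj q.2) := by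
    rw [← Complex.mul_conj, ← Complex.mul_conj]
    simp only [mul, map_add, map_mul, Complex.conj_conj]
    linear_combination (-amp q * conj (amp q) + q.2 * conj q.2) * h1 - h2
  exact_mod_cast h3

/-- The modulus is forced by the relation |a|² - |b|² = 1 for the product matrix, and the argument
correction in `mul` supplies the phase. -/
theorem amp_mul (p q : ℝ × ℂ) : amp (mul p q) = amp p * amp q + p.2 * conj q.2 := by
  have h1 : √(1 + Complex.normSq (mul p q).2) = ‖amp p‖ * ‖amp q‖ * ‖1 + cross p q‖ := by
    rw [normSq_mul, ← amp_mul_amp, Complex.normSq_eq_norm_sq, Real.sqrt_sq (norm_nonneg _),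
      norm_mul, norm_mul]
  have h2 : ∀ p : ℝ × ℂ, amp p = ‖amp p‖ * Complex.exp (p.1 * Complex.I) := fun p => by
    rw [norm_amp]; rfl
  have h3 := Complex.norm_mul_exp_arg_mul_I (1 + cross p q)
  rw [← amp_mul_amp, amp, h1]
  have h4 : (mul p q).1 = p.1 + q.1 + Complex.arg (1 + cross p q) := rfl
  rw [h4]
  push_cast
  rw [add_mul, add_mul, Complex.exp_add, Complex.exp_add]
  conv_rhs => rw [h2 p, h2 q, ← h3]
  ring

/-- The map to SU(1, 1) forgets θ only modulo 2π, so group identities there lift once the angles are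
known to be close. -/
theorem ext_of_amp {p q : ℝ × ℂ} (h1 : amp p = amp q) (h2 : p.2 = q.2)
    (h3 : |p.1 - q.1| < 2 * Real.pi) : p = q := by
  refine Prod.ext ?_ h2
  have h4 : ((√(1 + Complex.normSq q.2) : ℝ) : ℂ) ≠ 0 :=
    Complex.ofReal_ne_zero.2 (Real.sqrt_pos.2 (one_add_normSq_pos _)).ne'
  rw [amp, amp, h2] at h1
  obtain ⟨n, hn⟩ := Complex.exp_eq_exp_iff_exists_int.1 (mul_left_cancel₀ h4 h1)
  have h5 : (p.1 : ℂ) = ((q.1 + n * (2 * Real.pi) : ℝ) : ℂ) := by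
    push_cast
    refine mul_right_cancel₀ Complex.I_ne_zero (hn.trans ?_)
    ring
  have h6 : p.1 = q.1 + n * (2 * Real.pi) := Complex.ofReal_injective h5
  have h7 : (n : ℤ) = 0 := by
    rw [h6, add_sub_cancel_left, abs_mul, abs_of_pos Real.two_pi_pos] at h3
    have h8 : |(n : ℝ)| < 1 := by
      by_contra hcon
      have := mul_le_mul_of_nonneg_right (not_lt.1 hcon) Real.two_pi_pos.le
      linarith
    have h9 : |n| < 1 := by exact_mod_cast h8
    exact Int.abs_lt_one_iff.1 h9
  rw [h6, h7]
  simp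

/-- Both sides have the same matrix, and their angles differ by a combination of four arguments,
each below π/2 in size. -/
theorem assoc (p q r : ℝ × ℂ) : mul (mul p q) r = mul p (mul q r) := by
  have h1 := amp_mul p q
  have h2 := amp_mul q r
  refine ext_of_amp ?_ ?_ ?_
  · rw [amp_mul, amp_mul p (mul q r), h1, h2]
    simp only [mul, map_add, map_mul, Complex.conj_conj]
    ring
  · change amp (mul p q) * r.2 + (mul p q).2 * conj (amp r) =
      amp p * (mul q r).2 + p.2 * conj (amp (mul q r))
    rw [h1, h2]
    simp only [mul, map_add, map_mul, Complex.conj_conj]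
    ring
  · have e : (mul (mul p q) r).1 - (mul p (mul q r)).1 =
        Complex.arg (1 + cross p q) + Complex.arg (1 + cross (mul p q) r)
          - Complex.arg (1 + cross q r) - Complex.arg (1 + cross p (mul q r)) := by
      simp only [mul]
      ring
    have a1 := abs_lt.1 (abs_arg_cross_lt p q)
    have a2 := abs_lt.1 (abs_arg_cross_lt (mul p q) r)
    have a3 := abs_lt.1 (abs_arg_cross_lt q r)
    have a4 := abs_lt.1 (abs_arg_cross_lt p (mul q r))
    rw [e, abs_lt]
    constructor <;> linarith [a1.1, a1.2, a2.1, a2.2, a3.1, a3.2, a4.1, a4.2]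

theorem amp_zero : amp 0 = 1 := by simp [amp]

theorem cross_zero_left (p : ℝ × ℂ) : cross 0 p = 0 := by simp [cross]

theorem cross_zero_right (p : ℝ × ℂ) : cross p 0 = 0 := by simp [cross]

theorem zero_left (p : ℝ × ℂ) : mul 0 p = p := by
  simp [mul, cross_zero_left, amp_zero]

theorem zero_right (p : ℝ × ℂ) : mul p 0 = p := by
  simp [mul, cross_zero_right, amp_zero]

theorem amp_neg (p : ℝ × ℂ) : amp (-p) = conj (amp p) := by
  simp [amp, ← Complex.exp_conj]

theorem neg_left (p : ℝ × ℂ) : mul (-p) p = 0 := by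
  have h1 : (1 + cross (-p) p) = (((1 + Complex.normSq p.2)⁻¹ : ℝ) : ℂ) := by
    have h2 := amp_mul_conj p
    have h3 : (1 + p.2 * conj p.2) ≠ 0 := by
      rw [← h2]
      exact mul_ne_zero (amp_ne_zero p) ((map_ne_zero _).2 (amp_ne_zero p))
    rw [cross, amp_neg, mul_comm (conj _), h2]
    push_cast
    rw [← Complex.mul_conj, Prod.snd_neg]
    field_simp
    ring
  refine Prod.ext ?_ ?_
  · simp only [mul]
    rw [h1, Complex.arg_ofReal_of_nonneg (inv_nonneg.2 (one_add_normSq_pos _).le)]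
    simp
  · simp only [mul, amp_neg, Prod.snd_neg]
    simp [mul_comm]

theorem contDiff_amp : ContDiff ℝ ∞ amp := by
  have h1 : ContDiff ℝ ∞ fun p : ℝ × ℂ => 1 + Complex.normSq p.2 := by
    simp only [Complex.normSq_apply]
    have hre : ContDiff ℝ ∞ fun p : ℝ × ℂ => p.2.re := Complex.reCLM.contDiff.comp contDiff_snd
    have him : ContDiff ℝ ∞ fun p : ℝ × ℂ => p.2.im := Complex.imCLM.contDiff.comp contDiff_snd
    exact contDiff_const.add ((hre.mul hre).add (him.mul him))
  have h2 : ContDiff ℝ ∞ fun p : ℝ × ℂ => √(1 + Complex.normSq p.2) :=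
    h1.sqrt fun p => (one_add_normSq_pos p.2).ne'
  have h3 : ContDiff ℝ ∞ fun p : ℝ × ℂ => Complex.exp (p.1 * Complex.I) :=
    ((Complex.ofRealCLM.contDiff.comp contDiff_fst).mul contDiff_const).cexp
  exact (Complex.ofRealCLM.contDiff.comp h2).mul h3

theorem contDiff_mul : ContDiff ℝ ∞ fun x : (ℝ × ℂ) × ℝ × ℂ => mul x.1 x.2 := by
  have a1 : ContDiff ℝ ∞ fun x : (ℝ × ℂ) × ℝ × ℂ => amp x.1 := contDiff_amp.comp contDiff_fst
  have a2 : ContDiff ℝ ∞ fun x : (ℝ × ℂ) × ℝ × ℂ => amp x.2 := contDiff_amp.comp contDiff_snd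
  have b1 : ContDiff ℝ ∞ fun x : (ℝ × ℂ) × ℝ × ℂ => x.1.2 := contDiff_fst.snd
  have b2 : ContDiff ℝ ∞ fun x : (ℝ × ℂ) × ℝ × ℂ => x.2.2 := contDiff_snd.snd
  have t1 : ContDiff ℝ ∞ fun x : (ℝ × ℂ) × ℝ × ℂ => x.1.1 := contDiff_fst.fst
  have t2 : ContDiff ℝ ∞ fun x : (ℝ × ℂ) × ℝ × ℂ => x.2.1 := contDiff_snd.fst
  have hconj : ContDiff ℝ ∞ (conj : ℂ → ℂ) := Complex.conjCLE.contDiff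
  have hcross : ContDiff ℝ ∞ fun x : (ℝ × ℂ) × ℝ × ℂ => 1 + cross x.1 x.2 :=
    contDiff_const.add ((b1.mul (hconj.comp b2)).mul
      ((a1.mul a2).inv fun x => mul_ne_zero (amp_ne_zero _) (amp_ne_zero _)))
  have harg : ContDiff ℝ ∞ fun x : (ℝ × ℂ) × ℝ × ℂ => Complex.arg (1 + cross x.1 x.2) := by
    refine contDiff_iff_contDiffAt.2 fun x => ?_
    have h1 : ContDiffAt ℝ ∞ Complex.log (1 + cross x.1 x.2) :=
      (Complex.contDiffAt_log (Or.inl (re_one_add_cross_pos x.1 x.2))).restrict_scalars ℝ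
    have h2 := Complex.imCLM.contDiff.contDiffAt.comp x (h1.comp x hcross.contDiffAt)
    refine h2.congr_of_eventuallyEq (Filter.Eventually.of_forall fun y => ?_)
    exact (Complex.log_im _).symm
  exact ((t1.add t2).add harg).prodMk ((a1.mul b2).add (b1.mul (hconj.comp a2)))

end UnivSU


/-! ### Left-invariant fields of group structures on a vector space -/

section VectorGroup

variable {E : Type*} [NormedAddCommGroup E] [NormedSpace ℝ E] [Group E]

theorem mulInvariantVectorField_eq_fderiv (v : E) (x : E) :
    (mulInvariantVectorField (I := 𝓘(ℝ, E)) (G := E) v x : E) =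
      fderiv ℝ (fun y : E => x * y) 1 v :=
  congrArg (fun A : E →L[ℝ] E => A v) (mfderiv_eq_fderiv (f := fun y : E => x * y) (x := (1 : E)))

/-- On a vector space the bracket of fields is DW(V) - DV(W), here for left-invariant fields at the
identity. -/
theorem groupLieBracket_eq_fderiv (v w : E) :
    (Bracket.bracket (L := GroupLieAlgebra 𝓘(ℝ, E) E) (M := GroupLieAlgebra 𝓘(ℝ, E) E) v w : E) =
      fderiv ℝ (fun x : E => fderiv ℝ (fun y : E => x * y) 1 w) 1
          (fderiv ℝ (fun y : E => 1 * y) 1 v) -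
        fderiv ℝ (fun x : E => fderiv ℝ (fun y : E => x * y) 1 v) 1
          (fderiv ℝ (fun y : E => 1 * y) 1 w) := by
  have h := GroupLieAlgebra.bracket_def (I := 𝓘(ℝ, E)) (G := E) v w
  refine h.trans ?_
  have h3 : ∀ v : E, (mulInvariantVectorField (I := 𝓘(ℝ, E)) (G := E) v : E → E) =
      fun x : E => fderiv ℝ (fun y : E => x * y) 1 v := fun v =>
    funext fun x => mulInvariantVectorField_eq_fderiv v x
  have h4 : ∀ V W V' W' : E → E, V = V' → W = W' →
      VectorField.mlieBracket 𝓘(ℝ, E) (M := E) V W (1 : E) =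
        fderiv ℝ W' 1 (V' 1) - fderiv ℝ V' 1 (W' 1) := by
    rintro V W _ _ rfl rfl
    exact (congrFun VectorField.mlieBracketWithin_univ.symm 1).trans
      ((congrFun VectorField.mlieBracketWithin_eq_lieBracketWithin 1).trans
        (congrFun (VectorField.lieBracketWithin_univ (𝕜 := ℝ) (E := E) (V := V) (W := W)) (1 : E)))
  exact h4 _ _ _ _ (h3 v) (h3 w)

end VectorGroup

theorem fderiv_apply_eq_of_hasDerivAt {E F : Type*} [NormedAddCommGroup E] [NormedSpace ℝ E]
    [NormedAddCommGroup F] [NormedSpace ℝ F] {f : E → F} {v : E} {f' : F}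
    (hf : DifferentiableAt ℝ f 0) (h : HasDerivAt (fun s : ℝ => f (s • v)) f' 0) :
    fderiv ℝ f 0 v = f' := by
  have h1 : HasLineDerivAt ℝ f f' 0 v := by
    simpa only [HasLineDerivAt, zero_add] using h
  rw [← hf.lineDeriv_eq_fderiv, h1.lineDeriv]

theorem HasDerivAt.of_forall_eq {F : Type*} [NormedAddCommGroup F] [NormedSpace ℝ F]
    {f g : ℝ → F} {f' g' : F} {x : ℝ} (h : HasDerivAt f f' x) (h1 : ∀ s, g s = f s)
    (h2 : g' = f') : HasDerivAt g g' x := by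
  rw [funext h1, h2]
  exact h

/-! ### Left-invariant fields on the covering group -/

namespace UnivSU

open scoped ComplexConjugate

theorem hasDerivAt_amp (v : ℝ × ℂ) :
    HasDerivAt (fun s : ℝ => amp (s • v)) (v.1 * Complex.I) 0 := by
  have h1 : HasDerivAt (fun s : ℝ => 1 + s ^ 2 * Complex.normSq v.2)
      ((2 * 0) * Complex.normSq v.2) 0 := by
    simpa using ((hasDerivAt_pow 2 (0 : ℝ)).mul_const (Complex.normSq v.2)).const_add 1
  have h2 := (h1.sqrt (by simp)).ofReal_comp
  have h3 : HasDerivAt (fun s : ℝ => (s : ℂ) * (v.1 * Complex.I)) (1 * (v.1 * Complex.I)) 0 := by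
    simpa using (Complex.ofRealCLM.hasDerivAt (x := (0 : ℝ))).mul_const (v.1 * Complex.I)
  have h4 := h2.mul h3.cexp
  refine h4.of_forall_eq (fun s => ?_) ?_
  · simp only [amp, Prod.smul_fst, Prod.smul_snd, Complex.real_smul, smul_eq_mul, map_mul,
      Complex.normSq_ofReal, Pi.mul_apply]
    push_cast
    simp only [pow_two, mul_assoc]
  · simp

/-- The left-invariant field with value `v` at the identity. -/
def field (v p : ℝ × ℂ) : ℝ × ℂ :=
  (v.1 + (p.2 * conj v.2 * (amp p)⁻¹).im, amp p * v.2 + p.2 * (-(v.1 * Complex.I)))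

theorem hasDerivAt_mul (p v : ℝ × ℂ) :
    HasDerivAt (fun s : ℝ => mul p (s • v)) (field v p) 0 := by
  have h1 := hasDerivAt_amp v
  have hs : HasDerivAt (fun s : ℝ => (s : ℂ)) 1 0 := Complex.ofRealCLM.hasDerivAt
  have h3 : HasDerivAt (fun s : ℝ => 1 + cross p (s • v)) (p.2 * conj v.2 * (amp p)⁻¹) 0 := by
    have h2 : HasDerivAt (fun s : ℝ => (amp p * amp (s • v))⁻¹)
        (-(amp p * (v.1 * Complex.I)) / (amp p * amp ((0 : ℝ) • v)) ^ 2) 0 :=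
      (h1.const_mul (amp p)).inv (mul_ne_zero (amp_ne_zero _) (amp_ne_zero _))
    have h4 := (((hs.const_mul (p.2 * conj v.2)).mul h2).const_add 1)
    refine h4.of_forall_eq (fun s => ?_) ?_
    · simp only [cross, Prod.smul_snd, Complex.real_smul, map_mul, Complex.conj_ofReal,
        Pi.mul_apply]
      ring
    · simp [amp_zero]
  have h5 : HasDerivAt (fun s : ℝ => Complex.arg (1 + cross p (s • v)))
      ((p.2 * conj v.2 * (amp p)⁻¹).im) 0 := by
    have h6 : HasDerivAt (fun s : ℝ => Complex.log (1 + cross p (s • v))) _ 0 :=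
      h3.clog_real (Or.inl (re_one_add_cross_pos _ _))
    have h7 := Complex.imCLM.hasFDerivAt.comp_hasDerivAt (0 : ℝ) h6
    refine h7.of_forall_eq (fun s => ?_) ?_
    · exact (Complex.log_im _).symm
    · simp [cross_zero_right]
  have h8 : HasDerivAt (fun s : ℝ => s * v.1) v.1 0 := by
    simpa using (hasDerivAt_id (0 : ℝ)).mul_const v.1
  have h9 := (h8.const_add p.1).add h5
  have h10 : HasDerivAt (fun s : ℝ => conj (amp (s • v))) (-(v.1 * Complex.I)) 0 := by
    have := Complex.conjCLE.hasFDerivAt.comp_hasDerivAt (0 : ℝ) h1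
    refine this.of_forall_eq (fun s => rfl) ?_
    simp
  have h11 := ((hs.mul_const v.2).const_mul (amp p)).add (h10.const_mul p.2)
  have h12 := h9.prodMk h11
  refine h12.of_forall_eq (fun s => ?_) ?_
  · simp [mul]
  · simp [field]

theorem hasDerivAt_field (v u : ℝ × ℂ) :
    HasDerivAt (fun s : ℝ => field v (s • u))
      ((u.2 * conj v.2).im, Complex.I * (u.1 * v.2 - v.1 * u.2)) 0 := by
  have h1 := hasDerivAt_amp u
  have hs : HasDerivAt (fun s : ℝ => (s : ℂ)) 1 0 := Complex.ofRealCLM.hasDerivAt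
  have h2 : HasDerivAt (fun s : ℝ => (amp (s • u))⁻¹)
      (-(u.1 * Complex.I) / (amp ((0 : ℝ) • u)) ^ 2) 0 := h1.inv (amp_ne_zero _)
  have h3 := (hs.const_mul (u.2 * conj v.2)).mul h2
  have h4 := Complex.imCLM.hasFDerivAt.comp_hasDerivAt (0 : ℝ) h3
  have h5 := h4.const_add v.1
  have h6 := (h1.mul_const v.2).add ((hs.mul_const u.2).mul_const (-(v.1 * Complex.I)))
  have h7 := h5.prodMk h6
  refine h7.of_forall_eq (fun s => ?_) ?_
  · refine Prod.ext ?_ ?_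
    · simp only [field, Prod.smul_snd, Complex.real_smul, Function.comp_apply, Pi.mul_apply,
        Complex.imCLM_apply]
      congr 2
      ring
    · simp [field]
  · refine Prod.ext ?_ ?_
    · simp [amp_zero]
    · simp
      ring

theorem contDiff_field (v : ℝ × ℂ) : ContDiff ℝ ∞ (field v) := by
  have h2 : ContDiff ℝ ∞ fun p : ℝ × ℂ => p.2 * conj v.2 * (amp p)⁻¹ :=
    (contDiff_snd.mul contDiff_const).mul (contDiff_amp.inv amp_ne_zero)
  exact (contDiff_const.add (Complex.imCLM.contDiff.comp h2)).prodMk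
    ((contDiff_amp.mul contDiff_const).add (contDiff_snd.mul contDiff_const))

end UnivSU


/-! ### The simply connected group with Lie algebra `𝔨_α` -/

namespace KGroup

open scoped ComplexConjugate

/-- The underlying space of the product of the universal covering group of `SU(1, 1)` with a
semidirect product `ℝ ⋉ (ℝ × ℂ)`. -/
abbrev Model : Type := (ℝ × ℂ) × ℝ × ℝ × ℂ

/-- The complex weight of the action of `ℝ` on `ℂ`. -/
def weight (α : ℝ) : ℂ := α / 2 + Complex.I

/-- The product. -/
def mul (α : ℝ) (p q : Model) : Model :=
  (UnivSU.mul p.1 q.1, p.2.1 + q.2.1, p.2.2.1 + Real.exp (-(α * p.2.1)) * q.2.2.1,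
    p.2.2.2 + Complex.exp (weight α * p.2.1) * q.2.2.2)

/-- The inverse. -/
def inv (α : ℝ) (p : Model) : Model :=
  (-p.1, -p.2.1, -(Real.exp (α * p.2.1) * p.2.2.1),
    -(Complex.exp (-(weight α * p.2.1)) * p.2.2.2))

theorem assoc (α : ℝ) (p q r : Model) : mul α (mul α p q) r = mul α p (mul α q r) := by
  refine Prod.ext (UnivSU.assoc _ _ _) (Prod.ext (add_assoc _ _ _) (Prod.ext ?_ ?_))
  · simp only [mul]
    rw [mul_add α, neg_add, Real.exp_add]
    ring
  · simp only [mul]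
    push_cast
    rw [mul_add (weight α), Complex.exp_add]
    ring

theorem zero_left (α : ℝ) (p : Model) : mul α 0 p = p := by
  simp [mul, UnivSU.zero_left]

theorem zero_right (α : ℝ) (p : Model) : mul α p 0 = p := by
  simp [mul, UnivSU.zero_right]

theorem inv_left (α : ℝ) (p : Model) : mul α (inv α p) p = 0 := by
  simp [mul, inv, UnivSU.neg_left]

theorem contDiff_mul (α : ℝ) : ContDiff ℝ ∞ fun x : Model × Model => mul α x.1 x.2 := by
  have t1 : ContDiff ℝ ∞ fun x : Model × Model => x.1.2.1 := contDiff_fst.snd.fst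
  have hexp : ContDiff ℝ ∞ fun x : Model × Model => Real.exp (-(α * x.1.2.1)) :=
    (contDiff_const.mul t1).neg.exp
  have hcexp : ContDiff ℝ ∞ fun x : Model × Model => Complex.exp (weight α * x.1.2.1) :=
    (contDiff_const.mul (Complex.ofRealCLM.contDiff.comp t1)).cexp
  exact (UnivSU.contDiff_mul.comp (contDiff_fst.fst.prodMk contDiff_snd.fst)).prodMk
    ((t1.add contDiff_snd.snd.fst).prodMk
      ((contDiff_fst.snd.snd.fst.add (hexp.mul contDiff_snd.snd.snd.fst)).prodMk
        (contDiff_fst.snd.snd.snd.add (hcexp.mul contDiff_snd.snd.snd.snd))))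

theorem contDiff_inv (α : ℝ) : ContDiff ℝ ∞ (inv α) := by
  have t1 : ContDiff ℝ ∞ fun x : Model => x.2.1 := contDiff_snd.fst
  have hexp : ContDiff ℝ ∞ fun x : Model => Real.exp (α * x.2.1) :=
    (contDiff_const.mul t1).exp
  have hcexp : ContDiff ℝ ∞ fun x : Model => Complex.exp (-(weight α * x.2.1)) :=
    (contDiff_const.mul (Complex.ofRealCLM.contDiff.comp t1)).neg.cexp
  exact contDiff_fst.neg.prodMk (t1.neg.prodMk
    ((hexp.mul contDiff_snd.snd.fst).neg.prodMk (hcexp.mul contDiff_snd.snd.snd).neg))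

/-- The left-invariant field with value `v` at the identity. -/
def field (α : ℝ) (v p : Model) : Model :=
  (UnivSU.field v.1 p.1, v.2.1, Real.exp (-(α * p.2.1)) * v.2.2.1,
    Complex.exp (weight α * p.2.1) * v.2.2.2)

theorem hasDerivAt_mul (α : ℝ) (p v : Model) :
    HasDerivAt (fun s : ℝ => mul α p (s • v)) (field α v p) 0 := by
  have hs : HasDerivAt (fun s : ℝ => s) 1 0 := hasDerivAt_id 0
  have hc : HasDerivAt (fun s : ℝ => (s : ℂ)) 1 0 := Complex.ofRealCLM.hasDerivAt
  have h := (UnivSU.hasDerivAt_mul p.1 v.1).prodMk (((hs.mul_const v.2.1).const_add p.2.1).prodMk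
    ((((hs.mul_const v.2.2.1).const_mul (Real.exp (-(α * p.2.1)))).const_add p.2.2.1).prodMk
      (((hc.mul_const v.2.2.2).const_mul
        (Complex.exp (weight α * p.2.1))).const_add p.2.2.2)))
  exact h.of_forall_eq (fun s => by simp [mul]) (by simp [field])

/-- The derivative at the identity of the left-invariant field with value `v`, in the
direction `u`. -/
def fieldDeriv (α : ℝ) (v u : Model) : Model :=
  (((u.1.2 * conj v.1.2).im, Complex.I * (u.1.1 * v.1.2 - v.1.1 * u.1.2)), 0,
    -(α * u.2.1 * v.2.2.1), weight α * u.2.1 * v.2.2.2)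

theorem hasDerivAt_field (α : ℝ) (v u : Model) :
    HasDerivAt (fun s : ℝ => field α v (s • u)) (fieldDeriv α v u) 0 := by
  have hs : HasDerivAt (fun s : ℝ => s) 1 0 := hasDerivAt_id 0
  have hc : HasDerivAt (fun s : ℝ => (s : ℂ)) 1 0 := Complex.ofRealCLM.hasDerivAt
  have h := (UnivSU.hasDerivAt_field v.1 u.1).prodMk ((hasDerivAt_const (0 : ℝ) v.2.1).prodMk
    ((((hs.mul_const u.2.1).const_mul α).neg.exp.mul_const v.2.2.1).prodMk
      (((hc.mul_const (u.2.1 : ℂ)).const_mul (weight α)).cexp.mul_const v.2.2.2)))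
  exact h.of_forall_eq (fun s => by simp [field]) (by simp [fieldDeriv])

theorem contDiff_field (α : ℝ) (v : Model) : ContDiff ℝ ∞ (field α v) := by
  have t1 : ContDiff ℝ ∞ fun x : Model => x.2.1 := contDiff_snd.fst
  have hexp : ContDiff ℝ ∞ fun x : Model => Real.exp (-(α * x.2.1)) :=
    (contDiff_const.mul t1).neg.exp
  have hcexp : ContDiff ℝ ∞ fun x : Model => Complex.exp (weight α * x.2.1) :=
    (contDiff_const.mul (Complex.ofRealCLM.contDiff.comp t1)).cexp
  exact ((UnivSU.contDiff_field v.1).comp contDiff_fst).prodMk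
    (contDiff_const.prodMk ((hexp.mul contDiff_const).prodMk (hcexp.mul contDiff_const)))

/-- The automorphisms scaling the ideal `ℝ × ℂ`. -/
def scale (s : ℝ) (p : Model) : Model :=
  (p.1, p.2.1, Real.exp (2 * s) * p.2.2.1, (Real.exp (-(4 * s)) : ℝ) * p.2.2.2)

/-- The ℝ factor acts on each of the summands ℝ and ℂ by a scalar, with which real rescalings
commute. -/
theorem scale_mul (α s : ℝ) (p q : Model) :
    scale s (mul α p q) = mul α (scale s p) (scale s q) := by
  refine Prod.ext rfl (Prod.ext rfl (Prod.ext ?_ ?_)) <;> simp only [scale, mul] <;> ring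

theorem scale_zero (p : Model) : scale 0 p = p := by
  simp [scale]

theorem scale_add (s t : ℝ) (p : Model) : scale (s + t) p = scale s (scale t p) := by
  refine Prod.ext rfl (Prod.ext rfl (Prod.ext ?_ ?_))
  · simp only [scale]
    rw [mul_add (2 : ℝ), Real.exp_add]
    ring
  · simp only [scale]
    rw [mul_add (4 : ℝ), neg_add, Real.exp_add]
    push_cast
    ring

theorem contDiff_scale : ContDiff ℝ ∞ fun x : ℝ × Model => scale x.1 x.2 := by
  have h1 : ContDiff ℝ ∞ fun x : ℝ × Model => Real.exp (2 * x.1) :=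
    (contDiff_const.mul contDiff_fst).exp
  have h2 : ContDiff ℝ ∞ fun x : ℝ × Model => Real.exp (-(4 * x.1)) :=
    (contDiff_const.mul contDiff_fst).neg.exp
  exact contDiff_snd.fst.prodMk (contDiff_snd.snd.fst.prodMk
    ((h1.mul contDiff_snd.snd.snd.fst).prodMk
      ((Complex.ofRealCLM.contDiff.comp h2).mul contDiff_snd.snd.snd.snd)))

/-- The generator of `scale`. -/
def generator (p : Model) : Model := (0, 0, 2 * p.2.2.1, -(4 * p.2.2.2))

theorem hasDerivAt_scale (p : Model) (t : ℝ) :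
    HasDerivAt (fun s => scale s p) (generator (scale t p)) t := by
  have hs : HasDerivAt (fun s : ℝ => s) 1 t := hasDerivAt_id t
  have h := (hasDerivAt_const t p.1).prodMk ((hasDerivAt_const t p.2.1).prodMk
    (((hs.const_mul 2).exp.mul_const p.2.2.1).prodMk
      ((hs.const_mul 4).neg.exp.ofReal_comp.mul_const p.2.2.2)))
  refine h.of_forall_eq (fun s => rfl) (Prod.ext rfl (Prod.ext rfl (Prod.ext ?_ ?_)))
  · simp only [generator, scale]
    ring
  · simp only [generator, scale, Pi.neg_apply]
    push_cast
    ring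

/-- Linear coordinates on the group, in which the bracket of `𝔨_α` takes its standard form. -/
def chartₗ : EuclideanSpace ℝ (Fin 7) ≃ₗ[ℝ] Model where
  toFun x := (((x 1 - x 6) / 2, ⟨x 4 / √2, x 2 / √2⟩), x 6, x 0, ⟨x 3, x 5⟩)
  invFun p := !₂[p.2.2.1, 2 * p.1.1 + p.2.1, p.1.2.im * √2, p.2.2.2.re, p.1.2.re * √2,
    p.2.2.2.im, p.2.1]
  map_add' x y := by
    refine Prod.ext (Prod.ext ?_ (Complex.ext ?_ ?_))
      (Prod.ext ?_ (Prod.ext ?_ (Complex.ext ?_ ?_))) <;> simp <;> ring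
  map_smul' c x := by
    refine Prod.ext (Prod.ext ?_ (Complex.ext ?_ ?_))
      (Prod.ext ?_ (Prod.ext ?_ (Complex.ext ?_ ?_))) <;> simp <;> ring
  left_inv x := by
    ext i
    fin_cases i <;> simp <;> ring
  right_inv p := by
    refine Prod.ext (Prod.ext ?_ (Complex.ext ?_ ?_))
      (Prod.ext ?_ (Prod.ext ?_ (Complex.ext ?_ ?_))) <;> simp

/-- Linear coordinates on the group, as a continuous map. -/
def chart : EuclideanSpace ℝ (Fin 7) ≃L[ℝ] Model := chartₗ.toContinuousLinearEquiv

end KGroup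


/-! ### The group structure on ℝ⁷ and its Lie algebra -/

namespace KGroup

open scoped ComplexConjugate

/-- The group structure on `ℝ⁷`. -/
abbrev group (α : ℝ) : Group (EuclideanSpace ℝ (Fin 7)) where
  mul x y := chart.symm (mul α (chart x) (chart y))
  one := 0
  inv x := chart.symm (inv α (chart x))
  mul_assoc x y z := by
    change chart.symm (mul α (chart (chart.symm (mul α (chart x) (chart y)))) (chart z)) =
      chart.symm (mul α (chart x) (chart (chart.symm (mul α (chart y) (chart z)))))
    rw [chart.apply_symm_apply, chart.apply_symm_apply, assoc]
  one_mul x := by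
    change chart.symm (mul α (chart 0) (chart x)) = x
    rw [map_zero, zero_left, chart.symm_apply_apply]
  mul_one x := by
    change chart.symm (mul α (chart x) (chart 0)) = x
    rw [map_zero, zero_right, chart.symm_apply_apply]
  inv_mul_cancel x := by
    change chart.symm (mul α (chart (chart.symm (inv α (chart x)))) (chart x)) = 0
    rw [chart.apply_symm_apply, inv_left, map_zero]

section

variable (α : ℝ)

theorem mul_eq (x y : EuclideanSpace ℝ (Fin 7)) : letI := group α
    x * y = chart.symm (mul α (chart x) (chart y)) := rfl

theorem one_eq : letI := group α; (1 : EuclideanSpace ℝ (Fin 7)) = 0 := rfl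

theorem lieGroup : letI := group α; LieGroup (𝓡 7) ∞ (EuclideanSpace ℝ (Fin 7)) := by
  let _ := group α
  refine { contMDiff_mul := ?_, contMDiff_inv := ?_ }
  · rw [← modelWithCornersSelf_prod, chartedSpaceSelf_prod]
    refine contMDiff_iff_contDiff.2 ?_
    exact chart.symm.contDiff.comp ((contDiff_mul α).comp
      ((chart.contDiff.comp contDiff_fst).prodMk (chart.contDiff.comp contDiff_snd)))
  · refine contMDiff_iff_contDiff.2 ?_
    exact chart.symm.contDiff.comp ((contDiff_inv α).comp chart.contDiff)

theorem fderiv_mul_left (x v : EuclideanSpace ℝ (Fin 7)) : letI := group α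
    fderiv ℝ (fun y : EuclideanSpace ℝ (Fin 7) => x * y) 1 v =
      chart.symm (field α (chart v) (chart x)) := by
  refine fderiv_apply_eq_of_hasDerivAt ?_ ?_
  · have h : ContDiff ℝ ∞ fun y => chart.symm (mul α (chart x) (chart y)) :=
      chart.symm.contDiff.comp ((contDiff_mul α).comp (contDiff_const.prodMk chart.contDiff))
    exact (h.differentiable (by simp)).differentiableAt
  · have h := chart.symm.toContinuousLinearMap.hasFDerivAt.comp_hasDerivAt (0 : ℝ)
      (hasDerivAt_mul α (chart x) (chart v))
    refine h.of_forall_eq (fun s => ?_) rfl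
    change chart.symm (mul α (chart x) (chart (s • v))) =
      chart.symm (mul α (chart x) (s • chart v))
    rw [map_smul]

theorem field_zero (v : Model) : field α v 0 = v := by
  simp [field, UnivSU.field, UnivSU.amp_zero]

/-- Left multiplication by 1 has identity derivative, so only the antisymmetrised derivatives of the
left-invariant fields remain. -/
theorem groupLieBracket_eq (v w : EuclideanSpace ℝ (Fin 7)) : letI := group α
    (Bracket.bracket (L := GroupLieAlgebra (𝓡 7) (EuclideanSpace ℝ (Fin 7)))
      (M := GroupLieAlgebra (𝓡 7) (EuclideanSpace ℝ (Fin 7))) v w :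
        EuclideanSpace ℝ (Fin 7)) =
      chart.symm (fieldDeriv α (chart w) (chart v) - fieldDeriv α (chart v) (chart w)) := by
  let _ := group α
  have h1 : ∀ v : EuclideanSpace ℝ (Fin 7),
      fderiv ℝ (fun y : EuclideanSpace ℝ (Fin 7) => 1 * y) 1 v = v := fun v => by
    rw [fderiv_mul_left, one_eq, map_zero, field_zero, chart.symm_apply_apply]
  have h2 : ∀ v u : EuclideanSpace ℝ (Fin 7),
      fderiv ℝ (fun x : EuclideanSpace ℝ (Fin 7) =>
        fderiv ℝ (fun y : EuclideanSpace ℝ (Fin 7) => x * y) 1 v) 1 u =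
          chart.symm (fieldDeriv α (chart v) (chart u)) := fun v u => by
    have h3 : (fun x : EuclideanSpace ℝ (Fin 7) =>
        fderiv ℝ (fun y : EuclideanSpace ℝ (Fin 7) => x * y) 1 v) =
          fun x => chart.symm (field α (chart v) (chart x)) :=
      funext fun x => fderiv_mul_left α x v
    rw [h3]
    refine fderiv_apply_eq_of_hasDerivAt ?_ ?_
    · have h : ContDiff ℝ ∞ fun x => chart.symm (field α (chart v) (chart x)) :=
        chart.symm.contDiff.comp ((contDiff_field α _).comp chart.contDiff)
      exact (h.differentiable (by simp)).differentiableAt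
    · have h := chart.symm.toContinuousLinearMap.hasFDerivAt.comp_hasDerivAt (0 : ℝ)
        (hasDerivAt_field α (chart v) (chart u))
      refine h.of_forall_eq (fun s => ?_) rfl
      change chart.symm (field α (chart v) (chart (s • u))) =
        chart.symm (field α (chart v) (s • chart u))
      rw [map_smul]
  refine (groupLieBracket_eq_fderiv v w).trans ?_
  rw [h1, h1, h2, h2, ← map_sub]

/-- The coordinates on `𝔨_α`, with values in Euclidean space. -/
def linEquiv : KAlg α ≃ₗ[ℝ] EuclideanSpace ℝ (Fin 7) :=
  (KAlg.coords α).trans (WithLp.linearEquiv 2 ℝ (Fin 7 → ℝ)).symm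

/-- The identification of `𝔨_α` with the tangent space at the identity. -/
def lieEquiv : letI := group α; letI := lieGroup α
    KAlg α ≃ₗ⁅ℝ⁆ GroupLieAlgebra (𝓡 7) (EuclideanSpace ℝ (Fin 7)) :=
  letI := group α
  letI := lieGroup α
  { linEquiv α with
    map_lie' := by
      intro x y
      refine Eq.trans ?_ (groupLieBracket_eq α (linEquiv α x) (linEquiv α y)).symm
      refine chart.injective ?_
      rw [chart.apply_symm_apply]
      have h2 : √2 * √2 = 2 := Real.mul_self_sqrt (by norm_num)
      have h3 : (√2 : ℝ) ≠ 0 := by positivity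
      have h4 : (√2)⁻¹ * (√2)⁻¹ = 1 / 2 := by rw [← mul_inv, h2]; norm_num
      have he : ∀ z, chart (linEquiv α z) = (((KAlg.coords α z 1 - KAlg.coords α z 6) / 2,
        ⟨KAlg.coords α z 4 / √2, KAlg.coords α z 2 / √2⟩), KAlg.coords α z 6, KAlg.coords α z 0,
        ⟨KAlg.coords α z 3, KAlg.coords α z 5⟩) := fun z => rfl
      change chart (linEquiv α ⁅x, y⁆) = _
      rw [he, he, he, KAlg.coords_lie]
      generalize KAlg.coords α x = u
      generalize KAlg.coords α y = v
      refine Prod.ext (Prod.ext ?_ (Complex.ext ?_ ?_))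
        (Prod.ext ?_ (Prod.ext ?_ (Complex.ext ?_ ?_)))
      · simp [fieldDeriv, KAlg.structureEq, KAlg.w, div_eq_mul_inv]
        linear_combination (2 * u 4 * v 2 - 2 * u 2 * v 4) * h4
      all_goals simp [fieldDeriv, KAlg.structureEq, KAlg.w, weight] <;> ring }

end

end KGroup


/-! ### Projection to SL(2, ℝ) and the automorphism flow -/

namespace KGroup

open scoped ComplexConjugate

variable (α : ℝ)

/-- The projection to `SL(2, ℝ) ≅ SU(1, 1)`. -/
def toSL (x : EuclideanSpace ℝ (Fin 7)) : Matrix.SpecialLinearGroup (Fin 2) ℝ :=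
  ⟨!![(UnivSU.amp (chart x).1).re + (chart x).1.2.re,
      -(UnivSU.amp (chart x).1).im + (chart x).1.2.im;
      (UnivSU.amp (chart x).1).im + (chart x).1.2.im,
      (UnivSU.amp (chart x).1).re - (chart x).1.2.re], by
    have h := UnivSU.normSq_amp (chart x).1
    rw [Complex.normSq_apply, Complex.normSq_apply] at h
    rw [Matrix.det_fin_two_of]
    linear_combination h⟩

/-- The matrix is that of the real-linear map z ↦ az + b z̄ on ℂ = ℝ², and composing two such maps
reproduces the product of SU(1, 1). -/
theorem toSL_mul (x y : EuclideanSpace ℝ (Fin 7)) : letI := group α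
    toSL (x * y) = toSL x * toSL y := by
  let _ := group α
  have h1 : (chart (x * y)).1 = UnivSU.mul (chart x).1 (chart y).1 := by
    rw [mul_eq, chart.apply_symm_apply]
    rfl
  have h2 := UnivSU.amp_mul (chart x).1 (chart y).1
  refine Subtype.ext (?_ : _ = (toSL x).1 * (toSL y).1)
  simp only [toSL, h1, h2]
  ext i j
  fin_cases i <;> fin_cases j <;> simp [UnivSU.mul, Matrix.mul_apply, Fin.sum_univ_two] <;> ring

theorem toSL_surjective : Function.Surjective toSL := by
  intro A
  have hdet := A.2
  rw [Matrix.det_fin_two] at hdet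
  set a : ℂ := ⟨(A.1 0 0 + A.1 1 1) / 2, (A.1 1 0 - A.1 0 1) / 2⟩ with ha
  set b : ℂ := ⟨(A.1 0 0 - A.1 1 1) / 2, (A.1 1 0 + A.1 0 1) / 2⟩ with hb
  have hab : 1 + Complex.normSq b = Complex.normSq a := by
    rw [Complex.normSq_apply, Complex.normSq_apply]
    linear_combination -hdet
  have hamp : UnivSU.amp (Complex.arg a, b) = a := by
    rw [UnivSU.amp, hab, Complex.normSq_eq_norm_sq, Real.sqrt_sq (norm_nonneg _)]
    exact Complex.norm_mul_exp_arg_mul_I a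
  refine ⟨chart.symm ((Complex.arg a, b), 0), Subtype.ext ?_⟩
  simp only [toSL, chart.apply_symm_apply, hamp]
  ext i j
  fin_cases i <;> fin_cases j <;> simp [ha, hb] <;> ring

/-- The quotient SL(2, ℝ) is nontrivial and perfect, hence not solvable. -/
theorem not_isSolvable : letI := group α; ¬ Group.IsSolvable (EuclideanSpace ℝ (Fin 7)) := by
  let _ := group α
  intro h
  let f : EuclideanSpace ℝ (Fin 7) →* Matrix.SpecialLinearGroup (Fin 2) ℝ :=
    MonoidHom.mk' toSL (toSL_mul α)
  have h1 : Group.IsSolvable (Matrix.SpecialLinearGroup (Fin 2) ℝ) :=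
    Group.isSolvable_of_surjective (f := f) toSL_surjective
  have h2 : Nontrivial (Matrix.SpecialLinearGroup (Fin 2) ℝ) := by
    refine ⟨1, -1, fun h => ?_⟩
    have h3 := congrArg (fun A : Matrix.SpecialLinearGroup (Fin 2) ℝ => A.1 0 0) h
    norm_num at h3
  exact (Group.IsSolvable.commutator_lt_top_of_nontrivial
    (G := Matrix.SpecialLinearGroup (Fin 2) ℝ)).ne
      (Matrix.SL2.commutator_eq_top (a := (2 : ℝ)) (by norm_num) (by norm_num))

/-- The one-parameter group of automorphisms. -/
def flow (s : ℝ) (x : EuclideanSpace ℝ (Fin 7)) : EuclideanSpace ℝ (Fin 7) :=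
  chart.symm (scale s (chart x))

theorem contDiff_flow :
    ContDiff ℝ ∞ fun p : ℝ × EuclideanSpace ℝ (Fin 7) => flow p.1 p.2 :=
  chart.symm.contDiff.comp (contDiff_scale.comp
    (contDiff_fst.prodMk (chart.contDiff.comp contDiff_snd)))

/-- In these coordinates each F_t is linear, so it is its own derivative. -/
theorem fderiv_flow (t : ℝ) (v : EuclideanSpace ℝ (Fin 7)) :
    fderiv ℝ (flow t) 0 v = flow t v := by
  refine fderiv_apply_eq_of_hasDerivAt ?_ ?_
  · have h : ContDiff ℝ ∞ (flow t) := contDiff_flow.comp (contDiff_const.prodMk contDiff_id)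
    exact (h.differentiable (by simp)).differentiableAt
  · have hs : HasDerivAt (fun s : ℝ => s • flow t v) ((1 : ℝ) • flow t v) 0 :=
      (hasDerivAt_id (0 : ℝ)).smul_const _
    refine hs.of_forall_eq (fun s => ?_) (one_smul _ _).symm
    rw [flow, flow, ← map_smul, map_smul chart]
    congr 1
    refine Prod.ext rfl (Prod.ext rfl (Prod.ext ?_ ?_))
    · simp [scale]; ring
    · simp [scale]; ring

theorem linEquiv_basis (i : Fin 7) :
    linEquiv α (KAlg.basis α i) = EuclideanSpace.single i 1 := by
  have h : KAlg.coords α (KAlg.basis α i) = Pi.single i 1 := funext fun j => by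
    rw [KAlg.coords_basis, Pi.single_apply]
    simp only [eq_comm]
  change WithLp.toLp 2 (KAlg.coords α (KAlg.basis α i)) = _
  rw [h]
  rfl

theorem flow_single (t : ℝ) (i : Fin 7) : flow t (EuclideanSpace.single i 1) =
    Real.exp (t * (![2, 0, 0, -4, 0, -4, 0] : Fin 7 → ℝ) i) • EuclideanSpace.single i 1 := by
  refine chart.injective ?_
  rw [flow, chart.apply_symm_apply, map_smul]
  have h : ∀ x, chart x = (((x 1 - x 6) / 2, ⟨x 4 / √2, x 2 / √2⟩), x 6, x 0, ⟨x 3, x 5⟩) :=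
    fun x => rfl
  rw [h]
  refine Prod.ext (Prod.ext ?_ (Complex.ext ?_ ?_))
    (Prod.ext ?_ (Prod.ext ?_ (Complex.ext ?_ ?_))) <;>
  fin_cases i <;> simp [scale] <;> ring_nf

end KGroup


/-! ### The field X_D and existence of the group -/

namespace KGroup

variable (α : ℝ)

theorem isOneParameterGroupOf_flow : letI := group α; letI := lieGroup α
    G2.IsOneParameterGroupOf (lieEquiv α) (KAlg.deriv α : KAlg α →ₗ[ℝ] KAlg α) flow := by
  let _ := group α
  let _ := lieGroup α
  refine ⟨?_, ?_, ?_, ?_, ?_⟩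
  · rw [← modelWithCornersSelf_prod, chartedSpaceSelf_prod]
    exact contMDiff_iff_contDiff.2 contDiff_flow
  · intro t x y
    rw [mul_eq, mul_eq, flow, flow, flow, chart.apply_symm_apply, chart.apply_symm_apply,
      chart.apply_symm_apply, scale_mul]
  · intro x
    rw [flow, scale_zero, chart.symm_apply_apply]
  · intro s t x
    rw [flow, flow, flow, chart.apply_symm_apply, scale_add]
  · intro t v
    have h1 : (mfderiv (𝓡 7) (𝓡 7) (flow t) (1 : EuclideanSpace ℝ (Fin 7)) (lieEquiv α v) :
        EuclideanSpace ℝ (Fin 7)) = fderiv ℝ (flow t) 0 (linEquiv α v) :=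
      congrArg (fun A : EuclideanSpace ℝ (Fin 7) →L[ℝ] EuclideanSpace ℝ (Fin 7) =>
        A (linEquiv α v)) mfderiv_eq_fderiv
    refine h1.trans ?_
    have hfg : (fderiv ℝ (flow t) 0).toLinearMap ∘ₗ (linEquiv α).toLinearMap =
        (linEquiv α).toLinearMap ∘ₗ
          G2.expEnd (t • (KAlg.deriv α : KAlg α →ₗ[ℝ] KAlg α)) := by
      refine (KAlg.basis α).ext fun i => ?_
      have h3 : G2.expEnd (t • (KAlg.deriv α : KAlg α →ₗ[ℝ] KAlg α)) (KAlg.basis α i) =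
          Real.exp (t * KAlg.derivEntry i) • KAlg.basis α i :=
        G2.expEnd_apply_basis (KAlg.basis α) (d := fun i => t * KAlg.derivEntry i) (fun i => by
          have h4 := KAlg.deriv_basis α i
          rw [LinearMap.smul_apply, mul_smul]
          exact congrArg (t • ·) h4) i
      rw [LinearMap.comp_apply, LinearMap.comp_apply, h3, map_smul]
      refine (fderiv_flow t _).trans ?_
      change flow t (linEquiv α _) = _ • linEquiv α _
      rw [linEquiv_basis]
      exact flow_single t i
    exact LinearMap.congr_fun hfg v

/-- The generator of the flow. -/
def generatorField (x : EuclideanSpace ℝ (Fin 7)) : EuclideanSpace ℝ (Fin 7) :=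
  chart.symm (generator (chart x))

theorem hasDerivAt_flow (x : EuclideanSpace ℝ (Fin 7)) (t : ℝ) :
    HasDerivAt (fun s => flow s x) (generatorField (flow t x)) t := by
  have h := chart.symm.toContinuousLinearMap.hasFDerivAt.comp_hasDerivAt t
    (hasDerivAt_scale (chart x) t)
  refine h.of_forall_eq (fun s => rfl) ?_
  rw [generatorField, flow, chart.apply_symm_apply]
  rfl

theorem isMIntegralCurve_flow (x : EuclideanSpace ℝ (Fin 7)) :
    IsMIntegralCurve (I := 𝓡 7) (M := EuclideanSpace ℝ (Fin 7)) (fun t => flow t x)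
      generatorField := by
  intro t
  exact (hasDerivAt_flow x t).hasFDerivAt.hasMFDerivAt

end KGroup

namespace KAlg

theorem exists_group (α : ℝ) (hα : 0 < α) :
    ∃ (G : Type) (_ : TopologicalSpace G) (_ : ChartedSpace (EuclideanSpace ℝ (Fin 7)) G)
        (_ : Group G) (_ : LieGroup (𝓡 7) ∞ G) (_ : T2Space G) (_ : SimplyConnectedSpace G)
        (ψ : KAlg α ≃ₗ⁅ℝ⁆ GroupLieAlgebra (𝓡 7) G) (X : (x : G) → TangentSpace (𝓡 7) x),
        ¬ Group.IsSolvable G ∧ G2.IsVectorFieldOf ψ (deriv α : KAlg α →ₗ[ℝ] KAlg α) X ∧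
          G2.IsLaplacianSoliton (G2.leftInvariantForm ψ (KAlg.phi α)) 6 X := by
  let _ := KGroup.group α
  let _ := KGroup.lieGroup α
  have hX : G2.IsVectorFieldOf (KGroup.lieEquiv α) (deriv α : KAlg α →ₗ[ℝ] KAlg α)
      KGroup.generatorField :=
    ⟨KGroup.flow, KGroup.isOneParameterGroupOf_flow α, KGroup.isMIntegralCurve_flow⟩
  -- Simple connectedness is that of the vector space ℝ⁷.
  exact ⟨EuclideanSpace ℝ (Fin 7), inferInstance, inferInstance, inferInstance, inferInstance,
    inferInstance, inferInstance, KGroup.lieEquiv α, KGroup.generatorField,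
    KGroup.not_isSolvable α, hX, isLaplacianSoliton _ hα _ hX⟩

end KAlg

end

theorem mainTheorem2 (α : ℝ) (hα : 0 < α) :
    -- the Lie algebra
    (Nonempty (KAlg α ≃ₗ⁅ℝ⁆ LieAlgebra.SpecialLinear.sl (Fin 2) ℝ × RAlg α (-α / 2)) ∧
      ¬ LieAlgebra.IsSolvable (KAlg α) ∧
      G2.IsUnimodular (KAlg α) ∧
      ∀ β : ℝ, 0 < β → Nonempty (KAlg α ≃ₗ⁅ℝ⁆ KAlg β) → β = α) ∧
    -- the closed `G₂`-structure with its metric, volume form and torsion form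
    (G2.IsClosedG2Structure (KAlg.phi α) ∧
      (∀ x y : KAlg α, G2.metric (KAlg.phi α) x y =
        (∑ i : Fin 6, (KAlg.basis α).coord i.castSucc x * (KAlg.basis α).coord i.castSucc y)
          + α ^ 2 / 4 * ((KAlg.basis α).coord 6 x * (KAlg.basis α).coord 6 y)) ∧
      G2.volForm (KAlg.phi α) = (α / 2) • G2.basisForm (KAlg.basis α) ![0, 1, 2, 3, 4, 5, 6] ∧
      ∀ τ : KAlg α [⋀^Fin 2]→ₗ[ℝ] ℝ, G2.IsTorsionForm (KAlg.phi α) τ ↔ τ = KAlg.tau α) ∧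
    -- the soliton equation on the Lie algebra and on the simply connected Lie group
    ∃ D : LieDerivation ℝ (KAlg α) (KAlg α),
      LinearMap.toMatrix (KAlg.basis α) (KAlg.basis α) D =
        Matrix.diagonal ![2, 0, 0, -4, 0, -4, 0] ∧
      G2.SatisfiesAS (KAlg.phi α) (KAlg.tau α) 6 D ∧
      G2.IsAlgebraicSoliton (KAlg.phi α) 6 D ∧
      (∃ (G : Type) (_ : TopologicalSpace G) (_ : ChartedSpace (EuclideanSpace ℝ (Fin 7)) G)
        (_ : Group G) (_ : LieGroup (𝓡 7) ∞ G) (_ : T2Space G) (_ : SimplyConnectedSpace G)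
        (ψ : KAlg α ≃ₗ⁅ℝ⁆ GroupLieAlgebra (𝓡 7) G) (X : (x : G) → TangentSpace (𝓡 7) x),
        ¬ Group.IsSolvable G ∧ G2.IsVectorFieldOf ψ D X ∧
          G2.IsLaplacianSoliton (G2.leftInvariantForm ψ (KAlg.phi α)) 6 X) ∧
      ∀ (G : Type*) [TopologicalSpace G] [ChartedSpace (EuclideanSpace ℝ (Fin 7)) G]
        [Group G] [LieGroup (𝓡 7) ∞ G] [T2Space G] [SimplyConnectedSpace G]
        (ψ : KAlg α ≃ₗ⁅ℝ⁆ GroupLieAlgebra (𝓡 7) G) (X : (x : G) → TangentSpace (𝓡 7) x),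
        G2.IsVectorFieldOf ψ D X →
          G2.IsLaplacianSoliton (G2.leftInvariantForm ψ (KAlg.phi α)) 6 X := by
  exact ⟨⟨⟨KAlg.equivProd α⟩, KAlg.not_isSolvable α, KAlg.isUnimodular α,
      fun β hβ ⟨f⟩ => KAlg.eq_of_equiv hα hβ f⟩,
    ⟨KAlg.isClosedG2Structure_phi hα, KAlg.metric_phi_apply hα, KAlg.volForm_phi hα,
      KAlg.isTorsionForm_iff hα⟩,
    KAlg.deriv α, KAlg.toMatrix_deriv α, KAlg.satisfiesAS hα, KAlg.isAlgebraicSoliton_phi hα,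
    KAlg.exists_group α hα, fun G _ _ _ _ _ _ ψ X hX => KAlg.isLaplacianSoliton ψ hα X hX⟩
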